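/- **Notation.** Let $\mathbf t=(t_1,t_3,t_5,\dots)$, let $\sum_{m\ge0}q_m(\mathbf t)z^m=\exp\big(\sum_{k\text{ odd}}t_kz^k\big)$, and put $Q_{i,0}=\tfrac1{\sqrt2}q_i=-Q_{0,i}$ for $i\ge1$, and $Q_{i,j}=\tfrac12q_iq_j+\sum_{k=1}^{j}(-1)^kq_{i+k}q_{j-k}$ for $i,j\ge1$. A strict partition $\lambda$ is a finite set of positive integers; its augmentation $\lambda'=\{\lambda_1>\lambda_2>\dots>\lambda_{2\ell}\}\subset\mathbb Z_{\ge0}$ is $\lambda$ if $\lambda$ has an even number of parts, and $\lambda\cup\{0\}$ otherwise. The Schur $Q$-function is $Q_\lambda=\mathrm{Pf}(Q_{\lambda_i,\lambda_j})_{1\le i,j\le2\ell}$. Number rows and columns by $\dots,-2,-1,-0,+0,1,2,\dots$, and let $\tilde E_{x,y}$ be the matrix units and $E^\wedge_{x,y}=\tilde E_{x,y}-\tilde E_{y,x}$. Let $I_\lambda=\{-a:a\in\lambda'\}\cup\{+a:a\ge0,\ a\notin\lambda'\}$. For constants $r_{i,j}\in\mathbb C$ ($i,j\in I_\lambda$,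 $i>|j|$) let $$W_\lambda=\sum_{j>i\ge0}Q_{j,i}E^\wedge_{-i,-j}+\sum_{a\ge0,\,a\notin\lambda'}E^\wedge_{-a,+a}+\sum_{i,j\in I_\lambda,\ i>|j|}(-1)^{\min(0,j)}r_{i,j}E^\wedge_{i,j}+\sum_{j=1}^{\ell}E^\wedge_{\lambda_{2j},\lambda_{2j-1}}$$ (in the last sum the indices are the non-negative ones $+\lambda_k$). Let $W_\lambda^{(n)}$ be the truncation to the rows and columns $-n,\dots,-0,+0,\dots,n$, and let $\tau_{\lambda,r}(\mathbf t)=\mathrm{Pf}(W_\lambda)$ be the coefficientwise limit of $\mathrm{Pf}(W_\lambda^{(n)})$ in the ring of formal power series in $\mathbf t$. Let $V=V_n$ be the complex space with basis $e_{-n},\dots,e_n$ and the symmetric bilinear form $\Psi$ with $\Psi(e_i,e_{-i})=(-1)^i$ ($i\ge1$), $\Psi(e_0,e_0)=1$, and all other pairs of basis vectors orthogonal. It acts on $S=S_n=\bigwedge\langle e_{-1},\dots,e_{-n}\rangle$ by $\rho(e_{-i})=e_{-i}\wedge$, $\rho(e_i)=$ contraction with $\Psi(\cdot,e_i)$, and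 $\rho(e_0)=\tfrac1{\sqrt2}(-1)^{\deg}$. A nonzero $s\in S$ is a pure spinor if $s\in\rho(w_1)\cdots\rho(w_n)S$ for a basis $w_1,\dots,w_n$ of some $n$-dimensional totally isotropic subspace of $V$. The Cartan coordinates $\xi_\mu$ of $s$ are defined by $s=\sum_\mu\xi_\mu\,e_{-\mu_1}\wedge\dots\wedge e_{-\mu_k}$, the sum being over the strict partitions $\mu=(\mu_1>\dots>\mu_k)$ with parts in $\{1,\dots,n\}$. The Cartan–Plücker relations are, for all $\mu,\nu$, $$\sum_{i\in\mu\triangle\nu}(-1)^{\#\{j\in\mu:\,j>i\}+\#\{j\in\nu:\,j>i\}}\,\xi_{\mu\triangle\{i\}}\,\xi_{\nu\triangle\{i\}}=\begin{cases}\xi_\mu\xi_\nu&\text{if }|\mu|+|\nu|\text{ is odd},\\0&\text{otherwise,}\end{cases}$$ where $|\cdot|$ is the number of parts. An infinite pure spinor is a nonzero family $(\xi_\mu)$, indexed by all strict partitions, such that for every $n$ the subfamily of the $\mu$ with parts $\le n$ is zero or consists of the Cartan coordinates of a pure spinor in $S_n$. **Theorem.** 1. For every $\lambda$ and $r$ the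 limit $\tau_{\lambda,r}$ exists and has a unique Schur $Q$-expansion $\tau_{\lambda,r}=\sum_\mu\xi_\mu Q_\mu$, the sum being over all strict partitions. The coefficients $\xi_\mu$ satisfy all Cartan–Plücker relations and form an infinite pure spinor. For every $n$ not less than the parts of $\lambda$, $\mathrm{Pf}(W_\lambda^{(n)})=\sum_\mu\xi_\mu Q_\mu$, the sum being over the $\mu$ with parts $\le n$; these $\xi_\mu$ satisfy all Cartan–Plücker relations and are the Cartan coordinates of a pure spinor in $S_n$; and $$\xi_\mu=(-1)^{\sum_i\mu_i}\,\mathrm{Pf}\big(W_\lambda^{(n)}|_{\mathbf t=0}\text{ without the rows and columns }-m,\ m\in\mu'\big).$$ 2. Conversely, for every $n$ and every pure spinor $s\in S_n$ there are $\lambda$ with parts $\le n$, constants $r$, and $c\in\mathbb C^\times$ such that the Cartan coordinates of $s$ are $c\,\xi_\mu$, where $\xi_\mu$ are the coefficients of $\tau_{\lambda,r}$. Here $\lambda$, $c$ and the skew-symmetric matrix $A_s=W_\lambda^{(n)}|_{\mathbf t=0}$ are uniquely determined by $s$. As a result, there is an invertible diagonal matrix $D$ such that every Cartan coordinate of $s$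 is exactly the Pfaffian of a principal minor of the skew-symmetric matrix $DA_sD$: the coordinate with index $\mu$ is the Pfaffian of $DA_sD$ without the rows and columns $-m$, $m\in\mu'$. 3. Every infinite pure spinor is of the form $(c\,\xi_\mu)_\mu$, where $c\in\mathbb C^\times$ and the $\xi_\mu$ are the coefficients of some $\tau_{\lambda,r}$. -/

import Mathlib

open scoped MvPowerSeries.WithPiTopology

namespace BKP

noncomputable section

/-! ### Pfaffians -/

/-- The Pfaffian of the principal submatrix of the skew-symmetric matrix `A` whose rows and columns
are listed, in order, by a list of indices without repetition; it is given by the expansion along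
the first row. (The Pfaffian of the empty matrix is `1`, that of a matrix of odd size is `0`.) -/
def pf {R ι : Type*} [CommRing R] (A : Matrix ι ι R) : List ι → R
  | [] => 1
  | a :: l => ∑ k : Fin l.length, (-1) ^ (k : ℕ) * A a (l.get k) * pf A (l.eraseIdx k)
termination_by l => l.length
decreasing_by
  have h := k.isLt
  rw [List.length_eraseIdx_of_lt h]
  simp only [List.length_cons]
  omega

/-! ### Schur Q-functions

The polynomial ring in `t₁, t₃, t₅, …` is `MvPolynomial ℕ ℂ`, the variable `X k` being `t_{2k+1}`.
A strict partition is the finite set of its (positive, distinct) parts. -/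

/-- `θ(t, z) = ∑_{k odd} t_k z^k`. -/
def theta : PowerSeries (MvPolynomial ℕ ℂ) :=
  PowerSeries.mk fun k => if Odd k then MvPolynomial.X (k / 2) else 0

/-- `q_m(t)`, the coefficient of `z^m` in `exp θ(t, z) = ∑_j θ^j / j!`. As `θ` has no constant term,
only the terms with `j ≤ m` contribute. -/
def q (m : ℕ) : MvPolynomial ℕ ℂ :=
  ∑ j ∈ Finset.range (m + 1),
    MvPolynomial.C ((j.factorial : ℂ)⁻¹) * PowerSeries.coeff m (theta ^ j)

/-- The elementary Schur Q-functions `Q_{i,j}`, in the normalization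
`Q_{i,0} = q_i / √2 = - Q_{0,i}` and `Q_{i,j} = q_i q_j / 2 + ∑_{k=1}^{j} (-1)^k q_{i+k} q_{j-k}`
for `i, j ≥ 1`. -/
def elemQ : Matrix ℕ ℕ (MvPolynomial ℕ ℂ) := fun i j =>
  if j = 0 then
    if i = 0 then 0 else MvPolynomial.C ((Real.sqrt 2 : ℂ)⁻¹) * q i
  else if i = 0 then
    -(MvPolynomial.C ((Real.sqrt 2 : ℂ)⁻¹) * q j)
  else
    MvPolynomial.C (1 / 2) * q i * q j
      + ∑ k ∈ Finset.Icc 1 j, (-1) ^ k * q (i + k) * q (j - k)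

/-- The augmented strict partition: a part `0` is added when the number of parts is odd. -/
def aug (lam : Finset ℕ+) : Finset ℕ :=
  if Even lam.card then lam.image (fun i : ℕ+ => (i : ℕ)) else insert 0 (lam.image (fun i : ℕ+ => (i : ℕ)))

/-- The Schur Q-function `Q_λ`: the Pfaffian of `(Q_{λ_i, λ_j})`, with the parts of the augmented
partition in decreasing order. -/
def schurQ (lam : Finset ℕ+) : MvPolynomial ℕ ℂ :=
  pf elemQ ((aug lam).sort (fun a b => b ≤ a))

/-- Sum of the parts of a strict partition. -/
def size (lam : Finset ℕ+) : ℕ := ∑ i ∈ lam, (i : ℕ)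

/-! ### The skew-symmetric matrix `W_λ` and the `τ`-function

Rows and columns are numbered by `…, -2, -1, -0, +0, 1, 2, …`, where `Sum.inl k` is `-k` and
`Sum.inr k` is `+k`. The index sequence of `λ` consists of `-k` for `k` in the augmented `λ` and of
`+k` for the other `k ≥ 0`; the parameter `r_{i, ± j}`, with `i > j` and `± j` in the
index sequence, is `r i j`. Other values of `r` are not used. -/

/-- The number of parts that are larger than `a`; the `k`-th part has rank `k - 1`. -/
def rank (L : Finset ℕ) (a : ℕ) : ℕ := (L.filter fun x => a < x).card

/-- `U = ∑ (coefficient) E_{x, y}`, so that `W_λ = U - Uᵀ = ∑ (coefficient) (E_{x,y} - E_{y,x})`. -/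
def halfW (lam : Finset ℕ+) (r : ℕ → ℕ → ℂ) : Matrix (ℕ ⊕ ℕ) (ℕ ⊕ ℕ) (MvPolynomial ℕ ℂ)
  | Sum.inl i, Sum.inl j =>
      -- `Q_{j,i} E_{-i,-j}` for `j > i ≥ 0`
      if i < j then elemQ j i else 0
  | Sum.inl a, Sum.inr b =>
      -- `E_{-a,+a}` for `a` not in the augmented partition, `a = 0` included
      if a = b ∧ a ∉ aug lam then 1 else 0
  | Sum.inr a, Sum.inr b =>
      -- `r_{a,b} E_{a,b}` for `a > b ≥ 0` both outside the augmented partition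
      (if b < a ∧ a ∉ aug lam ∧ b ∉ aug lam then MvPolynomial.C (r a b) else 0)
      -- `E_{λ_{2j}, λ_{2j-1}}`
      + (if a ∈ aug lam ∧ b ∈ aug lam ∧ Even (rank (aug lam) b) ∧
            rank (aug lam) a = rank (aug lam) b + 1 then 1 else 0)
  | Sum.inr a, Sum.inl b =>
      -- `(-1)^b r_{a,-b} E_{a,-b}` for `a > b`, `a` outside and `b` in the augmented partition
      if b < a ∧ a ∉ aug lam ∧ b ∈ aug lam then MvPolynomial.C ((-1) ^ b * r a b) else 0

/-- The infinite skew-symmetric matrix `W_λ`. -/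
def matW (lam : Finset ℕ+) (r : ℕ → ℕ → ℂ) : Matrix (ℕ ⊕ ℕ) (ℕ ⊕ ℕ) (MvPolynomial ℕ ℂ) :=
  halfW lam r - (halfW lam r).transpose

/-- The complex skew-symmetric matrix `W_λ|_{t = 0}`. -/
def matW0 (lam : Finset ℕ+) (r : ℕ → ℕ → ℂ) : Matrix (ℕ ⊕ ℕ) (ℕ ⊕ ℕ) ℂ :=
  (matW lam r).map MvPolynomial.constantCoeff

/-- The indices `-n, …, -1, -0, +0, 1, …, n`, in this order. -/
def rows (n : ℕ) : List (ℕ ⊕ ℕ) :=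
  (List.range (n + 1)).reverse.map Sum.inl ++ (List.range (n + 1)).map Sum.inr

/-- The indices `-n, …, -0, +0, …, n` without the `-k` for `k` in the augmented partition `μ`. -/
def minorRows (n : ℕ) (mu : Finset ℕ+) : List (ℕ ⊕ ℕ) :=
  ((List.range (n + 1)).reverse.filter (fun k => k ∉ aug mu)).map Sum.inl
    ++ (List.range (n + 1)).map Sum.inr

/-- The Pfaffian of the `(2n+2) × (2n+2)` truncation of `W_λ`. -/
def tauTrunc (lam : Finset ℕ+) (r : ℕ → ℕ → ℂ) (n : ℕ) : MvPolynomial ℕ ℂ :=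
  pf (matW lam r) (rows n)

/-- `τ` is the Pfaffian of the infinite matrix `W_λ`: the coefficientwise limit, in the ring of
formal power series in `t₁, t₃, …`, of the Pfaffians of its truncations. -/
def IsBKPTau (lam : Finset ℕ+) (r : ℕ → ℕ → ℂ) (τ : MvPowerSeries ℕ ℂ) : Prop :=
  Filter.Tendsto (fun n => (tauTrunc lam r n : MvPowerSeries ℕ ℂ)) Filter.atTop (nhds τ)

/-- `τ = ∑_μ ξ_μ Q_μ`, the sum being over all strict partitions, coefficientwise convergent. -/
def IsSchurQExpansion (τ : MvPowerSeries ℕ ℂ) (ξ : Finset ℕ+ → ℂ) : Prop :=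
  HasSum (fun mu => ξ mu • (schurQ mu : MvPowerSeries ℕ ℂ)) τ

/-! ### Spinors

`V n` is the complex quadratic space with basis `e_{-n}, …, e_{-1}, e_0, e_1, …, e_n`. A vector is
given by its coordinates `((x_{-1}, …, x_{-n}), x_0, (x_1, …, x_n))`, and `i : Fin n` stands for the
index `i + 1`. -/

/-- The `(2n+1)`-dimensional space `V`. -/
abbrev V (n : ℕ) : Type := (Fin n → ℂ) × ℂ × (Fin n → ℂ)

/-- The symmetric bilinear form on `V` with `Ψ(e_i, e_{-i}) = (-1)^i` for `i ≥ 1`,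
`Ψ(e_0, e_0) = 1`, and `Ψ = 0` on all other pairs of basis vectors. -/
def psi (n : ℕ) (x y : V n) : ℂ :=
  x.2.1 * y.2.1 + ∑ i : Fin n, (-1) ^ ((i : ℕ) + 1) * (x.1 i * y.2.2 i + x.2.2 i * y.1 i)

/-- The space of spinors: the exterior algebra of the span of `e_{-1}, …, e_{-n}`. -/
abbrev S (n : ℕ) : Type := ExteriorAlgebra ℂ (Fin n → ℂ)

/-- The linear form `a ↦ Ψ(a, ∑_i y_i e_i)` on the span of `e_{-1}, …, e_{-n}`. -/
def pairing (n : ℕ) (y : Fin n → ℂ) : Module.Dual ℂ (Fin n → ℂ) :=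
  ∑ i : Fin n, ((-1) ^ ((i : ℕ) + 1) * y i) • LinearMap.proj i

/-- Clifford multiplication `ρ(x)` on spinors: `e_{-i}` acts as exterior multiplication, `e_i` as
the contraction (antiderivation) with `Ψ(·, e_i)`, and `e_0` as `(-1)^degree / √2`. -/
def rho (n : ℕ) (x : V n) : Module.End ℂ (S n) :=
  LinearMap.mulLeft ℂ (ExteriorAlgebra.ι ℂ x.1)
    + ((Real.sqrt 2 : ℂ)⁻¹ * x.2.1) • (CliffordAlgebra.involute :
        S n →ₐ[ℂ] S n).toLinearMap
    + CliffordAlgebra.contractLeft (pairing n x.2.2)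

/-- A pure spinor: a nonzero element of `ρ(w_1) ⋯ ρ(w_n) S` for a basis `w_1, …, w_n` of a
Lagrangian (`n`-dimensional totally isotropic) subspace of `V`. -/
def IsPureSpinor (n : ℕ) (s : S n) : Prop :=
  s ≠ 0 ∧ ∃ w : Fin n → V n, LinearIndependent ℂ w ∧ (∀ i j, psi n (w i) (w j) = 0) ∧
    ∃ u : S n, s = (List.ofFn fun i => rho n (w i)).prod u

/-- `e_{-i_1} ∧ ⋯ ∧ e_{-i_k}` for the set `{i_1 > ⋯ > i_k}`. -/
def wedge (n : ℕ) (mu : Finset (Fin n)) : S n :=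
  ((mu.sort (fun a b => b ≤ a)).map
    fun i => ExteriorAlgebra.ι ℂ (Pi.single i (1 : ℂ) : Fin n → ℂ)).prod

/-- The spinor with Cartan coordinates `x`. -/
def cartanSpinor (n : ℕ) (x : Finset (Fin n) → ℂ) : S n := ∑ mu, x mu • wedge n mu

/-- A set of indices `i : Fin n`, each standing for `i + 1`, as a strict partition with parts in
`{1, …, n}`. -/
def toPartition (n : ℕ) (mu : Finset (Fin n)) : Finset ℕ+ :=
  mu.image fun i : Fin n => Nat.succPNat (i : ℕ)

/-- The coordinates `ξ_μ` with all parts of `μ` at most `n`. -/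
def restrict (n : ℕ) (ξ : Finset ℕ+ → ℂ) (mu : Finset (Fin n)) : ℂ := ξ (toPartition n mu)

/-- The infinite-dimensional version: a nonzero family indexed by all strict partitions, each
restriction of which to the partitions with parts at most `n` is zero or consists of the Cartan
coordinates of a pure spinor. -/
def IsPureSpinorInf (ξ : Finset ℕ+ → ℂ) : Prop :=
  ξ ≠ 0 ∧ ∀ n, restrict n ξ = 0 ∨ IsPureSpinor n (cartanSpinor n (restrict n ξ))

/-- The Cartan–Plücker relations between Cartan coordinates, that is, the equation
`∑_α ρ(v_α) s ⊗ ρ(v^α) s = (1/2) s ⊗ s`, for dual bases `v_α`, `v^α` of `V`, written in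
coordinates: for all `μ`, `ν`,
`∑_{i ∈ μ ∆ ν} (-1)^{#{j ∈ μ | j > i} + #{j ∈ ν | j > i}} x_{μ ∆ {i}} x_{ν ∆ {i}}`
equals `x_μ x_ν` if `|μ| + |ν|` is odd, and `0` otherwise. -/
def CartanPlucker {α : Type*} [LinearOrder α] (x : Finset α → ℂ) : Prop :=
  ∀ mu nu : Finset α,
    ∑ i ∈ symmDiff mu nu,
      (-1) ^ ((mu.filter fun j => i < j).card + (nu.filter fun j => i < j).card)
        * x (symmDiff mu {i}) * x (symmDiff nu {i})
      = if Odd (mu.card + nu.card) then x mu * x nu else 0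

end

end BKP

namespace BKP

section Pfaffian

variable {R ι : Type*} [CommRing R]

/-- The contraction `∑_k (-1)^k d(l_k) g(l without l_k)` of a function of lists with a covector. -/
def contract (d : ι → R) : List ι → (List ι → R) → R
  | [], _ => 0
  | a :: l, g => d a * g l - contract d l fun l' => g (a :: l')

theorem contract_eq_sum (d : ι → R) (l : List ι) (g : List ι → R) :
    contract d l g = ∑ k : Fin l.length, (-1) ^ (k : ℕ) * d (l.get k) * g (l.eraseIdx k) := by
  induction l generalizing g with
  | nil => simp [contract]
  | cons a l ih =>
    rw [contract, ih]
    simp only [List.length_cons, Fin.sum_univ_succ]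
    simp [pow_succ, sub_eq_add_neg]

theorem pf_nil (A : Matrix ι ι R) : pf A [] = 1 := by
  rw [pf]

theorem pf_cons (A : Matrix ι ι R) (a : ι) (l : List ι) :
    pf A (a :: l) = contract (A a) l (pf A) := by
  rw [pf, contract_eq_sum]

/-- Contractions only depend on the values at the lists of smaller length with the same entries. -/
theorem contract_congr {d d' : ι → R} {l : List ι} {g g' : List ι → R}
    (hd : ∀ a ∈ l, d a = d' a)
    (hg : ∀ l' : List ι, l'.Sublist l → l'.length + 1 = l.length → g l' = g' l') :
    contract d l g = contract d' l g' := by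
  induction l generalizing g g' with
  | nil => rfl
  | cons a l ih =>
    rw [contract, contract, hd a (by simp), hg l (by simp) (by simp)]
    rw [ih (fun b hb => hd b (by simp [hb]))]
    intro l' h h'
    exact hg _ (h.cons_cons a) (by simp [h'])

theorem contract_zero {d : ι → R} {l : List ι} {g : List ι → R} (hd : ∀ a ∈ l, d a = 0) :
    contract d l g = 0 := by
  induction l generalizing g with
  | nil => rfl
  | cons a l ih => rw [contract, hd a (by simp), ih fun b hb => hd b (by simp [hb])]; simp

theorem contract_add (d : ι → R) (l : List ι) (g g' : List ι → R) :
    contract d l (fun l' => g l' + g' l') = contract d l g + contract d l g' := by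
  induction l generalizing g g' with
  | nil => simp [contract]
  | cons a l ih => rw [contract, contract, contract, ih]; ring

theorem contract_add_left (d d' : ι → R) (l : List ι) (g : List ι → R) :
    contract (d + d') l g = contract d l g + contract d' l g := by
  induction l generalizing g with
  | nil => simp [contract]
  | cons a l ih => rw [contract, contract, contract, ih]; simp only [Pi.add_apply]; ring

theorem contract_mul (d : ι → R) (l : List ι) (g : List ι → R) (c : R) :
    contract d l (fun l' => c * g l') = c * contract d l g := by
  induction l generalizing g with
  | nil => simp [contract]
  | cons a l ih => rw [contract, contract, ih]; ring

theorem contract_mul_right (d : ι → R) (l : List ι) (g : List ι → R) (c : R) :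
    contract d l (fun l' => g l' * c) = contract d l g * c := by
  rw [mul_comm, ← contract_mul]; simp only [mul_comm]

theorem contract_neg (d : ι → R) (l : List ι) (g : List ι → R) :
    contract d l (fun l' => -g l') = -contract d l g := by
  have := contract_mul d l g (-1)
  simpa using this

theorem contract_sub (d : ι → R) (l : List ι) (g g' : List ι → R) :
    contract d l (fun l' => g l' - g' l') = contract d l g - contract d l g' := by
  simp only [sub_eq_add_neg, contract_add, contract_neg]

theorem contract_append (d : ι → R) (l m : List ι) (g : List ι → R) :
    contract d (l ++ m) g = contract d l (fun l' => g (l' ++ m))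
      + (-1) ^ l.length * contract d m fun m' => g (l ++ m') := by
  induction l generalizing g with
  | nil => simp [contract]
  | cons a l ih =>
    rw [List.cons_append, contract, contract, ih]
    simp only [List.cons_append, List.length_cons, pow_succ]
    ring

theorem contract_map {κ : Type*} (f : κ → ι) (d : ι → R) (l : List κ) (g : List ι → R) :
    contract d (l.map f) g = contract (d ∘ f) l fun l' => g (l'.map f) := by
  induction l generalizing g with
  | nil => rfl
  | cons a l ih => simp [contract, ih]

theorem contract_comm (d e : ι → R) (l : List ι) (g : List ι → R) :
    (contract d l fun l' => contract e l' g) = -contract e l fun l' => contract d l' g := by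
  induction l generalizing g with
  | nil => simp [contract]
  | cons a l ih =>
    rw [contract, contract]
    simp only [contract, contract_sub, contract_mul, ih]
    ring

theorem pf_swap {A : Matrix ι ι R} (hA : ∀ a b, A a b = -A b a) (l m : List ι) (a b : ι) :
    pf A (l ++ a :: b :: m) = -pf A (l ++ b :: a :: m) := by
  induction hn : l.length + m.length using Nat.strong_induction_on generalizing l m with
  | _ n ih =>
  cases l with
  | nil =>
    simp only [List.nil_append, pf_cons, contract]
    rw [hA a b, contract_comm]
    ring
  | cons c l =>
    simp only [List.cons_append, pf_cons, contract_append, contract]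
    rw [contract_congr (d' := A c) (g' := fun l' => -pf A (l' ++ b :: a :: m)) (fun _ _ => rfl)
      fun l' _ hl => ih _ (by simp at hn; omega) l' m rfl]
    rw [contract_congr (l := m) (d' := A c) (g' := fun m' => -pf A (l ++ b :: a :: m'))
      (fun _ _ => rfl) fun m' _ h => ih _ (by simp at hn; omega) l m' rfl]
    simp only [contract_neg]
    ring

theorem pf_move {A : Matrix ι ι R} (hA : ∀ a b, A a b = -A b a) (l m : List ι) (a : ι) :
    pf A (a :: (l ++ m)) = (-1) ^ l.length * pf A (l ++ a :: m) := by
  induction l using List.reverseRecOn generalizing m with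
  | nil => simp
  | append_singleton l b ih =>
    rw [List.append_assoc, ih, List.append_assoc]
    simp only [List.cons_append, List.nil_append, List.length_append, List.length_singleton,
      pow_succ]
    rw [pf_swap hA]
    ring

theorem pf_cons_of_mem [IsDomain R] [CharZero R] {A : Matrix ι ι R} (hA : ∀ a b, A a b = -A b a)
    {l : List ι} {a : ι} (h : a ∈ l) : pf A (a :: l) = 0 := by
  obtain ⟨s, t, rfl⟩ := List.append_of_mem h
  rw [pf_move hA]
  have : pf A (s ++ a :: a :: t) = -pf A (s ++ a :: a :: t) := pf_swap hA s t a a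
  rw [self_eq_neg.mp this, mul_zero]

/-- Two functions agree up to a global sign. -/
def EqUpToSign {X : Type*} (f g : X → R) : Prop :=
  ∃ ε : R, (ε = 1 ∨ ε = -1) ∧ ∀ x, f x = ε * g x

section EqUpToSign

variable {X : Type*}

theorem EqUpToSign.refl (f : X → R) : EqUpToSign f f := ⟨1, Or.inl rfl, fun x => by simp⟩

theorem EqUpToSign.trans {f g h : X → R} (H : EqUpToSign f g) (H' : EqUpToSign g h) :
    EqUpToSign f h := by
  obtain ⟨ε, hε, H⟩ := H
  obtain ⟨ε', hε', H'⟩ := H'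
  refine ⟨ε * ε', ?_, fun x => by rw [H, H', mul_assoc]⟩
  rcases hε with rfl | rfl <;> rcases hε' with rfl | rfl <;> simp

theorem eqUpToSign_neg_one_pow_mul (k : ℕ) (f : X → R) :
    EqUpToSign (fun x => (-1) ^ k * f x) f :=
  ⟨(-1) ^ k, neg_one_pow_eq_or R k, fun _ => rfl⟩

variable {A : X → Matrix ι ι R}

theorem pf_append_perm (hA : ∀ x a b, A x a b = -A x b a) {m m' : List ι}
    (h : m.Perm m') (l : List ι) :
    EqUpToSign (fun x => pf (A x) (l ++ m)) fun x => pf (A x) (l ++ m') := by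
  induction h generalizing l with
  | nil => exact .refl _
  | cons a _ ih =>
    have := ih (l ++ [a])
    simpa using this
  | swap a b m => exact ⟨-1, Or.inr rfl, fun x => by simpa using pf_swap (hA x) l m b a⟩
  | trans _ _ ih ih' => exact (ih l).trans (ih' l)

theorem pf_perm (hA : ∀ x a b, A x a b = -A x b a) {m m' : List ι} (h : m.Perm m') :
    EqUpToSign (fun x => pf (A x) m) fun x => pf (A x) m' := pf_append_perm hA h []

theorem pf_cons_cons {A : Matrix ι ι R} {a b : ι} {l : List ι} (h : ∀ c ∈ l, A a c = 0) :
    pf A (a :: b :: l) = A a b * pf A l := by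
  rw [pf_cons, contract, contract_zero h, sub_zero]

/-- Expansion along a row with only one entry. -/
theorem pf_of_perm_cons_cons (hA : ∀ x a b, A x a b = -A x b a) {a b : ι}
    {l m : List ι} (hm : m.Perm (a :: b :: l)) (h : ∀ x, ∀ c ∈ l, A x a c = 0) :
    EqUpToSign (fun x => pf (A x) m) fun x => A x a b * pf (A x) l := by
  simp only [← pf_cons_cons (h _)]
  exact pf_perm hA hm

theorem pf_of_row_eq_zero {A : Matrix ι ι R} (hA : ∀ a b, A a b = -A b a) {a : ι}
    {l m : List ι} (hm : m.Perm (a :: l)) (h : ∀ c ∈ l, A a c = 0) : pf A m = 0 := by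
  obtain ⟨ε, -, H⟩ := pf_perm (A := fun _ : Unit => A) (fun _ => hA) hm
  have := H ()
  simp only [pf_cons, contract_zero h, mul_zero] at this
  exact this

end EqUpToSign

theorem pf_congr {A B : Matrix ι ι R} {l : List ι} (h : ∀ a ∈ l, ∀ b ∈ l, A a b = B a b) :
    pf A l = pf B l := by
  induction hn : l.length using Nat.strong_induction_on generalizing l with
  | _ n ih =>
  cases l with
  | nil => rw [pf_nil, pf_nil]
  | cons a l =>
    rw [pf_cons, pf_cons]
    refine contract_congr (fun b hb => h a (by simp) b (by simp [hb])) fun l' hs hl => ?_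
    exact ih l'.length (by simp at hn; omega)
      (fun a ha b hb => h a (by simp [hs.subset ha]) b (by simp [hs.subset hb])) rfl

theorem map_contract {R' : Type*} [CommRing R'] (φ : R →+* R') (d : ι → R) (l : List ι)
    (g : List ι → R) : φ (contract d l g) = contract (φ ∘ d) l (φ ∘ g) := by
  induction l generalizing g with
  | nil => simp [contract]
  | cons a l ih => simp [contract, ih, Function.comp_def]

theorem map_pf {R' : Type*} [CommRing R'] (φ : R →+* R') (A : Matrix ι ι R) (l : List ι) :
    φ (pf A l) = pf (A.map φ) l := by
  induction hn : l.length using Nat.strong_induction_on generalizing l with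
  | _ n ih =>
  cases l with
  | nil => simp [pf_nil]
  | cons a l =>
    rw [pf_cons, pf_cons, map_contract]
    exact contract_congr (fun _ _ => rfl) fun l' _ hl => ih _ (by simp at hn; omega) l' rfl

theorem pf_map {κ : Type*} (f : κ → ι) (A : Matrix ι ι R) (l : List κ) :
    pf A (l.map f) = pf (A.submatrix f f) l := by
  induction hn : l.length using Nat.strong_induction_on generalizing l with
  | _ n ih =>
  cases l with
  | nil => simp [pf_nil]
  | cons a l =>
    rw [List.map_cons, pf_cons, pf_cons, contract_map]
    exact contract_congr (fun _ _ => rfl) fun l' _ hl => ih _ (by simp at hn; omega) l' rfl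

theorem contract_scale (d e : ι → R) (l : List ι) (g : List ι → R) :
    contract (fun b => d b * e b) l (fun l' => (l'.map e).prod * g l')
      = (l.map e).prod * contract d l g := by
  induction l generalizing g with
  | nil => simp [contract]
  | cons a l ih =>
    have := ih fun l' => g (a :: l')
    simp only [contract, List.map_cons, List.prod_cons, mul_assoc, contract_mul, this]
    ring

theorem pf_scale (A : Matrix ι ι R) (d : ι → R) (l : List ι) :
    pf (Matrix.of fun a b => d a * A a b * d b) l = (l.map d).prod * pf A l := by
  induction hn : l.length using Nat.strong_induction_on generalizing l with
  | _ n ih =>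
  cases l with
  | nil => simp [pf_nil]
  | cons a l =>
    rw [pf_cons, pf_cons, List.map_cons, List.prod_cons, mul_assoc, ← contract_scale,
      ← contract_mul]
    rw [contract_congr (fun _ _ => rfl)
      fun l' _ hl => ih l'.length (by simp at hn; omega) l' rfl]
    clear ih hn
    rw [contract_mul]
    have : ∀ g : List ι → R, contract (fun b => d a * A a b * d b) l g
        = d a * contract (fun b => A a b * d b) l g := by
      intro g
      induction l generalizing g with
      | nil => simp [contract]
      | cons b l ih => rw [contract, contract, ih]; ring
    exact this _

theorem pf_odd (A : Matrix ι ι R) (l : List ι) (h : Odd l.length) : pf A l = 0 := by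
  induction hn : l.length using Nat.strong_induction_on generalizing l with
  | _ n ih =>
  cases l with
  | nil => simp at h
  | cons a l =>
    rw [pf_cons, contract_congr (d' := A a) (g' := fun _ => 0 * 0) (fun _ _ => rfl), contract_mul,
      zero_mul]
    intro l' _ hl
    rw [mul_zero]
    refine ih _ (by simp at hn; omega) l' ?_ rfl
    rw [List.length_cons, ← hl] at h
    rcases h with ⟨k, hk⟩
    exact ⟨k - 1, by omega⟩

theorem contract_contract_skew {A : Matrix ι ι R} (hA : ∀ a b, A a b = -A b a) (l m : List ι)
    (f g : List ι → R) :
    ∑ p : Fin l.length, (-1) ^ (p : ℕ) * contract (A (l.get p)) m g * f (l.eraseIdx p)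
      + ∑ p : Fin m.length, (-1) ^ (p : ℕ) * contract (A (m.get p)) l f * g (m.eraseIdx p) = 0 := by
  simp only [contract_eq_sum, Finset.mul_sum, Finset.sum_mul]
  rw [Finset.sum_comm, ← Finset.sum_add_distrib]
  refine Finset.sum_eq_zero fun p _ => ?_
  rw [← Finset.sum_add_distrib]
  refine Finset.sum_eq_zero fun k _ => ?_
  rw [hA (l.get k)]
  ring

/-- The quadratic relations between the Pfaffians of principal minors. -/
theorem pf_plucker {A : Matrix ι ι R} (hA : ∀ a b, A a b = -A b a) (l m : List ι) :
    ∑ p : Fin l.length, (-1) ^ (p : ℕ) * pf A (l.get p :: m) * pf A (l.eraseIdx p)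
      + ∑ p : Fin m.length, (-1) ^ (p : ℕ) * pf A (m.get p :: l) * pf A (m.eraseIdx p) = 0 := by
  simp only [pf_cons]
  exact contract_contract_skew hA l m _ _

/-! ### Pfaffians of sums -/

/-- The sum of `± f K C` over all ways to split a list into sublists `K`, `C`, with the sign of the
shuffle. -/
def shuffle : List ι → (List ι → List ι → R) → R
  | [], f => f [] []
  | a :: l, f => shuffle l (fun K C => f (a :: K) C)
      + shuffle l fun K C => (-1) ^ K.length * f K (a :: C)

theorem shuffle_add (l : List ι) (f f' : List ι → List ι → R) :
    shuffle l (fun K C => f K C + f' K C) = shuffle l f + shuffle l f' := by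
  induction l generalizing f f' with
  | nil => rfl
  | cons a l ih => simp only [shuffle, mul_add, ih]; ring

theorem shuffle_mul (l : List ι) (f : List ι → List ι → R) (c : R) :
    shuffle l (fun K C => c * f K C) = c * shuffle l f := by
  induction l generalizing f with
  | nil => rfl
  | cons a l ih => simp only [shuffle, mul_left_comm _ c, ih, mul_add]

theorem shuffle_neg (l : List ι) (f : List ι → List ι → R) :
    shuffle l (fun K C => -f K C) = -shuffle l f := by
  simpa using shuffle_mul l f (-1)

theorem shuffle_sub (l : List ι) (f f' : List ι → List ι → R) :
    shuffle l (fun K C => f K C - f' K C) = shuffle l f - shuffle l f' := by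
  simp only [sub_eq_add_neg, shuffle_add, shuffle_neg]

theorem shuffle_congr {l : List ι} {f f' : List ι → List ι → R}
    (h : ∀ K C, K.length + C.length = l.length → f K C = f' K C) : shuffle l f = shuffle l f' := by
  induction l generalizing f f' with
  | nil => exact h [] [] rfl
  | cons a l ih =>
    exact congrArg₂ (· + ·) (ih fun K C hl => h _ _ (by simp; omega))
      (ih fun K C hl => by rw [h _ _ (by simp; omega)])

theorem contract_shuffle_left (d : ι → R) (l : List ι) (f : List ι → List ι → R) :
    (contract d l fun l' => shuffle l' f)
      = shuffle l fun K C => contract d K fun K' => f K' C := by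
  induction l generalizing f with
  | nil => simp [contract, shuffle]
  | cons a l ih =>
    simp only [contract, shuffle, shuffle_sub, contract_add, ih, shuffle_mul]
    have key : (shuffle l fun K C => contract d K fun K' => (-1) ^ K'.length * f K' (a :: C))
        = -shuffle l fun K C => (-1) ^ K.length * contract d K fun K' => f K' (a :: C) := by
      rw [← shuffle_neg]
      refine shuffle_congr fun K C _ => ?_
      rw [← contract_mul, ← contract_neg]
      refine contract_congr (fun _ _ => rfl) fun K' _ h => ?_
      rw [← h, pow_succ]
      ring
    rw [key]
    ring

theorem contract_shuffle_right (d : ι → R) (l : List ι) (f : List ι → List ι → R) :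
    (contract d l fun l' => shuffle l' f)
      = shuffle l fun K C => (-1) ^ K.length * contract d C fun C' => f K C' := by
  induction l generalizing f with
  | nil => simp [contract, shuffle]
  | cons a l ih =>
    have sq : ∀ (K : List ι) (x : R), (-1) ^ K.length * ((-1) ^ K.length * x) = x := by
      intro K x
      rw [← mul_assoc, ← mul_pow]
      simp
    simp only [contract, shuffle, contract_add, ih, shuffle_sub, List.length_cons, mul_sub, sq,
      shuffle_mul, pow_succ, mul_neg, mul_one, neg_mul, shuffle_neg, contract_mul]
    ring

/-- The Pfaffian of a sum of two matrices, the first of which only has entries with row and column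
in an initial part of the list of indices. -/
theorem pf_add (A B : Matrix ι ι R) (l m : List ι) (hA : ∀ a ∈ l, ∀ b ∈ m, A a b = 0)
    (hA' : ∀ a ∈ m, ∀ b ∈ m, A a b = 0) :
    pf (A + B) (l ++ m) = shuffle l fun K C => pf A K * pf B (C ++ m) := by
  induction hn : l.length + m.length using Nat.strong_induction_on generalizing l m with
  | _ n ih =>
  cases l with
  | nil =>
    rw [List.nil_append, shuffle, pf_nil, one_mul, List.nil_append]
    exact pf_congr fun a ha b hb => by rw [Matrix.add_apply, hA' a ha b hb, zero_add]
  | cons a l =>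
    have h1 : ∀ d : ι → R, contract d l (fun l' => pf (A + B) (l' ++ m))
        = contract d l fun l' => shuffle l' fun K C => pf A K * pf B (C ++ m) := fun d =>
      contract_congr (fun _ _ => rfl) fun l' hs hl => ih _ (by simp at hn; omega) l' m
        (fun a ha => hA a (by simp [hs.subset ha])) hA' rfl
    have h2 : contract (B a) m (fun m' => pf (A + B) (l ++ m'))
        = contract (B a) m fun m' => shuffle l fun K C => pf A K * pf B (C ++ m') :=
      contract_congr (fun _ _ => rfl) fun m' hs hl => ih _ (by simp at hn; omega) l m'
        (fun a ha b hb => hA a (by simp [ha]) b (hs.subset hb))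
        (fun a ha b hb => hA' a (hs.subset ha) b (hs.subset hb)) rfl
    have h3 : ∀ (d : ι → R) (m : List ι) (f : List ι → List ι → List ι → R),
        (contract d m fun m' => shuffle l fun K C => f K C m')
          = shuffle l fun K C => contract d m fun m' => f K C m' := by
      intro d m f
      induction m generalizing f with
      | nil => simpa [contract] using (shuffle_mul l (fun _ _ => (0 : R)) 0).symm
      | cons b m ihm => simp only [contract, ihm, shuffle_sub, shuffle_mul]
    have h4 : contract (A a) m (fun m' => pf (A + B) (l ++ m')) = 0 :=
      contract_zero fun b hb => hA a (by simp) b hb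
    have hrow : (A + B) a = A a + B a := rfl
    rw [List.cons_append, pf_cons, hrow, contract_append, contract_add_left, contract_add_left, h4,
      h1, h1, h2, h3, contract_shuffle_left, contract_shuffle_right, zero_add, add_assoc, shuffle]
    congr 1
    · refine shuffle_congr fun K C _ => ?_
      rw [pf_cons, contract_mul_right]
    · rw [← shuffle_mul, ← shuffle_add]
      refine shuffle_congr fun K C hl => ?_
      rw [List.cons_append, pf_cons, contract_append, contract_mul, contract_mul, ← hl, pow_add]
      ring

end Pfaffian
end BKP

namespace BKP

section Pfaffian

variable {R ι : Type*} [CommRing R]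

theorem pf_congr_of_pairwise {A B : Matrix ι ι R} {l : List ι}
    (h : l.Pairwise fun a b => A a b = B a b) : pf A l = pf B l := by
  induction hn : l.length using Nat.strong_induction_on generalizing l with
  | _ n ih =>
  cases l with
  | nil => rw [pf_nil, pf_nil]
  | cons a l =>
    rw [pf_cons, pf_cons]
    rw [List.pairwise_cons] at h
    exact contract_congr h.1 fun l' hs hl => ih l'.length (by simp at hn; omega) (h.2.sublist hs) rfl

theorem contract_neg_left (d : ι → R) (l : List ι) (g : List ι → R) :
    contract (-d) l g = -contract d l g := by
  induction l generalizing g with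
  | nil => simp [contract]
  | cons a l ih => simp only [contract, ih, Pi.neg_apply]; ring

theorem pf_neg (A : Matrix ι ι R) (l : List ι) :
    pf (-A) l = (-1) ^ (l.length / 2) * pf A l := by
  induction hn : l.length using Nat.strong_induction_on generalizing l with
  | _ n ih =>
  cases l with
  | nil => simp [pf_nil, ← hn]
  | cons a l =>
    cases l with
    | nil => simp [pf_cons, contract]
    | cons b l =>
      have hrow : (-A) a = -(A a) := rfl
      rw [pf_cons, pf_cons, hrow, contract_neg_left,
        contract_congr (d' := A a) (g' := fun l' => (-1) ^ (l.length / 2) * pf A l')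
          (fun _ _ => rfl), contract_mul, ← neg_mul]
      · simp only [List.length_cons] at hn
        rw [← hn, show (l.length + 1 + 1) / 2 = l.length / 2 + 1 by omega, pow_succ]
        ring
      · intro l' _ hl
        simp only [List.length_cons] at hl hn
        rw [ih l'.length (by omega) l' rfl, show l'.length = l.length by omega]

/-- The elements of `{0, …, n - 1}` outside of a set, in decreasing order. -/
def descCompl (n : ℕ) (K : Finset ℕ) : List ℕ := (List.range n).reverse.filter fun k => k ∉ K

/-- The elements of `{0, …, n - 1}` in a set, in decreasing order. -/
def descIn (n : ℕ) (K : Finset ℕ) : List ℕ := (List.range n).reverse.filter fun k => k ∈ K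

theorem descCompl_succ (n : ℕ) (K : Finset ℕ) :
    descCompl (n + 1) K = if n ∈ K then descCompl n K else n :: descCompl n K := by
  unfold descCompl
  rw [List.range_succ, List.reverse_append, List.reverse_singleton, List.singleton_append,
    List.filter_cons]
  split_ifs <;> simp_all

theorem descIn_succ (n : ℕ) (K : Finset ℕ) :
    descIn (n + 1) K = if n ∈ K then n :: descIn n K else descIn n K := by
  unfold descIn
  rw [List.range_succ, List.reverse_append, List.reverse_singleton, List.singleton_append,
    List.filter_cons]
  split_ifs <;> simp_all

theorem mem_descCompl {n k : ℕ} {K : Finset ℕ} : k ∈ descCompl n K ↔ k < n ∧ k ∉ K := by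
  simp [descCompl]

theorem mem_descIn {n k : ℕ} {K : Finset ℕ} : k ∈ descIn n K ↔ k < n ∧ k ∈ K := by
  simp [descIn]

theorem descCompl_congr {n : ℕ} {K K' : Finset ℕ} (h : ∀ k < n, k ∈ K ↔ k ∈ K') :
    descCompl n K = descCompl n K' := by
  unfold descCompl
  refine List.filter_congr fun k hk => ?_
  simp only [List.mem_reverse, List.mem_range] at hk
  simp [h k hk]

theorem descIn_congr {n : ℕ} {K K' : Finset ℕ} (h : ∀ k < n, k ∈ K ↔ k ∈ K') :
    descIn n K = descIn n K' := by
  unfold descIn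
  refine List.filter_congr fun k hk => ?_
  simp only [List.mem_reverse, List.mem_range] at hk
  simp [h k hk]

theorem pairwise_descIn (n : ℕ) (K : Finset ℕ) : (descIn n K).Pairwise fun a b => b < a := by
  refine List.Pairwise.filter _ ?_
  rw [List.pairwise_reverse]
  exact List.pairwise_lt_range

theorem sort_eq_descIn {n : ℕ} {K : Finset ℕ} (h : ∀ k ∈ K, k < n) :
    K.sort (fun a b => b ≤ a) = descIn n K := by
  refine List.Perm.eq_of_pairwise (le := fun a b => b ≤ a) (fun a b _ _ h h' => le_antisymm h' h)
    (Finset.pairwise_sort _ _)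
    ((pairwise_descIn n K).imp fun h => h.le) ?_
  rw [List.perm_ext_iff_of_nodup (Finset.sort_nodup _ _)
    ((pairwise_descIn n K).imp fun h => h.ne')]
  intro a
  rw [Finset.mem_sort, mem_descIn]
  exact ⟨fun ha => ⟨h a ha, ha⟩, fun ha => ha.2⟩

/-- The number of `j < n` outside of `K` that are larger than `i`. -/
def complRank (n : ℕ) (K : Finset ℕ) (i : ℕ) : ℕ :=
  ((Finset.range n).filter fun j => j ∉ K ∧ i < j).card

theorem complRank_succ {n i : ℕ} (K : Finset ℕ) (h : i < n) :
    complRank (n + 1) K i = if n ∈ K then complRank n K i else complRank n K i + 1 := by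
  unfold complRank
  rw [Finset.range_add_one, Finset.filter_insert]
  split_ifs <;> simp_all

theorem complRank_self (n : ℕ) (K : Finset ℕ) : complRank (n + 1) K n = 0 := by
  unfold complRank
  rw [Finset.card_eq_zero, Finset.filter_eq_empty_iff]
  intro j hj
  simp at hj
  omega

theorem complRank_add_rank {n i : ℕ} {K : Finset ℕ} (h : ∀ k ∈ K, k < n) :
    complRank n K i + (K.filter fun j => i < j).card = n - 1 - i := by
  unfold complRank
  rw [← Finset.card_union_of_disjoint]
  · rw [show n - 1 - i = (Finset.Ico (i + 1) n).card by simp; omega]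
    congr 1
    ext j
    simp only [Finset.mem_union, Finset.mem_filter, Finset.mem_range, Finset.mem_Ico]
    have := h j
    by_cases hj : j ∈ K <;> simp_all; omega
  · rw [Finset.disjoint_left]
    intro j
    simp only [Finset.mem_filter]
    tauto

theorem contract_descCompl (d : ℕ → R) (n : ℕ) (K : Finset ℕ) (g : List ℕ → R) :
    contract d (descCompl n K) g = ∑ i ∈ (Finset.range n).filter (fun i => i ∉ K),
      (-1) ^ complRank n K i * d i * g (descCompl n (insert i K)) := by
  induction n generalizing g with
  | zero => simp [descCompl, contract]
  | succ n ih =>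
    rw [descCompl_succ, Finset.range_add_one, Finset.filter_insert]
    by_cases hn : n ∈ K
    · simp only [hn, if_true, not_true, if_false, ih]
      refine Finset.sum_congr rfl fun i hi => ?_
      simp only [Finset.mem_filter, Finset.mem_range] at hi
      rw [complRank_succ K hi.1, if_pos hn, descCompl_succ,
        if_pos (Finset.mem_insert_of_mem hn)]
    · simp only [hn, if_false, not_false_eq_true, if_true]
      rw [Finset.sum_insert (by simp), contract, ih, complRank_self, descCompl_succ,
        if_pos (Finset.mem_insert_self _ _), sub_eq_add_neg, ← Finset.sum_neg_distrib]
      rw [descCompl_congr (K := insert n K) (K' := K) fun k hk => by simp [hk.ne]]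
      congr 1
      · ring
      · refine Finset.sum_congr rfl fun i hi => ?_
        simp only [Finset.mem_filter, Finset.mem_range] at hi
        rw [complRank_succ K hi.1, if_neg hn, descCompl_succ, if_neg (by simp [hn, hi.1.ne'])]
        ring

theorem exists_descCompl_erase {n i : ℕ} {K : Finset ℕ} (hi : i < n) (h : i ∈ K) :
    ∃ l m, descCompl n (K.erase i) = l ++ i :: m ∧ descCompl n K = l ++ m ∧
      l.length = complRank n K i := by
  induction n with
  | zero => omega
  | succ n ih =>
    rcases Nat.lt_succ_iff_lt_or_eq.mp hi with hi | rfl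
    · obtain ⟨l, m, h1, h2, h3⟩ := ih hi
      rw [descCompl_succ, descCompl_succ, complRank_succ K hi, h1, h2]
      by_cases hn : n ∈ K
      · refine ⟨l, m, ?_, ?_, ?_⟩ <;> simp [hn, hi.ne', h3]
      · refine ⟨n :: l, m, ?_, ?_, ?_⟩ <;> simp [hn, h3]
    · refine ⟨[], descCompl i K, ?_, ?_, ?_⟩
      · rw [descCompl_succ, if_neg (by simp),
          descCompl_congr (K' := K) fun k hk => by simp [hk.ne]]
        rfl
      · rw [descCompl_succ, if_pos h]; rfl
      · rw [complRank_self]; rfl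

/-- The indices `-k` for `k ≤ n` outside of `K`, and `+0, …, +n`. -/
def complRows (n : ℕ) (K : Finset ℕ) : List (ℕ ⊕ ℕ) :=
  (descCompl (n + 1) K).map Sum.inl ++ (List.range (n + 1)).map Sum.inr

theorem mem_complRows {n : ℕ} {K : Finset ℕ} {a : ℕ ⊕ ℕ} :
    a ∈ complRows n K ↔ (∃ k ≤ n, k ∉ K ∧ a = Sum.inl k) ∨ ∃ k ≤ n, a = Sum.inr k := by
  simp only [complRows, List.mem_append, List.mem_map, mem_descCompl, List.mem_range,
    Nat.lt_succ_iff]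
  constructor
  · rintro (⟨k, ⟨h, h'⟩, rfl⟩ | ⟨k, h, rfl⟩)
    exacts [Or.inl ⟨k, h, h', rfl⟩, Or.inr ⟨k, h, rfl⟩]
  · rintro (⟨k, h, h', rfl⟩ | ⟨k, h, rfl⟩)
    exacts [Or.inl ⟨k, ⟨h, h'⟩, rfl⟩, Or.inr ⟨k, h, rfl⟩]

theorem nodup_complRows (n : ℕ) (K : Finset ℕ) : (complRows n K).Nodup := by
  refine List.Nodup.append ?_ ?_ ?_
  · exact ((List.nodup_reverse.mpr List.nodup_range).filter _).map Sum.inl_injective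
  · exact List.nodup_range.map Sum.inr_injective
  · simp [List.disjoint_left]

variable [IsDomain R] [CharZero R]

theorem pf_inl_cons_complRows {A : Matrix (ℕ ⊕ ℕ) (ℕ ⊕ ℕ) R} (hA : ∀ a b, A a b = -A b a)
    {n i : ℕ} (hi : i ≤ n) (K : Finset ℕ) :
    pf A (Sum.inl i :: complRows n K) =
      if i ∈ K then (-1) ^ complRank (n + 1) K i * pf A (complRows n (K.erase i)) else 0 := by
  split_ifs with h
  · obtain ⟨l, m, h1, h2, h3⟩ := exists_descCompl_erase (Nat.lt_succ_of_le hi) h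
    rw [complRows, complRows, h1, h2, List.map_append, List.append_assoc, pf_move hA, List.length_map,
      h3]
    simp
  · exact pf_cons_of_mem hA (mem_complRows.mpr (Or.inl ⟨i, hi, h, rfl⟩))

theorem contract_complRows {A : Matrix (ℕ ⊕ ℕ) (ℕ ⊕ ℕ) R} (hA : ∀ a b, A a b = -A b a)
    {n : ℕ} {M N : Finset ℕ} (hM : ∀ k ∈ M, k ≤ n) (hN : ∀ k ∈ N, k ≤ n) :
    contract (fun a => pf A (a :: complRows n N)) (complRows n M) (pf A) =
      ∑ i ∈ N \ M, (-1) ^ ((M.filter fun j => i < j).card + (N.filter fun j => i < j).card)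
        * pf A (complRows n (symmDiff M {i})) * pf A (complRows n (symmDiff N {i})) := by
  conv_lhs => rw [complRows.eq_def n M]
  rw [contract_append, contract_zero (l := (List.range (n + 1)).map Sum.inr),
    mul_zero, add_zero, contract_map, contract_descCompl]
  · symm
    refine Finset.sum_subset_zero_on_sdiff ?_ ?_ ?_
    · intro i hi
      simp only [Finset.mem_sdiff, Finset.mem_filter, Finset.mem_range] at hi ⊢
      exact ⟨Nat.lt_succ_of_le (hN i hi.1), hi.2⟩
    · intro i hi
      simp only [Finset.mem_sdiff, Finset.mem_filter, Finset.mem_range, not_and, not_not] at hi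
      have hi' : i ∉ N := fun h => hi.1.2 (hi.2 h)
      rw [Function.comp_apply, pf_inl_cons_complRows hA (by omega), if_neg hi']
      ring
    · intro i hi
      simp only [Finset.mem_sdiff] at hi
      rw [Function.comp_apply, pf_inl_cons_complRows hA (hN i hi.1), if_pos hi.1]
      have h1 : symmDiff M {i} = insert i M := by
        ext j; simp only [Finset.mem_symmDiff, Finset.mem_singleton, Finset.mem_insert]
        by_cases hj : j = i
        · subst hj; simp [hi.2]
        · simp [hj]
      have h2 : symmDiff N {i} = N.erase i := by
        ext j; simp only [Finset.mem_symmDiff, Finset.mem_singleton, Finset.mem_erase]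
        by_cases hj : j = i
        · subst hj; simp [hi.1]
        · simp [hj]
      have e1 := complRank_add_rank (n := n + 1) (i := i) fun k hk => Nat.lt_succ_of_le (hM k hk)
      have e2 := complRank_add_rank (n := n + 1) (i := i) fun k hk => Nat.lt_succ_of_le (hN k hk)
      have sgn : ((-1) ^ complRank (n + 1) M i * (-1) ^ complRank (n + 1) N i : R)
          = (-1) ^ ((M.filter fun j => i < j).card + (N.filter fun j => i < j).card) := by
        rw [← pow_add]
        refine neg_one_pow_congr ?_
        have : Even (complRank (n + 1) M i + complRank (n + 1) N i
          + ((M.filter fun j => i < j).card + (N.filter fun j => i < j).card)) :=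
          ⟨n + 1 - 1 - i, by omega⟩
        exact Nat.even_add.mp this
      rw [← sgn, h1, h2, complRows.eq_def n (insert i M)]
      ring
  · intro a ha
    obtain ⟨k, hk, rfl⟩ := List.mem_map.mp ha
    exact pf_cons_of_mem hA (mem_complRows.mpr (Or.inr ⟨k, by simpa [Nat.lt_succ_iff] using hk, rfl⟩))

theorem pf_complRows_plucker {A : Matrix (ℕ ⊕ ℕ) (ℕ ⊕ ℕ) R} (hA : ∀ a b, A a b = -A b a)
    {n : ℕ} {M N : Finset ℕ} (hM : ∀ k ∈ M, k ≤ n) (hN : ∀ k ∈ N, k ≤ n) :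
    ∑ i ∈ symmDiff M N, (-1) ^ ((M.filter fun j => i < j).card + (N.filter fun j => i < j).card)
        * pf A (complRows n (symmDiff M {i})) * pf A (complRows n (symmDiff N {i})) = 0 := by
  have key := pf_plucker hA (complRows n M) (complRows n N)
  have h := fun l m : List (ℕ ⊕ ℕ) => contract_eq_sum (fun a => pf A (a :: m)) l (pf A)
  simp only [← h] at key
  rw [contract_complRows hA hM hN, contract_complRows hA hN hM, add_comm] at key
  rw [symmDiff_def, Finset.sup_eq_union, Finset.sum_union (by
    rw [Finset.disjoint_left]; intro a; simp only [Finset.mem_sdiff]; tauto), ← key]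
  congr 1
  refine Finset.sum_congr rfl fun i _ => ?_
  rw [add_comm (M.filter _).card]
  ring

end Pfaffian
end BKP

namespace BKP

section Aug

theorem coe_mem_aug {lam : Finset ℕ+} {i : ℕ+} : (i : ℕ) ∈ aug lam ↔ i ∈ lam := by
  unfold aug
  have := i.pos.ne'
  split_ifs <;> simp [this]

theorem zero_mem_aug {lam : Finset ℕ+} : 0 ∈ aug lam ↔ ¬ Even lam.card := by
  unfold aug
  split_ifs with h <;> simp [h]

theorem even_card_aug (lam : Finset ℕ+) : Even (aug lam).card := by
  have h : (lam.image fun i : ℕ+ => (i : ℕ)).card = lam.card :=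
    Finset.card_image_of_injective _ PNat.coe_injective
  unfold aug
  split_ifs with he
  · rwa [h]
  · rw [Finset.card_insert_of_notMem (by simp), h, Nat.even_add_one]
    exact he

theorem aug_injective : Function.Injective aug := by
  intro lam mu h
  ext i
  rw [← coe_mem_aug, h, coe_mem_aug]

theorem ext_of_pos {K K' : Finset ℕ} (h0 : 0 ∈ K ↔ 0 ∈ K') (h : ∀ i : ℕ+, (i : ℕ) ∈ K ↔ (i : ℕ) ∈ K') :
    K = K' := by
  ext k
  rcases Nat.eq_zero_or_pos k with rfl | hk
  · exact h0
  · exact h ⟨k, hk⟩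

theorem even_card_symmDiff {α : Type*} [DecidableEq α] (mu nu : Finset α) :
    Even (symmDiff mu nu).card ↔ Even (mu.card + nu.card) := by
  have h1 := Finset.card_sdiff_add_card_inter mu nu
  have h2 := Finset.card_sdiff_add_card_inter nu mu
  rw [Finset.inter_comm] at h2
  have h3 : (symmDiff mu nu).card = (mu \ nu).card + (nu \ mu).card := by
    rw [symmDiff_def, Finset.sup_eq_union, Finset.card_union_of_disjoint]
    rw [Finset.disjoint_left]
    intro a
    simp only [Finset.mem_sdiff]
    tauto
  rw [h3, Nat.even_iff, Nat.even_iff]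
  omega

theorem even_card_symmDiff_singleton {α : Type*} [DecidableEq α] (mu : Finset α) (i : α) :
    Even (symmDiff mu {i}).card ↔ ¬ Even mu.card := by
  rw [even_card_symmDiff, Finset.card_singleton, Nat.even_add_one]

/-- Every set of natural numbers of even size is an augmented partition. -/
theorem exists_aug_eq {K : Finset ℕ} (hK : Even K.card) : ∃ lam, aug lam = K := by
  obtain ⟨lam, hpos⟩ : ∃ lam : Finset ℕ+, ∀ i : ℕ+, (i : ℕ) ∈ aug lam ↔ (i : ℕ) ∈ K := by
    refine ⟨(K.erase 0).image Nat.toPNat', fun i => ?_⟩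
    rw [coe_mem_aug]
    simp only [Finset.mem_image, Finset.mem_erase]
    constructor
    · rintro ⟨a, ⟨h, h'⟩, rfl⟩
      rwa [Nat.toPNat'_coe, if_pos (Nat.pos_of_ne_zero h)]
    · exact fun h => ⟨i, ⟨i.pos.ne', h⟩, PNat.coe_toPNat' i⟩
  refine ⟨lam, ext_of_pos ?_ hpos⟩
  have h := even_card_symmDiff (aug lam) K
  have hs : symmDiff (aug lam) K ⊆ {0} := by
    intro k hk
    rcases Nat.eq_zero_or_pos k with rfl | hk'
    · simp
    · have := hpos ⟨k, hk'⟩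
      rw [PNat.mk_coe] at this
      rw [Finset.mem_symmDiff] at hk
      tauto
  rcases Finset.subset_singleton_iff.mp hs with h0 | h0
  · rw [show aug lam = K from symmDiff_eq_bot.mp h0]
  · rw [h0] at h
    have := h.mpr (Even.add (even_card_aug lam) hK)
    simp at this

/-- The augmented partition with the part `0` toggled. -/
def augOdd (mu : Finset ℕ+) : Finset ℕ := symmDiff (aug mu) {0}

theorem aug_symmDiff_singleton (mu : Finset ℕ+) (i : ℕ+) :
    aug (symmDiff mu {i}) = symmDiff (augOdd mu) {(i : ℕ)} := by
  refine ext_of_pos ?_ fun j => ?_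
  · rw [zero_mem_aug, even_card_symmDiff_singleton]
    simp only [augOdd, Finset.mem_symmDiff, zero_mem_aug, Finset.mem_singleton, i.pos.ne]
    tauto
  · simp only [coe_mem_aug, augOdd, Finset.mem_symmDiff, Finset.mem_singleton, j.pos.ne',
      PNat.coe_inj]
    tauto

theorem augOdd_symmDiff_zero (mu : Finset ℕ+) : symmDiff (augOdd mu) {0} = aug mu := by
  rw [augOdd, symmDiff_symmDiff_cancel_right]

theorem aug_symmDiff_singleton' (mu : Finset ℕ+) (i : ℕ+) :
    aug (symmDiff mu {i}) = symmDiff (aug mu) {(i : ℕ), 0} := by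
  rw [aug_symmDiff_singleton, augOdd, symmDiff_assoc]
  congr 1
  ext j
  have := i.pos.ne
  simp only [Finset.mem_symmDiff, Finset.mem_singleton, Finset.mem_insert]
  by_cases h : j = 0
  · subst h; simp [this]
  · simp [h]

theorem aug_symmDiff_pair (mu : Finset ℕ+) {i j : ℕ+} (h : i ≠ j) :
    aug (symmDiff mu {i, j}) = symmDiff (aug mu) {(i : ℕ), (j : ℕ)} := by
  refine ext_of_pos ?_ fun k => ?_
  · rw [zero_mem_aug, even_card_symmDiff, Finset.card_pair h]
    simp only [Finset.mem_symmDiff, zero_mem_aug, Finset.mem_singleton, Finset.mem_insert, i.pos.ne,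
      j.pos.ne, Nat.even_add]
    simp
  · simp only [coe_mem_aug, Finset.mem_symmDiff, Finset.mem_singleton, Finset.mem_insert,
      PNat.coe_inj]

theorem card_filter_augOdd (mu : Finset ℕ+) (i : ℕ+) :
    ((augOdd mu).filter fun j => (i : ℕ) < j).card = (mu.filter fun j => i < j).card := by
  rw [← Finset.card_image_of_injective (mu.filter fun j => i < j) PNat.coe_injective]
  congr 1
  refine ext_of_pos ?_ fun j => ?_
  · simp
  · simp [augOdd, Finset.mem_symmDiff, coe_mem_aug]

theorem card_filter_augOdd_zero (mu : Finset ℕ+) :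
    ((augOdd mu).filter fun j => 0 < j).card = mu.card := by
  rw [← Finset.card_image_of_injective mu PNat.coe_injective]
  congr 1
  refine ext_of_pos ?_ fun j => ?_
  · simp
  · simp [augOdd, Finset.mem_symmDiff, coe_mem_aug]

theorem sum_symmDiff_augOdd {M : Type*} [AddCommMonoid M] (mu nu : Finset ℕ+) (f : ℕ → M) :
    ∑ i ∈ symmDiff (augOdd mu) (augOdd nu), f i
      = (∑ i ∈ symmDiff mu nu, f i) + if Odd (mu.card + nu.card) then f 0 else 0 := by
  have h : symmDiff (augOdd mu) (augOdd nu) = (symmDiff mu nu).image (fun i : ℕ+ => (i : ℕ))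
      ∪ if Odd (mu.card + nu.card) then {0} else ∅ := by
    refine ext_of_pos ?_ fun j => ?_
    · simp only [augOdd, Finset.mem_symmDiff, Finset.mem_union, Finset.mem_singleton,
        zero_mem_aug, ← Nat.not_even_iff_odd, Nat.even_add]
      by_cases h1 : Even mu.card <;> by_cases h2 : Even nu.card <;> simp [h1, h2]
    · simp only [augOdd, Finset.mem_symmDiff, Finset.mem_union, Finset.mem_singleton,
        coe_mem_aug]
      split_ifs <;> simp [Finset.mem_symmDiff]
  rw [h, Finset.sum_union, Finset.sum_image (by simp)]
  · split_ifs <;> simp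
  · split_ifs <;> simp

theorem neg_one_pow_size_symmDiff (mu : Finset ℕ+) (i : ℕ+) :
    ((-1) ^ size (symmDiff mu {i}) : ℂ) = (-1) ^ size mu * (-1) ^ (i : ℕ) := by
  unfold size
  by_cases h : i ∈ mu
  · have : symmDiff mu {i} = mu.erase i := by
      ext j; simp only [Finset.mem_symmDiff, Finset.mem_singleton, Finset.mem_erase]
      by_cases hj : j = i
      · subst hj; simp [h]
      · simp [hj]
    rw [this, ← Finset.add_sum_erase mu _ h, pow_add, mul_comm ((-1) ^ (i : ℕ)), mul_assoc,
      ← mul_pow]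
    simp
  · have : symmDiff mu {i} = insert i mu := by
      ext j; simp only [Finset.mem_symmDiff, Finset.mem_singleton, Finset.mem_insert]
      by_cases hj : j = i
      · subst hj; simp [h]
      · simp [hj]
    rw [this, Finset.sum_insert h, pow_add, mul_comm]

end Aug

section MatW

theorem constantCoeff_coeff_theta_pow (m j : ℕ) :
    MvPolynomial.constantCoeff (PowerSeries.coeff m (theta ^ j))
      = PowerSeries.coeff m ((0 : PowerSeries ℂ) ^ j) := by
  have h : PowerSeries.map MvPolynomial.constantCoeff theta = 0 := by
    ext k
    rw [PowerSeries.coeff_map, theta, PowerSeries.coeff_mk]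
    split_ifs <;> simp
  rw [← h, ← map_pow, PowerSeries.coeff_map]

theorem constantCoeff_q {m : ℕ} (hm : m ≠ 0) : MvPolynomial.constantCoeff (q m) = 0 := by
  unfold q
  rw [map_sum]
  refine Finset.sum_eq_zero fun j _ => ?_
  rw [map_mul, constantCoeff_coeff_theta_pow]
  rcases Nat.eq_zero_or_pos j with rfl | hj
  · simp [PowerSeries.coeff_one, hm]
  · simp [zero_pow hj.ne']

theorem constantCoeff_elemQ {i j : ℕ} (h : i ≠ 0) :
    MvPolynomial.constantCoeff (elemQ i j) = 0 := by
  unfold elemQ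
  split_ifs
  · simp [constantCoeff_q h]
  · rw [map_add, map_mul, map_mul, constantCoeff_q h, mul_zero, zero_mul, zero_add, map_sum]
    refine Finset.sum_eq_zero fun k _ => ?_
    rw [map_mul, map_mul, constantCoeff_q (by omega)]
    ring

variable (lam : Finset ℕ+) (r : ℕ → ℕ → ℂ)

theorem matW_skew (a b : ℕ ⊕ ℕ) : matW lam r a b = -matW lam r b a := by
  simp [matW]

theorem matW0_skew (a b : ℕ ⊕ ℕ) : matW0 lam r a b = -matW0 lam r b a := by
  rw [matW0, Matrix.map_apply, Matrix.map_apply, matW_skew, map_neg]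

theorem matW0_inl_inl (i j : ℕ) : matW0 lam r (Sum.inl i) (Sum.inl j) = 0 := by
  simp only [matW0, matW, Matrix.map_apply, Matrix.sub_apply, Matrix.transpose_apply, halfW]
  rw [map_sub]
  rcases lt_trichotomy i j with h | h | h
  · simp [h, not_lt.mpr h.le, constantCoeff_elemQ (show j ≠ 0 by omega)]
  · simp [h]
  · simp [h, not_lt.mpr h.le, constantCoeff_elemQ (show i ≠ 0 by omega)]

theorem matW0_inl_inr (a b : ℕ) : matW0 lam r (Sum.inl a) (Sum.inr b) =
    (if a = b ∧ a ∉ aug lam then 1 else 0)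
      - if a < b ∧ b ∉ aug lam ∧ a ∈ aug lam then (-1) ^ a * r b a else 0 := by
  simp only [matW0, matW, Matrix.map_apply, Matrix.sub_apply, Matrix.transpose_apply, halfW]
  rw [map_sub]
  split_ifs <;> simp

/-- The pairing of consecutive indices. -/
def pairMat : Matrix ℕ ℕ ℂ := fun i j =>
  (if Even j ∧ i = j + 1 then 1 else 0) - if Even i ∧ j = i + 1 then 1 else 0

theorem matW0_inr_inr_of_mem {a b : ℕ} (ha : a ∈ aug lam) (hb : b ∈ aug lam) :
    matW0 lam r (Sum.inr a) (Sum.inr b) = pairMat (rank (aug lam) a) (rank (aug lam) b) := by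
  simp only [matW0, matW, Matrix.map_apply, Matrix.sub_apply, Matrix.transpose_apply, halfW, ha, hb,
    not_true, and_false, if_false, zero_add, true_and, pairMat]
  rw [map_sub]
  split_ifs <;> simp

theorem matW0_inr_inr_of_notMem {a b : ℕ} (ha : a ∉ aug lam) (hb : b ∈ aug lam) :
    matW0 lam r (Sum.inr a) (Sum.inr b) = 0 := by
  simp [matW0, matW, halfW, ha, hb]

theorem matW0_inr_inr {a b : ℕ} (ha : a ∉ aug lam) (hb : b ∉ aug lam) (h : b < a) :
    matW0 lam r (Sum.inr a) (Sum.inr b) = r a b := by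
  simp [matW0, matW, halfW, ha, hb, h, not_lt.mpr h.le]

end MatW
end BKP

namespace BKP

section Coords

/-- The largest part of a strict partition. -/
def bound (lam : Finset ℕ+) : ℕ := lam.sup fun i => (i : ℕ)

theorem bound_le {lam : Finset ℕ+} {n : ℕ} : bound lam ≤ n ↔ ∀ i ∈ lam, (i : ℕ) ≤ n :=
  Finset.sup_le_iff

theorem le_of_mem_aug {lam : Finset ℕ+} {n k : ℕ} (h : bound lam ≤ n) (hk : k ∈ aug lam) :
    k ≤ n := by
  rcases Nat.eq_zero_or_pos k with rfl | hk'
  · exact Nat.zero_le n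
  · exact bound_le.mp h ⟨k, hk'⟩ (coe_mem_aug.mp hk)

theorem length_descCompl {n : ℕ} {K : Finset ℕ} (h : ∀ k ∈ K, k < n) :
    (descCompl n K).length + K.card = n := by
  have h1 : (descCompl n K).length = (descCompl n K).toFinset.card :=
    (List.toFinset_card_of_nodup ((List.nodup_reverse.mpr List.nodup_range).filter _)).symm
  have h2 : (descCompl n K).toFinset = Finset.range n \ K := by
    ext k
    simp [mem_descCompl]
  rw [h1, h2, Finset.card_sdiff_of_subset fun k hk => Finset.mem_range.mpr (h k hk),
    Finset.card_range]
  have := Finset.card_le_card (show K ⊆ Finset.range n from fun k hk => Finset.mem_range.mpr (h k hk))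
  rw [Finset.card_range] at this
  omega

/-- The coefficients of the Schur Q-expansion of the `τ`-function. -/
noncomputable def coords (lam : Finset ℕ+) (r : ℕ → ℕ → ℂ) (mu : Finset ℕ+) : ℂ :=
  (-1) ^ size mu * pf (matW0 lam r) (complRows (max (bound lam) (bound mu)) (aug mu))

variable {lam : Finset ℕ+} {r : ℕ → ℕ → ℂ}

theorem pf_complRows_succ {n : ℕ} {K : Finset ℕ} (hL : bound lam ≤ n) (hK : Even K.card)
    (hn : ∀ k ∈ K, k ≤ n) :
    pf (matW0 lam r) (complRows (n + 1) K) = pf (matW0 lam r) (complRows n K) := by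
  have hnL : n + 1 ∉ aug lam := fun h => absurd (le_of_mem_aug hL h) (by omega)
  have h1 : complRows (n + 1) K = Sum.inl (n + 1) :: (complRows n K ++ [Sum.inr (n + 1)]) := by
    rw [complRows, descCompl_succ, if_neg (fun h => absurd (hn _ h) (by omega)), List.range_succ,
      List.map_append, complRows]
    simp
  have h2 : Even (complRows n K).length := by
    have := length_descCompl (n := n + 1) fun k hk => Nat.lt_succ_of_le (hn k hk)
    rw [complRows, List.length_append, List.length_map, List.length_map, List.length_range]
    rw [Nat.even_iff] at hK ⊢
    omega
  rw [h1, pf_cons, contract_append, contract_zero (l := complRows n K)]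
  · rw [contract, contract, h2.neg_one_pow, matW0_inl_inr, if_pos ⟨rfl, hnL⟩,
      if_neg (fun h => hnL h.2.2)]
    simp
  · intro a ha
    rcases mem_complRows.mp ha with ⟨k, hk, -, rfl⟩ | ⟨k, hk, rfl⟩
    · exact matW0_inl_inl _ _ _ _
    · rw [matW0_inl_inr, if_neg (by omega), if_neg (by omega), sub_zero]

theorem pf_complRows_le {m n : ℕ} {K : Finset ℕ} (hL : bound lam ≤ m) (hK : Even K.card)
    (hm : ∀ k ∈ K, k ≤ m) (h : m ≤ n) :
    pf (matW0 lam r) (complRows n K) = pf (matW0 lam r) (complRows m K) := by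
  induction n, h using Nat.le_induction with
  | base => rfl
  | succ n h ih =>
    rw [pf_complRows_succ (hL.trans h) hK fun k hk => (hm k hk).trans h, ih]

theorem coords_eq {n : ℕ} {mu : Finset ℕ+} (hL : bound lam ≤ n) (hmu : bound mu ≤ n) :
    coords lam r mu = (-1) ^ size mu * pf (matW0 lam r) (complRows n (aug mu)) := by
  rw [coords, pf_complRows_le (le_max_left _ _) (even_card_aug mu)
    (fun k hk => le_of_mem_aug (le_max_right _ _) hk) (max_le hL hmu)]

theorem bound_symmDiff_le {mu nu : Finset ℕ+} {n : ℕ} (h : bound mu ≤ n) (h' : bound nu ≤ n) :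
    bound (symmDiff mu nu) ≤ n := by
  rw [bound_le] at *
  intro i hi
  rw [Finset.mem_symmDiff] at hi
  rcases hi with hi | hi
  exacts [h i hi.1, h' i hi.1]

theorem cartanPlucker_coords (lam : Finset ℕ+) (r : ℕ → ℕ → ℂ) :
    CartanPlucker (coords lam r) := by
  intro mu nu
  set n := max (bound lam) (max (bound mu) (bound nu)) with hn
  have hL : bound lam ≤ n := le_max_left _ _
  have hmu : bound mu ≤ n := (le_max_left _ _).trans (le_max_right _ _)
  have hnu : bound nu ≤ n := (le_max_right _ _).trans (le_max_right _ _)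
  have hodd : ∀ {mu : Finset ℕ+}, bound mu ≤ n → ∀ k ∈ augOdd mu, k ≤ n := by
    intro mu h k hk
    rw [augOdd, Finset.mem_symmDiff, Finset.mem_singleton] at hk
    rcases hk with hk | hk
    · exact le_of_mem_aug h hk.1
    · omega
  have key := pf_complRows_plucker (matW0_skew lam r) (hodd hmu) (hodd hnu)
  rw [sum_symmDiff_augOdd, augOdd_symmDiff_zero, augOdd_symmDiff_zero, card_filter_augOdd_zero,
    card_filter_augOdd_zero] at key
  have hsum : ∑ i ∈ symmDiff mu nu,
      (-1) ^ ((mu.filter fun j => i < j).card + (nu.filter fun j => i < j).card)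
        * coords lam r (symmDiff mu {i}) * coords lam r (symmDiff nu {i})
      = (-1) ^ size mu * (-1) ^ size nu * ∑ i ∈ symmDiff mu nu,
        (-1) ^ (((augOdd mu).filter fun j => (i : ℕ) < j).card
          + ((augOdd nu).filter fun j => (i : ℕ) < j).card)
          * pf (matW0 lam r) (complRows n (symmDiff (augOdd mu) {(i : ℕ)}))
          * pf (matW0 lam r) (complRows n (symmDiff (augOdd nu) {(i : ℕ)})) := by
    rw [Finset.mul_sum]
    refine Finset.sum_congr rfl fun i hi => ?_
    have hi' : bound {i} ≤ n := by
      rw [bound_le]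
      intro j hj
      rw [Finset.mem_singleton.mp hj]
      rcases Finset.mem_symmDiff.mp hi with hi | hi
      exacts [bound_le.mp hmu i hi.1, bound_le.mp hnu i hi.1]
    rw [coords_eq hL (bound_symmDiff_le hmu hi'), coords_eq hL (bound_symmDiff_le hnu hi'),
      aug_symmDiff_singleton, aug_symmDiff_singleton, neg_one_pow_size_symmDiff,
      neg_one_pow_size_symmDiff, card_filter_augOdd, card_filter_augOdd]
    have : ((-1) ^ (i : ℕ) * (-1) ^ (i : ℕ) : ℂ) = 1 := by rw [← mul_pow]; simp
    linear_combination (-1) ^ ((mu.filter fun j => i < j).card + (nu.filter fun j => i < j).card)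
      * (-1) ^ size mu * (-1) ^ size nu
      * pf (matW0 lam r) (complRows n (symmDiff (augOdd mu) {(i : ℕ)}))
      * pf (matW0 lam r) (complRows n (symmDiff (augOdd nu) {(i : ℕ)})) * this
  rw [hsum]
  split_ifs at key ⊢ with h
  · rw [h.neg_one_pow] at key
    rw [coords_eq hL hmu, coords_eq hL hnu]
    linear_combination (-1) ^ size mu * (-1) ^ size nu * key
  · rw [add_zero] at key
    rw [key, mul_zero]

/-! ### The coordinates near `λ` -/

theorem eqUpToSign_pf_cancel (lam : Finset ℕ+) (T : List ℕ) (hT : T.Nodup)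
    (hTL : ∀ a ∈ T, a ∉ aug lam) {l m : List (ℕ ⊕ ℕ)} (hl : ∀ a ∈ T, Sum.inr a ∉ l)
    (hm : m.Perm (T.map Sum.inl ++ T.map Sum.inr ++ l)) :
    EqUpToSign (fun r => pf (matW0 lam r) m) fun r => pf (matW0 lam r) l := by
  induction T generalizing m with
  | nil => exact pf_perm (fun r => matW0_skew lam r) (by simpa using hm)
  | cons a T ih =>
    rw [List.nodup_cons] at hT
    have haL := hTL a (by simp)
    have h1 := pf_of_perm_cons_cons (fun r => matW0_skew lam r) (a := Sum.inl a) (b := Sum.inr a)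
      (l := T.map Sum.inl ++ T.map Sum.inr ++ l) (m := m) ?_ ?_
    · have h2 := ih hT.2 (fun b hb => hTL b (by simp [hb])) (fun b hb => hl b (by simp [hb]))
        (List.Perm.refl _)
      refine h1.trans ?_
      simpa [matW0_inl_inr, haL] using h2
    · refine hm.trans ?_
      simp only [List.map_cons, List.cons_append, List.append_assoc]
      refine List.Perm.cons _ ?_
      exact List.perm_middle
    · intro r c hc
      cases c with
      | inl c => exact matW0_inl_inl _ _ _ _
      | inr c =>
        have hac : a ≠ c := by
          rintro rfl
          simp only [List.mem_append, List.mem_map, reduceCtorEq, and_false, exists_false,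
            Sum.inr.injEq, exists_eq_right, false_or] at hc
          exact hc.elim hT.1 (hl a (by simp))
        rw [matW0_inl_inr, if_neg (by simp [hac]), if_neg (by simp [haL]), sub_zero]

theorem pf_pairMat (s k : ℕ) (hs : Even s) : pf pairMat (List.range' s (2 * k)) = (-1) ^ k := by
  induction k generalizing s with
  | zero => simp [pf_nil]
  | succ k ih =>
    rw [Nat.mul_succ, List.range'_succ, List.range'_succ, pf_cons_cons, ih (s + 1 + 1) (by simpa [Nat.even_add_one] using hs),
      pow_succ]
    · have : ¬ (Even (s + 1) ∧ s = s + 1 + 1) := by omega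
      simp [pairMat, hs, this]
    · intro c hc
      rw [List.mem_range'_1] at hc
      simp only [pairMat]
      rw [if_neg (by omega), if_neg (by omega), sub_zero]

theorem map_rank_of_pairwise (l : List ℕ) (hl : l.Pairwise fun a b => b < a) :
    l.map (rank l.toFinset) = List.range l.length := by
  induction l with
  | nil => rfl
  | cons a l ih =>
    rw [List.pairwise_cons] at hl
    rw [List.map_cons, List.length_cons, List.range_succ_eq_map, ← ih hl.2, List.map_map]
    congr 1
    · rw [rank, Finset.card_eq_zero, Finset.filter_eq_empty_iff]
      intro x hx
      simp only [List.toFinset_cons, Finset.mem_insert, List.mem_toFinset] at hx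
      rcases hx with rfl | hx
      · exact lt_irrefl _
      · exact not_lt.mpr (hl.1 x hx).le
    · refine List.map_congr_left fun b hb => ?_
      rw [rank, List.toFinset_cons, Finset.filter_insert, if_pos (hl.1 b hb),
        Finset.card_insert_of_notMem, Function.comp_apply, rank]
      simp only [Finset.mem_filter, List.mem_toFinset, not_and]
      exact fun h => absurd (hl.1 a h) (lt_irrefl _)

theorem pf_inr_descIn {n : ℕ} (hn : bound lam ≤ n) :
    pf (matW0 lam r) ((descIn (n + 1) (aug lam)).map Sum.inr) = (-1) ^ ((aug lam).card / 2) := by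
  have hmem : ∀ k ∈ aug lam, k < n + 1 := fun k hk => Nat.lt_succ_of_le (le_of_mem_aug hn hk)
  have hfin : (descIn (n + 1) (aug lam)).toFinset = aug lam := by
    ext k
    rw [List.mem_toFinset, mem_descIn]
    exact ⟨fun h => h.2, fun h => ⟨hmem k h, h⟩⟩
  have hlen : (descIn (n + 1) (aug lam)).length = 2 * ((aug lam).card / 2) := by
    rw [Nat.mul_div_cancel' (even_card_aug lam).two_dvd, ← hfin,
      List.toFinset_card_of_nodup ((pairwise_descIn _ _).imp fun h => h.ne')]
    rw [hfin]
  have h1 : pf (matW0 lam r) ((descIn (n + 1) (aug lam)).map Sum.inr)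
      = pf pairMat ((descIn (n + 1) (aug lam)).map (rank (aug lam))) := by
    rw [pf_map, pf_map]
    exact pf_congr fun a ha b hb => matW0_inr_inr_of_mem lam r (mem_descIn.mp ha).2 (mem_descIn.mp hb).2
  have h2 := map_rank_of_pairwise _ (pairwise_descIn (n + 1) (aug lam))
  rw [hfin] at h2
  rw [h1, h2, hlen, List.range_eq_range', pf_pairMat _ _ Even.zero]

theorem eqUpToSign_complRows {n : ℕ} (hn : bound lam ≤ n) {K : Finset ℕ} (hK : ∀ k ∈ K, k ≤ n)
    {P Q : List ℕ} (hP : P.Nodup) (hQ : Q.Nodup) (hP' : ∀ a, a ∈ P ↔ a ∈ aug lam ∧ a ∉ K)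
    (hQ' : ∀ a, a ∈ Q ↔ a ∈ K ∧ a ∉ aug lam) :
    EqUpToSign (fun r => pf (matW0 lam r) (complRows n K)) fun r => pf (matW0 lam r)
      (P.map Sum.inl ++ Q.map Sum.inr ++ (descIn (n + 1) (aug lam)).map Sum.inr) := by
  have hL : ∀ k ∈ aug lam, k ≤ n := fun k hk => le_of_mem_aug hn hk
  have hnd : (descCompl (n + 1) (K ∪ aug lam)).Nodup :=
    (List.nodup_reverse.mpr List.nodup_range).filter _
  refine eqUpToSign_pf_cancel lam (descCompl (n + 1) (K ∪ aug lam)) hnd ?_ ?_ ?_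
  · intro a ha
    rw [mem_descCompl, Finset.mem_union] at ha
    tauto
  · intro a ha
    rw [mem_descCompl, Finset.mem_union] at ha
    simp only [List.mem_append, List.mem_map, reduceCtorEq, and_false, exists_false, false_or,
      Sum.inr.injEq, exists_eq_right, mem_descIn, hQ']
    tauto
  · rw [List.perm_ext_iff_of_nodup (nodup_complRows n K)]
    · rintro (a | a)
      · simp only [mem_complRows, List.mem_append, List.mem_map, reduceCtorEq, and_false,
          exists_false, or_false, Sum.inl.injEq, exists_eq_right, mem_descCompl, hP',
          Finset.mem_union, Nat.lt_succ_iff]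
        constructor
        · rintro ⟨k, h1, h2, rfl⟩
          tauto
        · have := hL a
          rintro (h | h)
          · exact ⟨a, h.1, by tauto, rfl⟩
          · exact ⟨a, by tauto, by tauto, rfl⟩
      · simp only [mem_complRows, List.mem_append, List.mem_map, reduceCtorEq, and_false,
          exists_false, false_or, Sum.inr.injEq, exists_eq_right, mem_descCompl, hQ',
          Finset.mem_union, Nat.lt_succ_iff, mem_descIn, exists_eq_right']
        have := hL a
        have := hK a
        tauto
    · have hd : (descIn (n + 1) (aug lam)).Nodup := (pairwise_descIn _ _).imp fun h => h.ne'
      simp only [List.nodup_append, hnd.map Sum.inl_injective, hnd.map Sum.inr_injective,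
        hP.map Sum.inl_injective, hQ.map Sum.inr_injective, hd.map Sum.inr_injective, true_and,
        List.mem_append, List.mem_map, mem_descCompl, mem_descIn, hP', hQ', Finset.mem_union]
      refine ⟨?_, ?_, ?_⟩
      · rintro _ ⟨a, ha, rfl⟩ _ ⟨b, hb, rfl⟩
        exact Sum.inl_ne_inr
      · refine ⟨?_, ?_⟩
        · rintro _ ⟨a, ha, rfl⟩ _ ⟨b, hb, rfl⟩
          exact Sum.inl_ne_inr
        · rintro _ (⟨a, ha, rfl⟩ | ⟨a, ha, rfl⟩) _ ⟨b, hb, rfl⟩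
          · exact Sum.inl_ne_inr
          · exact fun h => ha.2 (Sum.inr_injective h ▸ hb.2)
      · rintro _ (⟨a, ⟨-, ha⟩, rfl⟩ | ⟨a, ⟨-, ha⟩, rfl⟩) _ ((⟨b, hb, rfl⟩ | ⟨b, hb, rfl⟩) | ⟨b, hb, rfl⟩)
        · exact fun h => ha (Or.inr (Sum.inl_injective h ▸ hb.1))
        · exact Sum.inl_ne_inr
        · exact Sum.inl_ne_inr
        · exact Sum.inr_ne_inl
        · exact fun h => ha (Or.inl (Sum.inr_injective h ▸ hb.1))
        · exact fun h => ha (Or.inr (Sum.inr_injective h ▸ hb.2))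

theorem bound_le_of_aug_subset {mu : Finset ℕ+} {n : ℕ} (h : ∀ k ∈ aug mu, k ≤ n) :
    bound mu ≤ n :=
  bound_le.mpr fun i hi => h i (coe_mem_aug.mpr hi)

theorem eqUpToSign_coords {n : ℕ} (hn : bound lam ≤ n) {mu : Finset ℕ+} (hmu : bound mu ≤ n)
    {P Q : List ℕ} (hP : P.Nodup) (hQ : Q.Nodup) (hP' : ∀ a, a ∈ P ↔ a ∈ aug lam ∧ a ∉ aug mu)
    (hQ' : ∀ a, a ∈ Q ↔ a ∈ aug mu ∧ a ∉ aug lam) :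
    EqUpToSign (fun r => coords lam r mu) fun r => pf (matW0 lam r)
      (P.map Sum.inl ++ Q.map Sum.inr ++ (descIn (n + 1) (aug lam)).map Sum.inr) := by
  refine EqUpToSign.trans ?_
    (eqUpToSign_complRows hn (fun k hk => le_of_mem_aug hmu hk) hP hQ hP' hQ')
  simp only [coords_eq hn hmu]
  exact eqUpToSign_neg_one_pow_mul _ _

theorem coords_self (lam : Finset ℕ+) : ∃ ε : ℂ, (ε = 1 ∨ ε = -1) ∧ ∀ r, coords lam r lam = ε := by
  have h := eqUpToSign_coords (lam := lam) le_rfl (mu := lam) le_rfl (P := []) (Q := [])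
    List.nodup_nil List.nodup_nil (by simp) (by simp)
  simp only [List.map_nil, List.nil_append, pf_inr_descIn le_rfl] at h
  obtain ⟨ε, hε, h⟩ := h
  refine ⟨_, ?_, h⟩
  rcases hε with rfl | rfl <;> rcases neg_one_pow_eq_or ℂ ((aug lam).card / 2) with h | h <;>
    simp [h]

/-- The coordinates at the neighbours of `λ` are `± r_{x, ± y}` or zero. -/
theorem coords_near {mu : Finset ℕ+} {x y : ℕ} (hxy : y < x)
    (hmu : aug mu = symmDiff (aug lam) {x, y}) :
    ∃ ε : ℂ, (ε = 1 ∨ ε = -1) ∧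
      ∀ r, coords lam r mu = ε * if x ∈ aug lam then 0 else r x y := by
  set n := max (bound lam) x with hn
  have hL : bound lam ≤ n := le_max_left _ _
  have hM : bound mu ≤ n := by
    refine bound_le_of_aug_subset fun k hk => ?_
    have hx : x ≤ n := le_max_right _ _
    rw [hmu, Finset.mem_symmDiff, Finset.mem_insert, Finset.mem_singleton] at hk
    rcases hk with hk | hk
    · exact le_of_mem_aug hL hk.1
    · omega
  have hmem : ∀ a, a ∈ aug mu ↔ (a ∈ aug lam ∧ ¬(a = x ∨ a = y)) ∨ ((a = x ∨ a = y) ∧ a ∉ aug lam) := by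
    intro a
    rw [hmu, Finset.mem_symmDiff, Finset.mem_insert, Finset.mem_singleton]
  have fin : ∀ {a : ℕ ⊕ ℕ} {v : (ℕ → ℕ → ℂ) → ℂ} {s : ℂ}, (s = 1 ∨ s = -1) →
      EqUpToSign (fun r => coords lam r mu) (fun r => pf (matW0 lam r)
        (a :: Sum.inr x :: (descIn (n + 1) (aug lam)).map Sum.inr)) →
      (∀ r, ∀ c ∈ (descIn (n + 1) (aug lam)).map Sum.inr, matW0 lam r a c = 0) →
      (∀ r, matW0 lam r a (Sum.inr x) = s * v r) →
      ∃ ε : ℂ, (ε = 1 ∨ ε = -1) ∧ ∀ r, coords lam r mu = ε * v r := by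
    rintro a v s hs ⟨ε, hε, h⟩ h1 h2
    refine ⟨ε * (-1) ^ ((aug lam).card / 2) * s, ?_, fun r => ?_⟩
    · rcases hε with rfl | rfl <;> rcases neg_one_pow_eq_or ℂ ((aug lam).card / 2) with h | h <;>
        rcases hs with rfl | rfl <;> simp [h]
    · refine (h r).trans ?_
      beta_reduce
      rw [pf_cons_cons (h1 r), h2, pf_inr_descIn hL]
      ring
  by_cases hx : x ∈ aug lam
  · refine ⟨1, Or.inl rfl, fun r => ?_⟩
    rw [if_pos hx, mul_zero]
    by_cases hy : y ∈ aug lam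
    · obtain ⟨ε, -, h⟩ := eqUpToSign_coords hL hM (P := [x, y]) (Q := [])
        (by simp [hxy.ne']) (by simp)
        (by intro a; rw [hmem]; simp only [List.mem_cons, List.not_mem_nil, or_false]
            have : a = x → a ∈ aug lam := by rintro rfl; exact hx
            have : a = y → a ∈ aug lam := by rintro rfl; exact hy
            tauto)
        (by intro a; rw [hmem]; simp only [List.not_mem_nil]
            have : a = x → a ∈ aug lam := by rintro rfl; exact hx
            have : a = y → a ∈ aug lam := by rintro rfl; exact hy
            tauto)
      refine (h r).trans ?_
      refine mul_eq_zero_of_right _ (pf_of_row_eq_zero (a := Sum.inl x)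
        (l := Sum.inl y :: (descIn (n + 1) (aug lam)).map Sum.inr) (matW0_skew lam r)
        (List.Perm.refl _) ?_)
      intro c hc
      simp only [List.mem_cons, List.mem_map, mem_descIn] at hc
      rcases hc with rfl | ⟨b, hb, rfl⟩
      · exact matW0_inl_inl _ _ _ _
      · rw [matW0_inl_inr, if_neg (by tauto), if_neg (by tauto), sub_zero]
    · obtain ⟨ε, -, h⟩ := eqUpToSign_coords hL hM (P := [x]) (Q := [y])
        (by simp) (by simp)
        (by intro a; rw [hmem]; simp only [List.mem_cons, List.not_mem_nil, or_false]
            have : a = x → a ∈ aug lam := by rintro rfl; exact hx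
            have : a = y → a ∉ aug lam := by rintro rfl; exact hy
            tauto)
        (by intro a; rw [hmem]; simp only [List.mem_cons, List.not_mem_nil, or_false]
            have : a = x → a ∈ aug lam := by rintro rfl; exact hx
            have : a = y → a ∉ aug lam := by rintro rfl; exact hy
            tauto)
      refine (h r).trans ?_
      refine mul_eq_zero_of_right _ (pf_of_row_eq_zero (a := Sum.inl x)
        (l := Sum.inr y :: (descIn (n + 1) (aug lam)).map Sum.inr) (matW0_skew lam r)
        (List.Perm.refl _) ?_)
      intro c hc
      simp only [List.mem_cons, List.mem_map, mem_descIn] at hc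
      rcases hc with rfl | ⟨b, hb, rfl⟩
      · rw [matW0_inl_inr, if_neg (by omega), if_neg (by omega), sub_zero]
      · rw [matW0_inl_inr, if_neg (by tauto), if_neg (by tauto), sub_zero]
  · simp only [if_neg hx]
    by_cases hy : y ∈ aug lam
    · have h := eqUpToSign_coords hL hM (P := [y]) (Q := [x])
        (by simp) (by simp)
        (by intro a; rw [hmem]; simp only [List.mem_cons, List.not_mem_nil, or_false]
            have : a = x → a ∉ aug lam := by rintro rfl; exact hx
            have : a = y → a ∈ aug lam := by rintro rfl; exact hy
            tauto)
        (by intro a; rw [hmem]; simp only [List.mem_cons, List.not_mem_nil, or_false]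
            have : a = x → a ∉ aug lam := by rintro rfl; exact hx
            have : a = y → a ∈ aug lam := by rintro rfl; exact hy
            tauto)
      refine fin (s := -(-1) ^ y) ?_ h ?_ ?_
      · rcases neg_one_pow_eq_or ℂ y with h | h <;> simp [h]
      · intro r c hc
        obtain ⟨b, hb, rfl⟩ := List.mem_map.mp hc
        have := (mem_descIn.mp hb).2
        rw [matW0_inl_inr, if_neg (by tauto), if_neg (by tauto), sub_zero]
      · intro r
        rw [matW0_inl_inr, if_neg (by omega), if_pos ⟨hxy, hx, hy⟩]
        ring
    · have h := eqUpToSign_coords hL hM (P := []) (Q := [y, x])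
        (by simp) (by simp [hxy.ne])
        (by intro a; rw [hmem]; simp only [List.not_mem_nil]
            have : a = x → a ∉ aug lam := by rintro rfl; exact hx
            have : a = y → a ∉ aug lam := by rintro rfl; exact hy
            tauto)
        (by intro a; rw [hmem]; simp only [List.mem_cons, List.not_mem_nil, or_false]
            have : a = x → a ∉ aug lam := by rintro rfl; exact hx
            have : a = y → a ∉ aug lam := by rintro rfl; exact hy
            tauto)
      refine fin (s := -1) (Or.inr rfl) h ?_ ?_
      · intro r c hc
        obtain ⟨b, hb, rfl⟩ := List.mem_map.mp hc
        exact matW0_inr_inr_of_notMem lam r hy (mem_descIn.mp hb).2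
      · intro r
        rw [matW0_skew, matW0_inr_inr lam r hx hy hxy]
        ring

end Coords
end BKP

namespace BKP

section CartanPlucker

variable {α : Type*} [LinearOrder α]

theorem symmDiff_singleton_singleton (mu : Finset α) {i j : α} (h : j ≠ i) :
    symmDiff (symmDiff mu {i}) {j} = symmDiff mu {i, j} := by
  rw [symmDiff_assoc]
  congr 1
  ext k
  simp only [Finset.mem_symmDiff, Finset.mem_singleton, Finset.mem_insert]
  by_cases hk : k = i
  · subst hk; simp [h.symm]
  · simp [hk]

theorem symmDiff_symmDiff_singleton (mu nu : Finset α) (i : α) :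
    symmDiff (symmDiff mu {i}) (symmDiff nu {i}) = symmDiff mu nu := by
  rw [symmDiff_symmDiff_symmDiff_comm, symmDiff_self, symmDiff_bot]

theorem symmDiff_eq_erase {mu : Finset α} {i : α} (h : i ∈ mu) : symmDiff mu {i} = mu.erase i := by
  ext j
  simp only [Finset.mem_symmDiff, Finset.mem_singleton, Finset.mem_erase]
  by_cases hj : j = i
  · subst hj; simp [h]
  · simp [hj]

theorem symmDiff_eq_insert {mu : Finset α} {i : α} (h : i ∉ mu) : symmDiff mu {i} = insert i mu := by
  ext j
  simp only [Finset.mem_symmDiff, Finset.mem_singleton, Finset.mem_insert]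
  by_cases hj : j = i
  · subst hj; simp [h]
  · simp [hj]

theorem card_symmDiff_singleton_of_mem {mu nu : Finset α} {i : α} (h : i ∈ symmDiff mu nu) :
    (symmDiff (symmDiff mu {i}) nu).card + 1 = (symmDiff mu nu).card := by
  rw [symmDiff_right_comm, symmDiff_eq_erase h, Finset.card_erase_add_one h]

/-- The relation for `μ ∆ {i}` and `λ ∆ {i}`, solved for the term `x_μ x_λ`. -/
theorem exists_cartanPlucker_coeff (mu lam : Finset α) {i : α}
    (hi : i ∈ symmDiff mu lam) : ∃ (ε : α → ℂ) (δ : ℂ), ε i ≠ 0 ∧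
      (∀ y : Finset α → ℂ, CartanPlucker y → ε i * (y mu * y lam)
        = δ * (y (symmDiff mu {i}) * y (symmDiff lam {i}))
        - ∑ j ∈ (symmDiff mu lam).erase i, ε j * (y (symmDiff mu {i, j}) * y (symmDiff lam {i, j}))) := by
  refine ⟨fun j => (-1) ^ (((symmDiff mu {i}).filter fun k => j < k).card
      + ((symmDiff lam {i}).filter fun k => j < k).card),
    if Odd ((symmDiff mu {i}).card + (symmDiff lam {i}).card) then 1 else 0, by simp, ?_⟩
  intro y hy
  have := hy (symmDiff mu {i}) (symmDiff lam {i})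
  rw [symmDiff_symmDiff_singleton, ← Finset.add_sum_erase _ _ hi, symmDiff_symmDiff_cancel_right,
    symmDiff_symmDiff_cancel_right] at this
  rw [ite_mul, one_mul, zero_mul, ← this, mul_assoc, eq_sub_iff_add_eq]
  congr 1
  refine Finset.sum_congr rfl fun j hj => ?_
  have hji := Finset.ne_of_mem_erase hj
  rw [symmDiff_singleton_singleton _ hji, symmDiff_singleton_singleton _ hji]
  ring

/-- Coordinates that satisfy the Cartan–Plücker relations are determined by those in a
neighbourhood of a nonzero one. -/
theorem CartanPlucker.ext {x y : Finset α → ℂ} (hx : CartanPlucker x) (hy : CartanPlucker y)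
    {lam : Finset α} (h0 : x lam ≠ 0) (h : x lam = y lam)
    (h1 : ∀ i, x (symmDiff lam {i}) = y (symmDiff lam {i}))
    (h2 : ∀ i j, j < i → x (symmDiff lam {i, j}) = y (symmDiff lam {i, j})) : x = y := by
  have h2' : ∀ i j, i ≠ j → x (symmDiff lam {i, j}) = y (symmDiff lam {i, j}) := by
    intro i j hij
    rcases lt_or_gt_of_ne hij with h | h
    · rw [Finset.pair_comm]; exact h2 j i h
    · exact h2 i j h
  funext mu
  induction hd : (symmDiff mu lam).card using Nat.strong_induction_on generalizing mu with
  | _ d ih =>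
  rcases Finset.eq_empty_or_nonempty (symmDiff mu lam) with he | ⟨i, hi⟩
  · rw [show mu = lam from symmDiff_eq_bot.mp he, h]
  obtain ⟨ε, δ, hε, H⟩ := exists_cartanPlucker_coeff mu lam hi
  have hx' := H x hx
  have hy' := H y hy
  have hci := card_symmDiff_singleton_of_mem hi
  rw [ih _ (by omega) (symmDiff mu {i}) rfl, h1, h] at hx'
  have : ∑ j ∈ (symmDiff mu lam).erase i, ε j * (x (symmDiff mu {i, j}) * x (symmDiff lam {i, j}))
      = ∑ j ∈ (symmDiff mu lam).erase i, ε j * (y (symmDiff mu {i, j}) * y (symmDiff lam {i, j})) := by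
    refine Finset.sum_congr rfl fun j hj => ?_
    have hji := Finset.ne_of_mem_erase hj
    have hj' : j ∈ symmDiff (symmDiff mu {i}) lam := by
      rw [symmDiff_right_comm, symmDiff_eq_erase hi]
      exact hj
    have hcj := card_symmDiff_singleton_of_mem hj'
    rw [symmDiff_singleton_singleton _ hji] at hcj
    rw [h2' i j hji.symm, ih _ (by omega) _ rfl]
  rw [this, ← hy'] at hx'
  have := mul_left_cancel₀ hε hx'
  exact mul_right_cancel₀ (h ▸ h0) this

/-- The index of a nonzero coordinate that cannot be lowered by changing one or two parts. -/
def IsLowest (x : Finset α → ℂ) (lam : Finset α) : Prop :=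
  x lam ≠ 0 ∧ ∀ d ∈ lam, x (symmDiff lam {d}) = 0 ∧ ∀ j < d, x (symmDiff lam {d, j}) = 0

theorem exists_isLowest {x : Finset α → ℂ} (hx : x ≠ 0) {f : α → ℕ} (hf : StrictMono f) :
    ∃ lam, IsLowest x lam := by
  classical
  obtain ⟨mu, hmu⟩ := Function.ne_iff.mp hx
  have hex : ∃ k, ∃ lam, x lam ≠ 0 ∧ ∑ i ∈ lam, 2 ^ f i = k := ⟨_, mu, hmu, rfl⟩
  obtain ⟨lam, h0, hk⟩ := Nat.find_spec hex
  have hmin : ∀ nu, ∑ i ∈ nu, 2 ^ f i < ∑ i ∈ lam, 2 ^ f i → x nu = 0 := by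
    intro nu hnu
    by_contra h
    exact Nat.find_min hex (hk ▸ hnu) ⟨nu, h, rfl⟩
  refine ⟨lam, h0, fun d hd => ⟨hmin _ ?_, fun j hj => hmin _ ?_⟩⟩
  · rw [symmDiff_eq_erase hd, ← Finset.add_sum_erase lam _ hd]
    have := pow_pos (two_pos (α := ℕ)) (f d)
    omega
  · have hlt : 2 ^ f j < 2 ^ f d := Nat.pow_lt_pow_right (by norm_num) (hf hj)
    rw [← symmDiff_singleton_singleton _ hj.ne, symmDiff_eq_erase hd,
      ← Finset.add_sum_erase lam _ hd]
    refine lt_of_le_of_lt ?_ (Nat.add_lt_add_right hlt _)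
    by_cases hj' : j ∈ lam.erase d
    · rw [symmDiff_eq_erase hj', ← Finset.add_sum_erase (lam.erase d) _ hj']
      exact (Nat.le_add_left _ _).trans (Nat.le_add_left _ _)
    · rw [symmDiff_eq_insert hj', Finset.sum_insert hj']

theorem IsLowest.false_of_max_mem {x : Finset α → ℂ} (hx : CartanPlucker x) {lam mu : Finset α}
    (hlam : IsLowest x lam) (hmu : x mu ≠ 0) {d : α} (hd : d ∈ lam) (hd' : d ∈ symmDiff lam mu)
    (hmax : ∀ j ∈ symmDiff lam mu, j ≤ d) : False := by
  obtain ⟨ε, δ, hε, H⟩ := exists_cartanPlucker_coeff lam mu hd'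
  have := H x hx
  rw [(hlam.2 d hd).1, zero_mul, mul_zero, Finset.sum_eq_zero, sub_zero] at this
  · exact mul_ne_zero hε (mul_ne_zero hlam.1 hmu) this
  · intro j hj
    rw [Finset.mem_erase] at hj
    rw [(hlam.2 d hd).2 j (lt_of_le_of_ne (hmax j hj.2) hj.1), zero_mul, mul_zero]

theorem IsLowest.unique {x : Finset α → ℂ} (hx : CartanPlucker x) {lam mu : Finset α}
    (hlam : IsLowest x lam) (hmu : IsLowest x mu) : lam = mu := by
  by_contra hne
  obtain ⟨d, hd, hmax⟩ : ∃ d ∈ symmDiff lam mu, ∀ j ∈ symmDiff lam mu, j ≤ d := by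
    have hne' : (symmDiff lam mu).Nonempty := by
      rw [Finset.nonempty_iff_ne_empty]
      exact fun h => hne (symmDiff_eq_bot.mp h)
    exact ⟨_, Finset.max'_mem _ hne', fun j hj => Finset.le_max' _ j hj⟩
  rcases Finset.mem_symmDiff.mp hd with h | h
  · exact hlam.false_of_max_mem hx hmu.1 h.1 hd hmax
  · rw [symmDiff_comm] at hmax hd
    exact hmu.false_of_max_mem hx hlam.1 h.1 hd hmax

theorem sum_symmDiff_map {β : Type*} [LinearOrder β] (x : Finset β → ℂ) (f : α ↪o β)
    (mu nu : Finset α) :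
    ∑ i ∈ symmDiff (mu.map f.toEmbedding) (nu.map f.toEmbedding),
      (-1) ^ (((mu.map f.toEmbedding).filter fun j => i < j).card
          + ((nu.map f.toEmbedding).filter fun j => i < j).card)
        * x (symmDiff (mu.map f.toEmbedding) {i}) * x (symmDiff (nu.map f.toEmbedding) {i})
      = ∑ i ∈ symmDiff mu nu,
        (-1) ^ ((mu.filter fun j => i < j).card + (nu.filter fun j => i < j).card)
          * x ((symmDiff mu {i}).map f.toEmbedding) * x ((symmDiff nu {i}).map f.toEmbedding) := by
  have hs : ∀ mu nu : Finset α, symmDiff (mu.map f.toEmbedding) (nu.map f.toEmbedding)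
      = (symmDiff mu nu).map f.toEmbedding := by
    intro mu nu
    rw [Finset.map_eq_image, Finset.map_eq_image, Finset.map_eq_image,
      Finset.image_symmDiff _ _ f.toEmbedding.injective]
  have hc : ∀ (mu : Finset α) (i : α),
      ((mu.map f.toEmbedding).filter fun j => f.toEmbedding i < j).card
        = (mu.filter fun j => i < j).card := by
    intro mu i
    rw [Finset.filter_map, Finset.card_map]
    congr 1
    ext j
    simp
  rw [hs, Finset.sum_map]
  refine Finset.sum_congr rfl fun i _ => ?_
  rw [hc, hc, ← hs, ← hs, Finset.map_singleton]

theorem CartanPlucker.comp {β : Type*} [LinearOrder β] {x : Finset β → ℂ} (hx : CartanPlucker x)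
    (f : α ↪o β) : CartanPlucker fun mu : Finset α => x (mu.map f.toEmbedding) := by
  intro mu nu
  have h := hx (mu.map f.toEmbedding) (nu.map f.toEmbedding)
  rwa [sum_symmDiff_map, Finset.card_map, Finset.card_map] at h

theorem CartanPlucker.smul {x : Finset α → ℂ} (hx : CartanPlucker x) (c : ℂ) :
    CartanPlucker (c • x) := by
  intro mu nu
  have h := congrArg (fun y => c ^ 2 * y) (hx mu nu)
  simp only [Finset.mul_sum, Pi.smul_apply, smul_eq_mul, mul_ite, mul_zero] at h ⊢
  convert h using 1
  · exact Finset.sum_congr rfl fun i _ => by ring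
  · split_ifs <;> ring

end CartanPlucker
end BKP

namespace BKP

noncomputable section

section Wedge

variable {n : ℕ}

/-- The sign of the move of `i` to its position in `μ`. -/
def posSign {α : Type*} [LinearOrder α] (mu : Finset α) (i : α) : ℂ :=
  (-1) ^ (mu.filter fun j => i < j).card

theorem posSign_mul_self {α : Type*} [LinearOrder α] (mu : Finset α) (i : α) :
    posSign mu i * posSign mu i = 1 := by
  rw [posSign, ← mul_pow]; simp

theorem posSign_symmDiff_self {α : Type*} [LinearOrder α] (mu : Finset α) (i : α) :
    posSign (symmDiff mu {i}) i = posSign mu i := by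
  unfold posSign
  congr 2
  ext j
  simp only [Finset.mem_filter, Finset.mem_symmDiff, Finset.mem_singleton]
  constructor
  · rintro ⟨h, h'⟩
    exact ⟨by rcases h with h | h; exacts [h.1, absurd h.1 h'.ne'], h'⟩
  · exact fun ⟨h, h'⟩ => ⟨Or.inl ⟨h, h'.ne'⟩, h'⟩

/-- The generator `e_{-i}` of the exterior algebra. -/
abbrev gen (i : Fin n) : S n := ExteriorAlgebra.ι ℂ (Pi.single i (1 : ℂ) : Fin n → ℂ)

theorem wedge_empty : wedge n ∅ = 1 := by simp [wedge]

theorem wedge_insert {mu : Finset (Fin n)} {a : Fin n} (h : ∀ b ∈ mu, b < a) :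
    wedge n (insert a mu) = gen a * wedge n mu := by
  rw [wedge, Finset.sort_insert _ (fun b hb => (h b hb).le) (fun ha => lt_irrefl a (h a ha))]
  simp [wedge]

theorem gen_mul_self (i : Fin n) : gen i * gen i = 0 := ExteriorAlgebra.ι_sq_zero _

theorem gen_mul_comm (i j : Fin n) : gen i * gen j = -(gen j * gen i) :=
  eq_neg_of_add_eq_zero_left (ExteriorAlgebra.ι_add_mul_swap _ _)

theorem posSign_insert_of_lt {mu : Finset (Fin n)} {a i : Fin n} (h : ∀ b ∈ mu, b < a)
    (hi : i < a) : posSign (insert a mu) i = -posSign mu i := by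
  unfold posSign
  rw [Finset.filter_insert, if_pos hi, Finset.card_insert_of_notMem, pow_succ, mul_neg, mul_one]
  simp only [Finset.mem_filter, not_and]
  exact fun ha => absurd (h a ha) (lt_irrefl a)

theorem posSign_of_max {mu : Finset (Fin n)} {a : Fin n} (h : ∀ b ∈ mu, b ≤ a) :
    posSign mu a = 1 := by
  unfold posSign
  rw [Finset.filter_eq_empty_iff.mpr fun b hb => not_lt.mpr (h b hb)]
  simp

theorem gen_mul_wedge (i : Fin n) (mu : Finset (Fin n)) :
    gen i * wedge n mu = if i ∈ mu then 0 else posSign mu i • wedge n (symmDiff mu {i}) := by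
  induction mu using Finset.induction_on_max with
  | empty =>
    have := wedge_insert (mu := ∅) (a := i) (by simp)
    rw [symmDiff_eq_insert (Finset.notMem_empty i), this]
    simp [posSign]
  | insert a mu h ih =>
    rcases lt_trichotomy i a with hi | rfl | hi
    · rw [wedge_insert h, ← mul_assoc, gen_mul_comm, neg_mul, mul_assoc, ih]
      by_cases hmem : i ∈ mu
      · simp [hmem]
      · have hmem' : i ∉ insert a mu := by simp [hmem, hi.ne]
        rw [if_neg hmem, if_neg hmem', symmDiff_eq_insert hmem, symmDiff_eq_insert hmem',
          Finset.insert_comm, wedge_insert (mu := insert i mu), posSign_insert_of_lt h hi]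
        · simp
        · intro b hb
          rcases Finset.mem_insert.mp hb with rfl | hb
          exacts [hi, h b hb]
    · rw [wedge_insert h, ← mul_assoc, gen_mul_self, zero_mul, if_pos (Finset.mem_insert_self _ _)]
    · have hlt : ∀ b ∈ insert a mu, b < i := by
        intro b hb
        rcases Finset.mem_insert.mp hb with rfl | hb
        exacts [hi, (h b hb).trans hi]
      have hmem : i ∉ insert a mu := fun hm => lt_irrefl i (hlt i hm)
      rw [if_neg hmem, symmDiff_eq_insert hmem, wedge_insert hlt,
        posSign_of_max fun b hb => (hlt b hb).le, one_smul]

theorem contractLeft_wedge (d : Module.Dual ℂ (Fin n → ℂ)) (mu : Finset (Fin n)) :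
    CliffordAlgebra.contractLeft d (wedge n mu)
      = ∑ i ∈ mu, (posSign mu i * d (Pi.single i 1)) • wedge n (symmDiff mu {i}) := by
  induction mu using Finset.induction_on_max with
  | empty => simp [wedge_empty]
  | insert a mu h ih =>
    have ha : a ∉ mu := fun ha => lt_irrefl a (h a ha)
    rw [wedge_insert h, Finset.sum_insert ha, posSign_of_max, symmDiff_eq_erase
      (Finset.mem_insert_self a mu), Finset.erase_insert ha]
    · refine (CliffordAlgebra.contractLeft_ι_mul _ _ _).trans ?_
      rw [ih, one_mul, sub_eq_add_neg, Finset.mul_sum, ← Finset.sum_neg_distrib]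
      congr 1
      refine Finset.sum_congr rfl fun i hi => ?_
      have hi' : i ∈ insert a mu := Finset.mem_insert_of_mem hi
      rw [posSign_insert_of_lt h (h i hi), symmDiff_eq_erase hi, symmDiff_eq_erase hi',
        Finset.erase_insert_of_ne (h i hi).ne', wedge_insert (mu := mu.erase i), neg_mul, neg_smul,
        mul_smul_comm]
      exact fun b hb => h b (Finset.mem_of_mem_erase hb)
    · intro b hb
      rcases Finset.mem_insert.mp hb with rfl | hb
      exacts [le_rfl, (h b hb).le]

theorem involute_wedge (mu : Finset (Fin n)) :
    (CliffordAlgebra.involute : S n →ₐ[ℂ] S n) (wedge n mu) = (-1 : ℂ) ^ mu.card • wedge n mu := by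
  have := CliffordAlgebra.involute_prod_map_ι (Q := (0 : QuadraticForm ℂ (Fin n → ℂ)))
    ((mu.sort (fun a b => b ≤ a)).map fun i => (Pi.single i (1 : ℂ) : Fin n → ℂ))
  rw [List.map_map, List.length_map, Finset.length_sort] at this
  exact this

/-- The action of a vector in Cartan coordinates. -/
def act (v : V n) (x : Finset (Fin n) → ℂ) (mu : Finset (Fin n)) : ℂ :=
  (∑ i, posSign mu i * (if i ∈ mu then v.1 i else (-1) ^ ((i : ℕ) + 1) * v.2.2 i)
      * x (symmDiff mu {i}))
    + (Real.sqrt 2 : ℂ)⁻¹ * v.2.1 * (-1) ^ mu.card * x mu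

theorem pairing_single (y : Fin n → ℂ) (i : Fin n) :
    pairing n y (Pi.single i 1) = (-1) ^ ((i : ℕ) + 1) * y i := by
  simp [pairing, Finset.sum_apply, Pi.single_apply]

theorem rho_wedge (v : V n) (mu : Finset (Fin n)) : rho n v (wedge n mu)
    = (∑ i, (posSign mu i * (if i ∈ mu then (-1) ^ ((i : ℕ) + 1) * v.2.2 i else v.1 i))
        • wedge n (symmDiff mu {i})) + ((Real.sqrt 2 : ℂ)⁻¹ * v.2.1 * (-1) ^ mu.card) • wedge n mu := by
  have h1 : ExteriorAlgebra.ι ℂ v.1 * wedge n mu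
      = ∑ i, (posSign mu i * if i ∈ mu then 0 else v.1 i) • wedge n (symmDiff mu {i}) := by
    conv_lhs => rw [pi_eq_sum_univ' v.1, map_sum, Finset.sum_mul]
    refine Finset.sum_congr rfl fun i _ => ?_
    rw [map_smul, smul_mul_assoc, gen_mul_wedge]
    split_ifs
    · simp
    · rw [smul_smul, mul_comm]
  have h2 : CliffordAlgebra.contractLeft (pairing n v.2.2) (wedge n mu)
      = ∑ i, (posSign mu i * if i ∈ mu then (-1) ^ ((i : ℕ) + 1) * v.2.2 i else 0)
        • wedge n (symmDiff mu {i}) := by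
    rw [contractLeft_wedge, ← Finset.sum_subset (Finset.subset_univ mu)]
    · exact Finset.sum_congr rfl fun i hi => by rw [pairing_single, if_pos hi]
    · intro i _ hi
      simp [hi]
  rw [rho, LinearMap.add_apply, LinearMap.add_apply, LinearMap.mulLeft_apply, h1, h2,
    LinearMap.smul_apply, AlgHom.toLinearMap_apply, involute_wedge, smul_smul, add_right_comm,
    ← Finset.sum_add_distrib]
  congr 1
  refine Finset.sum_congr rfl fun i _ => ?_
  rw [← add_smul]
  split_ifs <;> simp

theorem cartanSpinor_add (x y : Finset (Fin n) → ℂ) :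
    cartanSpinor n (x + y) = cartanSpinor n x + cartanSpinor n y := by
  simp [cartanSpinor, add_smul, Finset.sum_add_distrib]

theorem cartanSpinor_smul (c : ℂ) (x : Finset (Fin n) → ℂ) :
    cartanSpinor n (c • x) = c • cartanSpinor n x := by
  simp [cartanSpinor, mul_smul, Finset.smul_sum]

theorem rho_cartanSpinor (v : V n) (x : Finset (Fin n) → ℂ) :
    rho n v (cartanSpinor n x) = cartanSpinor n (act v x) := by
  unfold cartanSpinor act
  simp only [map_sum, map_smul, rho_wedge, smul_add, Finset.smul_sum, add_smul, Finset.sum_smul,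
    Finset.sum_add_distrib, smul_smul]
  congr 1
  · rw [Finset.sum_comm, Finset.sum_comm (s := Finset.univ (α := Finset (Fin n)))]
    refine Finset.sum_congr rfl fun i _ => ?_
    refine Fintype.sum_equiv (Equiv.ofBijective (fun mu => symmDiff mu {i})
      (Function.Involutive.bijective fun mu => symmDiff_symmDiff_cancel_right {i} mu)) _ _ fun mu => ?_
    simp only [Equiv.ofBijective_apply, symmDiff_symmDiff_cancel_right, posSign_symmDiff_self]
    congr 1
    by_cases h : i ∈ mu <;> simp [h, Finset.mem_symmDiff] <;> ring
  · exact Finset.sum_congr rfl fun mu _ => by rw [mul_comm]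

theorem exists_cartanSpinor (s : S n) : ∃ x, s = cartanSpinor n x := by
  induction s using CliffordAlgebra.left_induction with
  | algebraMap c =>
    refine ⟨Pi.single ∅ c, ?_⟩
    rw [cartanSpinor, Finset.sum_eq_single ∅]
    · rw [wedge_empty, Pi.single_eq_same, Algebra.algebraMap_eq_smul_one]
    · intro mu _ h
      rw [Pi.single_eq_of_ne h, zero_smul]
    · simp
  | add s t hs ht =>
    obtain ⟨x, rfl⟩ := hs
    obtain ⟨y, rfl⟩ := ht
    exact ⟨x + y, (cartanSpinor_add x y).symm⟩
  | ι_mul s a hs =>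
    obtain ⟨x, rfl⟩ := hs
    refine ⟨act (a, 0, 0) x, ?_⟩
    rw [← rho_cartanSpinor]
    have h0 : pairing n 0 = 0 := by simp [pairing]
    simp [rho, h0, ExteriorAlgebra.ι]

theorem cartanSpinor_injective : Function.Injective (cartanSpinor n) := by
  let f : (Finset (Fin n) → ℂ) →ₗ[ℂ] S n :=
    { toFun := cartanSpinor n
      map_add' := cartanSpinor_add
      map_smul' := cartanSpinor_smul }
  have hb := (Pi.basisFun ℂ (Fin n)).ExteriorAlgebra
  have : FiniteDimensional ℂ (S n) := Module.Finite.of_basis hb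
  have hdim : Module.finrank ℂ (Finset (Fin n) → ℂ) = Module.finrank ℂ (S n) := by
    rw [Module.finrank_pi, Module.finrank_eq_card_basis hb]
  exact (LinearMap.injective_iff_surjective_of_finrank_eq_finrank hdim (f := f)).mpr fun s =>
    let ⟨x, hx⟩ := exists_cartanSpinor s
    ⟨x, hx.symm⟩

end Wedge

end

end BKP

namespace BKP

noncomputable section

section Spinor

variable {n : ℕ}

theorem involute_contractLeft (d : Module.Dual ℂ (Fin n → ℂ)) (s : S n) :
    (CliffordAlgebra.involute : S n →ₐ[ℂ] S n) (CliffordAlgebra.contractLeft d s)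
      = -CliffordAlgebra.contractLeft d ((CliffordAlgebra.involute : S n →ₐ[ℂ] S n) s) := by
  induction s using CliffordAlgebra.left_induction with
  | algebraMap c => simp [CliffordAlgebra.contractLeft_algebraMap]
  | add s t hs ht => simp only [map_add, hs, ht, neg_add]
  | ι_mul s a hs =>
    rw [CliffordAlgebra.contractLeft_ι_mul, map_sub, map_mul, map_mul, hs, map_smul,
      CliffordAlgebra.involute_ι, neg_mul, neg_mul, map_neg, CliffordAlgebra.contractLeft_ι_mul]
    simp

theorem inv_sqrt_two_mul_self : (Real.sqrt 2 : ℂ)⁻¹ * (Real.sqrt 2 : ℂ)⁻¹ = 1 / 2 := by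
  rw [← mul_inv, ← Complex.ofReal_mul, Real.mul_self_sqrt (by norm_num)]
  norm_num

theorem pairing_apply (y a : Fin n → ℂ) :
    pairing n y a = ∑ i : Fin n, (-1) ^ ((i : ℕ) + 1) * y i * a i := by
  simp [pairing, LinearMap.sum_apply]

/-- The Clifford relations. -/
theorem rho_rho_add (v w : V n) (s : S n) :
    rho n v (rho n w s) + rho n w (rho n v s) = psi n v w • s := by
  have hι : ∀ a b : Fin n → ℂ, ExteriorAlgebra.ι ℂ a * (ExteriorAlgebra.ι ℂ b * s)
      = -(ExteriorAlgebra.ι ℂ b * (ExteriorAlgebra.ι ℂ a * s)) := by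
    intro a b
    rw [← mul_assoc, ← mul_assoc, ← neg_mul]
    congr 1
    exact eq_neg_of_add_eq_zero_left (ExteriorAlgebra.ι_add_mul_swap _ _)
  have hinv : ∀ (b : Fin n → ℂ) (t : S n), (CliffordAlgebra.involute : S n →ₐ[ℂ] S n)
      (ExteriorAlgebra.ι ℂ b * t)
      = -(ExteriorAlgebra.ι ℂ b * (CliffordAlgebra.involute : S n →ₐ[ℂ] S n) t) := by
    intro b t
    rw [map_mul, ← neg_mul]
    congr 1
    exact CliffordAlgebra.involute_ι b
  have hc : ∀ (d : Module.Dual ℂ (Fin n → ℂ)) (b : Fin n → ℂ) (t : S n),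
      CliffordAlgebra.contractLeft d (ExteriorAlgebra.ι ℂ b * t)
      = d b • t - ExteriorAlgebra.ι ℂ b * CliffordAlgebra.contractLeft d t :=
    fun d b t => CliffordAlgebra.contractLeft_ι_mul _ _ _
  have hpsi : psi n v w = ((Real.sqrt 2 : ℂ)⁻¹ * v.2.1) * ((Real.sqrt 2 : ℂ)⁻¹ * w.2.1)
      + ((Real.sqrt 2 : ℂ)⁻¹ * w.2.1) * ((Real.sqrt 2 : ℂ)⁻¹ * v.2.1)
      + pairing n v.2.2 w.1 + pairing n w.2.2 v.1 := by
    rw [pairing_apply, pairing_apply, add_assoc _ (∑ i, _), ← Finset.sum_add_distrib, psi]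
    congr 1
    · linear_combination (-2 * v.2.1 * w.2.1) * inv_sqrt_two_mul_self
    · exact Finset.sum_congr rfl fun i _ => by ring
  have hcc := CliffordAlgebra.contractLeft_comm (d := pairing n v.2.2) (pairing n w.2.2) s
  simp only [rho, LinearMap.add_apply, LinearMap.mulLeft_apply, LinearMap.smul_apply,
    AlgHom.toLinearMap_apply, map_add, map_smul, hinv, involute_contractLeft, hc,
    CliffordAlgebra.involute_involute, hpsi]
  rw [hι v.1 w.1, hcc]
  module

theorem act_act_add (v w : V n) (x : Finset (Fin n) → ℂ) :
    act v (act w x) + act w (act v x) = psi n v w • x := by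
  refine cartanSpinor_injective ?_
  rw [cartanSpinor_add, ← rho_cartanSpinor, ← rho_cartanSpinor, ← rho_cartanSpinor,
    ← rho_cartanSpinor, rho_rho_add, cartanSpinor_smul]

theorem act_add_left (v w : V n) (x : Finset (Fin n) → ℂ) : act (v + w) x = act v x + act w x := by
  funext mu
  simp only [act, Pi.add_apply, Prod.fst_add, Prod.snd_add]
  rw [show ∀ a b c d : ℂ, a + b + (c + d) = (a + c) + (b + d) by intros; ring,
    ← Finset.sum_add_distrib]
  congr 1
  · exact Finset.sum_congr rfl fun i _ => by split_ifs <;> ring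
  · ring

theorem act_smul_left (c : ℂ) (v : V n) (x : Finset (Fin n) → ℂ) : act (c • v) x = c • act v x := by
  funext mu
  simp only [act, Pi.smul_apply, Prod.smul_fst, Prod.smul_snd, smul_eq_mul, mul_add, Finset.mul_sum]
  congr 1
  · exact Finset.sum_congr rfl fun i _ => by split_ifs <;> ring
  · ring

theorem act_smul_right (c : ℂ) (v : V n) (x : Finset (Fin n) → ℂ) : act v (c • x) = c • act v x := by
  refine cartanSpinor_injective ?_
  rw [← rho_cartanSpinor, cartanSpinor_smul, cartanSpinor_smul, ← rho_cartanSpinor, map_smul]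

theorem act_sub_right (v : V n) (x y : Finset (Fin n) → ℂ) : act v (x - y) = act v x - act v y := by
  have h : ∀ x y : Finset (Fin n) → ℂ, act v (x + y) = act v x + act v y := by
    intro x y
    refine cartanSpinor_injective ?_
    rw [← rho_cartanSpinor, cartanSpinor_add, cartanSpinor_add, ← rho_cartanSpinor,
      ← rho_cartanSpinor, map_add]
  rw [sub_eq_add_neg, h, ← neg_one_smul ℂ y, act_smul_right, neg_one_smul, sub_eq_add_neg]

/-- The linear map `v ↦ act v x`. -/
def actHom (x : Finset (Fin n) → ℂ) : V n →ₗ[ℂ] (Finset (Fin n) → ℂ) where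
  toFun v := act v x
  map_add' v w := act_add_left v w x
  map_smul' c v := act_smul_left c v x

/-- The components of a vector that act on the coordinate `μ`. -/
def comps (mu : Finset (Fin n)) : V n →ₗ[ℂ] (Fin n → ℂ) where
  toFun v i := if i ∈ mu then v.1 i else (-1) ^ ((i : ℕ) + 1) * v.2.2 i
  map_add' v w := by
    funext i
    simp only [Pi.add_apply, Prod.fst_add, Prod.snd_add]
    split_ifs <;> ring
  map_smul' c v := by
    funext i
    simp only [Pi.smul_apply, Prod.smul_fst, Prod.smul_snd, smul_eq_mul, RingHom.id_apply]
    split_ifs <;> ring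

theorem act_eq_comps (v : V n) (x : Finset (Fin n) → ℂ) (mu : Finset (Fin n)) :
    act v x mu = (∑ i, posSign mu i * comps mu v i * x (symmDiff mu {i}))
      + (Real.sqrt 2 : ℂ)⁻¹ * v.2.1 * (-1) ^ mu.card * x mu := rfl

theorem comps_congr {mu nu : Finset (Fin n)} (v : V n) {i : Fin n} (h : i ∉ symmDiff mu nu) :
    comps mu v i = comps nu v i := by
  have : i ∈ mu ↔ i ∈ nu := by
    rw [Finset.mem_symmDiff] at h
    tauto
  simp [comps, this]

/-- The vector with `Ψ(w, ·) = (ρ(w) x)_ν` for all `w`. -/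
def vecOf (x : Finset (Fin n) → ℂ) (nu : Finset (Fin n)) : V n :=
  (fun i => if i ∈ nu then 0 else posSign nu i * x (symmDiff nu {i}),
    (Real.sqrt 2 : ℂ)⁻¹ * (-1) ^ nu.card * x nu,
    fun i => (-1) ^ ((i : ℕ) + 1) * if i ∈ nu then posSign nu i * x (symmDiff nu {i}) else 0)

theorem neg_one_pow_mul_self (k : ℕ) : ((-1) ^ k * (-1) ^ k : ℂ) = 1 := by
  rw [← mul_pow]; simp

theorem psi_vecOf (w : V n) (x : Finset (Fin n) → ℂ) (nu : Finset (Fin n)) :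
    psi n w (vecOf x nu) = act w x nu := by
  rw [psi, act, add_comm]
  congr 1
  · refine Finset.sum_congr rfl fun i _ => ?_
    simp only [vecOf]
    split_ifs
    · linear_combination (w.1 i * posSign nu i * x (symmDiff nu {i})) * neg_one_pow_mul_self (i + 1)
    · ring
  · simp only [vecOf]
    ring

theorem comps_vecOf (x : Finset (Fin n) → ℂ) (mu nu : Finset (Fin n)) (i : Fin n) :
    comps mu (vecOf x nu) i
      = if i ∈ symmDiff mu nu then posSign nu i * x (symmDiff nu {i}) else 0 := by
  have := neg_one_pow_mul_self (i + 1)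
  simp only [comps, vecOf, LinearMap.coe_mk, AddHom.coe_mk, Finset.mem_symmDiff]
  by_cases h : i ∈ mu <;> by_cases h' : i ∈ nu <;> simp [h, h', ← mul_assoc, this]

theorem act_vecOf (x y : Finset (Fin n) → ℂ) (mu nu : Finset (Fin n)) :
    act (vecOf x nu) y mu = (∑ i ∈ symmDiff mu nu, (-1) ^ ((mu.filter fun j => i < j).card
      + (nu.filter fun j => i < j).card) * y (symmDiff mu {i}) * x (symmDiff nu {i}))
      + 1 / 2 * (-1) ^ (mu.card + nu.card) * y mu * x nu := by
  rw [act_eq_comps]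
  congr 1
  · rw [← Finset.sum_subset (Finset.subset_univ (symmDiff mu nu))]
    · refine Finset.sum_congr rfl fun i hi => ?_
      rw [comps_vecOf, if_pos hi, pow_add, posSign, posSign]
      ring
    · intro i _ hi
      rw [comps_vecOf, if_neg hi, mul_zero, zero_mul]
  · rw [← inv_sqrt_two_mul_self, pow_add]
    simp only [vecOf]
    ring

theorem cartanPlucker_iff (x : Finset (Fin n) → ℂ) :
    CartanPlucker x ↔ ∀ nu, act (vecOf x nu) x = (1 / 2 * x nu) • x := by
  simp only [funext_iff, act_vecOf, Pi.smul_apply, smul_eq_mul]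
  rw [forall_comm]
  refine forall_congr' fun mu => forall_congr' fun nu => ?_
  by_cases h : Odd (mu.card + nu.card)
  · rw [if_pos h, h.neg_one_pow]
    constructor <;> intro H <;> linear_combination H
  · rw [if_neg h, (Nat.not_odd_iff_even.mp h).neg_one_pow]
    constructor <;> intro H <;> linear_combination H

theorem rho_prod_of_mem {l : List (V n)} (hl : ∀ v ∈ l, ∀ w ∈ l, psi n v w = 0) {v : V n}
    (hv : v ∈ l) (u : S n) : rho n v ((l.map (rho n)).prod u) = 0 := by
  induction l generalizing v with
  | nil => simp at hv
  | cons w l ih =>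
    rw [List.map_cons, List.prod_cons, Module.End.mul_apply]
    have h := rho_rho_add v w ((l.map (rho n)).prod u)
    rw [hl v hv w (by simp), zero_smul] at h
    rcases List.mem_cons.mp hv with rfl | hv
    · have h2 : (2 : ℂ) • rho n v (rho n v ((l.map (rho n)).prod u)) = 0 := by
        rw [two_smul]; exact h
      exact (smul_eq_zero.mp h2).resolve_left two_ne_zero
    · rw [ih (fun v hv w hw => hl v (by simp [hv]) w (by simp [hw])) hv, map_zero, add_zero] at h
      exact h

theorem eq_zero_of_comps_eq_zero {x : Finset (Fin n) → ℂ} {lam : Finset (Fin n)} (h0 : x lam ≠ 0)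
    {v : V n} (hv : act v x = 0) (hc : comps lam v = 0) : v = 0 := by
  have h1 := congrFun hv lam
  rw [act_eq_comps, hc] at h1
  have hv0 : v.2.1 = 0 := by simpa [h0] using h1
  have h2 : ∀ i, comps (symmDiff lam {i}) v i = 0 := by
    intro i
    have h := congrFun hv (symmDiff lam {i})
    rw [act_eq_comps, hv0, Finset.sum_eq_single i, symmDiff_symmDiff_cancel_right] at h
    · have hs : posSign (symmDiff lam {i}) i ≠ 0 := by simp [posSign]
      simpa [h0, hs] using h
    · intro j _ hj
      rw [comps_congr (nu := lam) v (by
        rw [symmDiff_comm, symmDiff_symmDiff_cancel_left]; simpa using hj), hc]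
      simp
    · simp
  have h3 : ∀ i, v.1 i = 0 ∧ v.2.2 i = 0 := by
    intro i
    have e1 := congrFun hc i
    have e2 := h2 i
    by_cases hi : i ∈ lam
    · simp [comps, hi] at e1
      simp [comps, hi, Finset.mem_symmDiff] at e2
      exact ⟨e1, e2⟩
    · simp [comps, hi] at e1
      simp [comps, hi, Finset.mem_symmDiff] at e2
      exact ⟨e2, e1⟩
  exact Prod.ext (funext fun i => (h3 i).1) (Prod.ext hv0 (funext fun i => (h3 i).2))

theorem eq_zero_of_act_eq_zero {lam : Finset (Fin n)} {w : Fin n → V n}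
    (hw : ∀ i, comps lam (w i) = Pi.single i 1) {y : Finset (Fin n) → ℂ}
    (hy : ∀ i, act (w i) y = 0) (h0 : y lam = 0) : y = 0 := by
  funext mu
  induction hd : (symmDiff mu lam).card using Nat.strong_induction_on generalizing mu with
  | _ d ih =>
  rcases Finset.eq_empty_or_nonempty (symmDiff mu lam) with he | ⟨i, hi⟩
  · rw [show mu = lam from symmDiff_eq_bot.mp he, h0]; rfl
  have hci := card_symmDiff_singleton_of_mem hi
  have h := congrFun (hy i) (symmDiff mu {i})
  have hK : symmDiff (symmDiff mu {i}) lam = (symmDiff mu lam).erase i := by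
    rw [symmDiff_right_comm, symmDiff_eq_erase hi]
  rw [act_eq_comps, ih _ (by omega) (symmDiff mu {i}) rfl, Finset.sum_eq_single i,
    symmDiff_symmDiff_cancel_right, comps_congr (nu := lam) (w i) (by rw [hK]; simp), hw] at h
  · have hs : posSign (symmDiff mu {i}) i ≠ 0 := by simp [posSign]
    simpa [hs] using h
  · intro j _ hj
    by_cases hj' : j ∈ symmDiff (symmDiff mu {i}) lam
    · have hcj := card_symmDiff_singleton_of_mem hj'
      rw [ih _ (by omega) (symmDiff (symmDiff mu {i}) {j}) rfl]
      simp
    · rw [comps_congr (nu := lam) (w i) hj', hw]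
      simp [hj]
  · simp

/-- The coordinates of a pure spinor satisfy the Cartan–Plücker relations. -/
theorem IsPureSpinor.cartanPlucker {x : Finset (Fin n) → ℂ}
    (hx : IsPureSpinor n (cartanSpinor n x)) : CartanPlucker x := by
  obtain ⟨hne, w, hlin, hiso, u, hu⟩ := hx
  have hann : ∀ i, act (w i) x = 0 := by
    intro i
    refine cartanSpinor_injective ?_
    rw [← rho_cartanSpinor, hu, show (List.ofFn fun i => rho n (w i))
      = (List.ofFn w).map (rho n) by rw [List.map_ofFn]; rfl, rho_prod_of_mem]
    · simp [cartanSpinor]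
    · intro v hv v' hv'
      obtain ⟨i, rfl⟩ := List.mem_ofFn.mp hv
      obtain ⟨j, rfl⟩ := List.mem_ofFn.mp hv'
      exact hiso i j
    · exact List.mem_ofFn.mpr ⟨i, rfl⟩
  have hx0 : x ≠ 0 := by
    rintro rfl
    exact hne (by simp [cartanSpinor])
  obtain ⟨lam, h0⟩ := Function.ne_iff.mp hx0
  simp only [Pi.zero_apply] at h0
  have hannS : ∀ c : Fin n → ℂ, act (Fintype.linearCombination ℂ w c) x = 0 := by
    intro c
    change actHom x _ = 0
    rw [Fintype.linearCombination_apply, map_sum]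
    refine Finset.sum_eq_zero fun i _ => ?_
    rw [map_smul, show actHom x (w i) = 0 from hann i, smul_zero]
  have hinj : Function.Injective (comps lam ∘ₗ Fintype.linearCombination ℂ w) := by
    rw [← LinearMap.ker_eq_bot, LinearMap.ker_eq_bot']
    intro c hc
    have h := eq_zero_of_comps_eq_zero h0 (hannS c) hc
    exact (linearIndependent_iff_injective_fintypeLinearCombination.mp hlin) (by rw [h, map_zero])
  have hsurj := LinearMap.injective_iff_surjective.mp hinj
  choose c hc using fun i : Fin n => hsurj (Pi.single i 1)
  rw [cartanPlucker_iff]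
  intro nu
  obtain ⟨κ, hκ⟩ : ∃ κ : ℂ, act (vecOf x nu) x = κ • x := by
    refine ⟨act (vecOf x nu) x lam / x lam, ?_⟩
    rw [← sub_eq_zero]
    refine eq_zero_of_act_eq_zero hc (fun i => ?_) ?_
    · have h := act_act_add (Fintype.linearCombination ℂ w (c i)) (vecOf x nu) x
      rw [psi_vecOf, hannS] at h
      have hz : act (vecOf x nu) 0 = 0 := by
        have := act_smul_right 0 (vecOf x nu) 0
        simpa using this
      rw [act_sub_right, act_smul_right, hannS, smul_zero, sub_zero]
      simpa [hz] using h
    · simp [h0]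
  have h1 : κ * x nu = 1 / 2 * x nu * x nu := by
    have := congrFun hκ nu
    rw [act_vecOf] at this
    simpa [← two_mul, pow_mul] using this.symm
  have h2 : κ * κ = 1 / 2 * x nu * (1 / 2 * x nu) := by
    have h := act_act_add (vecOf x nu) (vecOf x nu) x
    rw [psi_vecOf, hκ, act_smul_right, hκ] at h
    have h := congrFun h lam
    simp only [Pi.add_apply, Pi.smul_apply, smul_eq_mul] at h
    have h' : (κ * κ) * x lam = (1 / 2 * x nu * (1 / 2 * x nu)) * x lam := by
      linear_combination 1 / 2 * h + 1 / 2 * x lam * h1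
    exact mul_right_cancel₀ h0 h'
  rw [hκ]
  congr 1
  by_cases hnu : x nu = 0
  · rw [hnu] at h2 ⊢
    simpa using h2
  · exact mul_right_cancel₀ hnu h1

theorem exists_eq_prod {w w' : Fin n → V n} (hdual : ∀ i j, psi n (w i) (w' j) = if i = j then 1 else 0)
    {l : List (Fin n)} (hl : l.Nodup) {s : S n} (hs : ∀ i ∈ l, rho n (w i) s = 0) :
    ∃ u, s = (l.map fun i => rho n (w i)).prod u := by
  induction l generalizing s with
  | nil => exact ⟨s, by simp⟩
  | cons i l ih =>
    rw [List.nodup_cons] at hl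
    have h := fun j => rho_rho_add (w j) (w' i) s
    obtain ⟨u, hu⟩ := ih hl.2 (s := rho n (w' i) s) fun j hj => by
      have := h j
      rw [hs j (by simp [hj]), hdual, if_neg (by rintro rfl; exact hl.1 hj), map_zero, add_zero,
        zero_smul] at this
      exact this
    refine ⟨u, ?_⟩
    rw [List.map_cons, List.prod_cons, Module.End.mul_apply, ← hu]
    have := h i
    rw [hs i (by simp), map_zero, add_zero, hdual, if_pos rfl, one_smul] at this
    exact this.symm

theorem CartanPlucker.isPureSpinor {x : Finset (Fin n) → ℂ} (hx : CartanPlucker x) (hx0 : x ≠ 0) :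
    IsPureSpinor n (cartanSpinor n x) := by
  refine ⟨fun h => hx0 (cartanSpinor_injective (h.trans (by simp [cartanSpinor]))), ?_⟩
  obtain ⟨lam, h0⟩ := Function.ne_iff.mp hx0
  simp only [Pi.zero_apply] at h0
  rw [cartanPlucker_iff] at hx
  obtain ⟨w, hw⟩ : ∃ w : Fin n → V n, ∀ i, act (w i) x = 0 ∧ comps lam (w i) = Pi.single i 1 := by
    refine ⟨fun i => (posSign (symmDiff lam {i}) i * (x lam)⁻¹) • (vecOf x (symmDiff lam {i})
      - (x (symmDiff lam {i}) / x lam) • vecOf x lam), fun i => ⟨?_, ?_⟩⟩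
    · change actHom x _ = 0
      rw [map_smul, map_sub, map_smul, show actHom x (vecOf x lam) = _ from hx lam,
        show actHom x (vecOf x (symmDiff lam {i})) = _ from hx _, smul_smul, ← sub_smul]
      rw [show 1 / 2 * x (symmDiff lam {i}) - x (symmDiff lam {i}) / x lam * (1 / 2 * x lam) = 0 by
        field_simp; ring, zero_smul, smul_zero]
    · funext j
      simp only [map_smul, map_sub, Pi.smul_apply, Pi.sub_apply, smul_eq_mul, comps_vecOf,
        symmDiff_symmDiff_cancel_left, symmDiff_self, Finset.bot_eq_empty, Finset.notMem_empty,
        if_false, mul_zero, sub_zero, Finset.mem_singleton]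
      by_cases hj : j = i
      · subst hj
        have := posSign_mul_self (symmDiff lam {j}) j
        rw [if_pos rfl, symmDiff_symmDiff_cancel_right, Pi.single_eq_same]
        field_simp
        linear_combination this
      · simp [hj]
  have hiso : ∀ i j, psi n (w i) (w j) = 0 := by
    intro i j
    have h := act_act_add (w i) (w j) x
    have hz : ∀ v : V n, act v 0 = 0 := fun v => by
      simpa using act_smul_right 0 v 0
    rw [(hw i).1, (hw j).1, hz, hz, add_zero] at h
    have := congrFun h lam
    simpa [h0] using this.symm
  refine ⟨w, ?_, hiso, ?_⟩
  · refine LinearIndependent.of_comp (comps lam) ?_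
    have : comps lam ∘ w = fun i => Pi.basisFun ℂ (Fin n) i := by
      funext i
      rw [Function.comp_apply, (hw i).2, Pi.basisFun_apply]
    rw [this]
    exact (Pi.basisFun ℂ (Fin n)).linearIndependent
  · rw [List.ofFn_eq_map]
    refine exists_eq_prod (w' := fun j => if j ∈ lam then (0, 0, Pi.single j ((-1) ^ ((j : ℕ) + 1)))
      else (Pi.single j 1, 0, 0)) ?_ (List.nodup_finRange n) fun i _ => ?_
    · intro i j
      have h1 : psi n (w i) (if j ∈ lam then (0, 0, Pi.single j ((-1) ^ ((j : ℕ) + 1)))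
          else (Pi.single j 1, 0, 0)) = comps lam (w i) j := by
        simp only [comps, LinearMap.coe_mk, AddHom.coe_mk]
        split_ifs
        · have := neg_one_pow_mul_self (j + 1)
          simp only [psi, Pi.zero_apply, mul_zero, add_zero, zero_add]
          rw [Finset.sum_eq_single j]
          · rw [Pi.single_eq_same]
            linear_combination (w i).1 j * this
          · intro k _ hk
            simp [hk]
          · simp
        · simp [psi, Pi.single_apply]
      rw [h1, (hw i).2, Pi.single_apply]
      simp only [eq_comm]
    · rw [rho_cartanSpinor, (hw i).1]
      simp [cartanSpinor]

end Spinor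

end

end BKP

namespace BKP

section Partition

theorem mem_toPartition {n : ℕ} {mu : Finset (Fin n)} {i : ℕ+} :
    i ∈ toPartition n mu ↔ ∃ j ∈ mu, (j : ℕ) + 1 = i := by
  simp only [toPartition, Finset.mem_image]
  refine exists_congr fun j => and_congr_right fun _ => ?_
  rw [← PNat.coe_inj, Nat.succPNat_coe]

theorem bound_toPartition_le {n : ℕ} (mu : Finset (Fin n)) : bound (toPartition n mu) ≤ n := by
  rw [bound_le]
  intro i hi
  obtain ⟨j, -, h⟩ := mem_toPartition.mp hi
  omega

/-- The order embedding of `Fin n` as the positive integers at most `n`. -/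
def succPNatEmb (n : ℕ) : Fin n ↪o ℕ+ :=
  OrderEmbedding.ofStrictMono (fun i => Nat.succPNat i) fun _ _ h => Nat.succPNat_lt_succPNat.mpr h

theorem toPartition_eq_map (n : ℕ) (mu : Finset (Fin n)) :
    toPartition n mu = mu.map (succPNatEmb n).toEmbedding := by
  rw [Finset.map_eq_image]; rfl

theorem toPartition_injective (n : ℕ) : Function.Injective (toPartition n) := by
  intro mu nu h
  rw [toPartition_eq_map, toPartition_eq_map] at h
  exact Finset.map_injective _ h

theorem exists_toPartition_eq {n : ℕ} {lam : Finset ℕ+} (h : bound lam ≤ n) :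
    ∃ mu, toPartition n mu = lam := by
  rw [bound_le] at h
  refine ⟨Finset.univ.filter fun j : Fin n => Nat.succPNat j ∈ lam, ?_⟩
  ext i
  rw [mem_toPartition]
  constructor
  · rintro ⟨j, hj, h⟩
    rw [Finset.mem_filter] at hj
    rw [← show Nat.succPNat j = i from PNat.coe_injective (by simpa using h)]
    exact hj.2
  · intro hi
    have h1 := h i hi
    have h2 := i.pos
    refine ⟨⟨i - 1, by omega⟩, ?_, by simp; omega⟩
    rw [Finset.mem_filter]
    refine ⟨Finset.mem_univ _, ?_⟩
    rwa [show Nat.succPNat ((⟨i - 1, by omega⟩ : Fin n) : ℕ) = i from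
      PNat.coe_injective (by simp; omega)]

theorem size_eq_sum_aug (mu : Finset ℕ+) : size mu = ∑ k ∈ aug mu, k := by
  unfold size aug
  split_ifs
  · rw [Finset.sum_image (by simp)]
  · rw [Finset.sum_insert (by simp), Finset.sum_image (by simp), zero_add]

theorem sum_aug_toPartition {M : Type*} [AddCommMonoid M] (n : ℕ) (f : Finset ℕ → M) :
    ∑ mu : Finset (Fin n), f (aug (toPartition n mu))
      = ∑ K ∈ (Finset.range (n + 1)).powerset.filter fun K => Even K.card, f K := by
  refine Finset.sum_bij (fun mu _ => aug (toPartition n mu)) ?_ ?_ ?_ fun _ _ => rfl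
  · intro mu _
    rw [Finset.mem_filter, Finset.mem_powerset]
    exact ⟨fun k hk => Finset.mem_range.mpr (Nat.lt_succ_of_le
      (le_of_mem_aug (bound_toPartition_le mu) hk)), even_card_aug _⟩
  · intro mu _ nu _ h
    exact toPartition_injective n (aug_injective h)
  · intro K hK
    rw [Finset.mem_filter, Finset.mem_powerset] at hK
    obtain ⟨lam, rfl⟩ := exists_aug_eq hK.2
    obtain ⟨mu, rfl⟩ := exists_toPartition_eq (n := n) (lam := lam)
      (bound_le_of_aug_subset fun k hk => by
        have := Finset.mem_range.mp (hK.1 hk)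
        omega)
    exact ⟨mu, Finset.mem_univ _, rfl⟩

end Partition

section Tau

theorem shuffle_map {R ι κ : Type*} [CommRing R] (g : κ → ι) (l : List κ)
    (f : List ι → List ι → R) :
    shuffle (l.map g) f = shuffle l fun K C => f (K.map g) (C.map g) := by
  induction l generalizing f with
  | nil => rfl
  | cons a l ih => simp [shuffle, ih]

theorem shuffle_range {R : Type*} [CommRing R] (n : ℕ) (f : List ℕ → List ℕ → R) :
    shuffle (List.range n).reverse f = ∑ K ∈ (Finset.range n).powerset,
      (-1) ^ (n * K.card + ∑ k ∈ K, k + (K.card + 1).choose 2)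
        * f (descIn n K) (descCompl n K) := by
  induction n generalizing f with
  | zero => simp [shuffle, descIn, descCompl]
  | succ n ih =>
    rw [List.range_succ, List.reverse_append, List.reverse_singleton, List.singleton_append,
      shuffle, ih, ih, Finset.range_add_one, Finset.sum_powerset_insert (by simp), add_comm]
    congr 1
    · refine Finset.sum_congr rfl fun K hK => ?_
      have hn : n ∉ K := fun h => by simpa using Finset.mem_powerset.mp hK h
      have hlen : (descIn n K).length = K.card := by
        rw [← sort_eq_descIn, Finset.length_sort]
        exact fun k hk => by simpa using Finset.mem_powerset.mp hK hk
      rw [descIn_succ, if_neg hn, descCompl_succ, if_neg hn, hlen, ← mul_assoc, ← pow_add]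
      congr 2
      ring
    · refine Finset.sum_congr rfl fun K hK => ?_
      have hn : n ∉ K := fun h => by simpa using Finset.mem_powerset.mp hK h
      rw [descIn_succ, if_pos (Finset.mem_insert_self _ _), descCompl_succ,
        if_pos (Finset.mem_insert_self _ _), Finset.card_insert_of_notMem hn, Finset.sum_insert hn]
      have h1 : ∀ k < n, k ∈ insert n K ↔ k ∈ K := fun k hk => by simp [hk.ne]
      rw [descIn_congr h1, descCompl_congr h1]
      congr 1
      rw [Nat.choose_succ_succ' (K.card + 1), Nat.choose_one_right]
      have : (n + 1) * (K.card + 1) + (n + ∑ k ∈ K, k) + (K.card + 1 + (K.card + 1).choose (1 + 1))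
          = (n * K.card + ∑ k ∈ K, k + (K.card + 1).choose 2) + 2 * (n + K.card + 1) := by ring
      rw [this, pow_add _ _ (2 * _), pow_mul]
      simp

variable (lam : Finset ℕ+) (r : ℕ → ℕ → ℂ)

theorem matW_inr_left (a : ℕ) (b : ℕ ⊕ ℕ) :
    matW lam r (Sum.inr a) b = MvPolynomial.C (matW0 lam r (Sum.inr a) b) := by
  cases b <;>
  · simp only [matW0, matW, Matrix.map_apply, Matrix.sub_apply, Matrix.transpose_apply, halfW]
    split_ifs <;> simp

theorem matW_inr_right (a b : ℕ) :
    matW lam r (Sum.inl a) (Sum.inr b) = MvPolynomial.C (matW0 lam r (Sum.inl a) (Sum.inr b)) := by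
  rw [matW_skew, matW_inr_left, matW0_skew, map_neg, neg_neg]

theorem matW_inl_inl {i j : ℕ} (h : j < i) :
    matW lam r (Sum.inl i) (Sum.inl j) = -elemQ i j := by
  simp [matW, halfW, h, not_lt.mpr h.le]

theorem tauTrunc_eq_sum_powerset (n : ℕ) :
    tauTrunc lam r n = ∑ K ∈ (Finset.range (n + 1)).powerset,
      (-1) ^ ((n + 1) * K.card + ∑ k ∈ K, k + (K.card + 1).choose 2)
        * (pf (-elemQ) (descIn (n + 1) K)
          * MvPolynomial.C (pf (matW0 lam r) (complRows n K))) := by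
  set B : Matrix (ℕ ⊕ ℕ) (ℕ ⊕ ℕ) (MvPolynomial ℕ ℂ) := (matW0 lam r).map MvPolynomial.C with hB
  have hAB : matW lam r = (matW lam r - B) + B := (sub_add_cancel _ _).symm
  rw [tauTrunc, rows, hAB, pf_add, shuffle_map, shuffle_range]
  · refine Finset.sum_congr rfl fun K _ => ?_
    congr 2
    · rw [pf_map]
      refine pf_congr_of_pairwise ((pairwise_descIn _ _).imp fun {a b} h => ?_)
      rw [Matrix.submatrix_apply, Matrix.sub_apply, matW_inl_inl _ _ h, hB, Matrix.map_apply,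
        matW0_inl_inl, map_zero, sub_zero]
      rfl
    · rw [hB, ← map_pf]
      rfl
  · intro a ha b hb
    obtain ⟨i, -, rfl⟩ := List.mem_map.mp ha
    obtain ⟨j, -, rfl⟩ := List.mem_map.mp hb
    rw [Matrix.sub_apply, matW_inr_right, hB, Matrix.map_apply, sub_self]
  · intro a ha b _
    obtain ⟨i, -, rfl⟩ := List.mem_map.mp ha
    rw [Matrix.sub_apply, matW_inr_left, hB, Matrix.map_apply, sub_self]

variable {lam}

theorem tauTrunc_eq_sum {n : ℕ} (hn : bound lam ≤ n) :
    tauTrunc lam r n = ∑ mu : Finset (Fin n),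
      MvPolynomial.C (restrict n (coords lam r) mu) * schurQ (toPartition n mu) := by
  have hlen : ∀ K ∈ (Finset.range (n + 1)).powerset, (descIn (n + 1) K).length = K.card := by
    intro K hK
    rw [← sort_eq_descIn, Finset.length_sort]
    exact fun k hk => by simpa [Nat.lt_succ_iff] using Finset.mem_powerset.mp hK hk
  have h1 : ∀ mu : Finset (Fin n),
      MvPolynomial.C (restrict n (coords lam r) mu) * schurQ (toPartition n mu)
      = (-1) ^ (∑ k ∈ aug (toPartition n mu), k) * (pf elemQ (descIn (n + 1) (aug (toPartition n mu)))
        * MvPolynomial.C (pf (matW0 lam r) (complRows n (aug (toPartition n mu))))) := by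
    intro mu
    have hb := bound_toPartition_le mu
    rw [restrict, coords_eq hn hb, schurQ, sort_eq_descIn (n := n + 1)
      fun k hk => Nat.lt_succ_of_le (le_of_mem_aug hb hk), ← size_eq_sum_aug, map_mul, map_pow,
      map_neg, map_one]
    ring
  simp only [h1]
  rw [sum_aug_toPartition n (fun K => (-1) ^ (∑ k ∈ K, k) * (pf elemQ (descIn (n + 1) K)
    * MvPolynomial.C (pf (matW0 lam r) (complRows n K)))), tauTrunc_eq_sum_powerset,
    ← Finset.sum_filter_add_sum_filter_not _ (fun K => Even K.card), add_eq_left.mpr]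
  · refine Finset.sum_congr rfl fun K hK => ?_
    rw [Finset.mem_filter] at hK
    rw [pf_neg, hlen K hK.1]
    obtain ⟨l, hl⟩ := hK.2
    have e1 : (K.card + 1).choose 2 = l + 2 * (l * l) := by
      rw [Nat.choose_two_right, hl]
      refine Nat.div_eq_of_eq_mul_left (by norm_num) ?_
      rw [Nat.add_sub_cancel]
      ring
    rw [e1, hl, show (l + l) / 2 = l by omega]
    have e2 : (n + 1) * (l + l) + ∑ k ∈ K, k + (l + 2 * (l * l))
        = (∑ k ∈ K, k) + l + 2 * ((n + 1) * l + l * l) := by ring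
    rw [e2, pow_add _ _ (2 * _), pow_mul, pow_add]
    have e3 : ((-1) ^ l * (-1) ^ l : MvPolynomial ℕ ℂ) = 1 := by rw [← mul_pow]; simp
    linear_combination ((-1) ^ (∑ k ∈ K, k) * pf elemQ (descIn (n + 1) K)
      * MvPolynomial.C (pf (matW0 lam r) (complRows n K))) * e3
  · refine Finset.sum_eq_zero fun K hK => ?_
    rw [Finset.mem_filter, Nat.not_even_iff_odd] at hK
    rw [pf_odd _ _ (by rw [hlen K hK.1]; exact hK.2), zero_mul, mul_zero]

end Tau

end BKP

namespace BKP

noncomputable section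

section QFunctions

theorem coeff_theta_pow_of_lt {i j : ℕ} (h : i < j) : PowerSeries.coeff i (theta ^ j) = 0 := by
  have h1 : (PowerSeries.X : PowerSeries (MvPolynomial ℕ ℂ)) ∣ theta := by
    rw [PowerSeries.X_dvd_iff, ← PowerSeries.coeff_zero_eq_constantCoeff_apply, theta,
      PowerSeries.coeff_mk]
    simp
  exact PowerSeries.X_pow_dvd_iff.mp (pow_dvd_pow_of_dvd h1 j) i h

theorem q_eq_sum {i m : ℕ} (h : i ≤ m) : q i = ∑ j ∈ Finset.range (m + 1),
    ((j.factorial : ℂ)⁻¹) • PowerSeries.coeff i (theta ^ j) := by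
  simp only [q, MvPolynomial.C_mul']
  refine Finset.sum_subset (Finset.range_mono (by omega)) fun j _ hj => ?_
  rw [coeff_theta_pow_of_lt (by simpa using hj), smul_zero]

theorem q_zero : q 0 = 1 := by
  simp [q]

theorem rescale_theta : PowerSeries.rescale (-1 : MvPolynomial ℕ ℂ) theta = -theta := by
  ext1 k
  rw [PowerSeries.coeff_rescale, map_neg, theta, PowerSeries.coeff_mk]
  split_ifs with h
  · rw [h.neg_one_pow]; ring
  · simp

theorem neg_one_pow_smul_coeff_theta_pow (i j : ℕ) :
    (-1 : ℂ) ^ j • PowerSeries.coeff i (theta ^ j) = (-1) ^ i * PowerSeries.coeff i (theta ^ j) := by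
  rw [← PowerSeries.coeff_rescale, map_pow (PowerSeries.rescale _), rescale_theta]
  rcases neg_one_pow_eq_or ℂ j with h | h
  · rw [h, one_smul, Even.neg_pow]
    by_contra hj
    rw [Nat.not_even_iff_odd] at hj
    rw [hj.neg_one_pow] at h
    norm_num at h
  · rw [h, neg_one_smul, Odd.neg_pow, map_neg]
    by_contra hj
    rw [Nat.not_odd_iff_even] at hj
    rw [hj.neg_one_pow] at h
    norm_num at h

/-- The relation `q(z) q(-z) = 1`. -/
theorem sum_antidiagonal_q {m : ℕ} (hm : m ≠ 0) :
    ∑ p ∈ Finset.HasAntidiagonal.antidiagonal m, (-1) ^ p.2 * (q p.1 * q p.2) = 0 := by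
  set P : Polynomial ℂ := PowerSeries.trunc (m + 1) (PowerSeries.exp ℂ) with hP
  set P' : Polynomial ℂ := PowerSeries.trunc (m + 1) (PowerSeries.evalNegHom (PowerSeries.exp ℂ))
    with hP'
  obtain ⟨T, hT⟩ : Polynomial.X ^ (m + 1) ∣ P * P' - 1 := by
    rw [Polynomial.X_pow_dvd_iff]
    intro d hd
    have h := congrArg (PowerSeries.coeff d) (PowerSeries.exp_mul_exp_neg_eq_one (A := ℂ))
    rw [PowerSeries.coeff_mul, PowerSeries.coeff_one] at h
    rw [Polynomial.coeff_sub, Polynomial.coeff_mul, Polynomial.coeff_one, ← h, sub_eq_zero]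
    refine Finset.sum_congr rfl fun p hp => ?_
    have := Finset.HasAntidiagonal.mem_antidiagonal.mp hp
    rw [hP, hP', PowerSeries.coeff_trunc, PowerSeries.coeff_trunc, if_pos (by omega),
      if_pos (by omega)]
  have hT' := congrArg (fun p => PowerSeries.coeff m (Polynomial.aeval theta p)) hT
  simp only [map_mul, map_sub, map_one, map_pow, Polynomial.aeval_X] at hT'
  have h0 : PowerSeries.coeff m (theta ^ (m + 1) * Polynomial.aeval theta T) = 0 := by
    rw [PowerSeries.coeff_mul]
    refine Finset.sum_eq_zero fun p hp => ?_
    have := Finset.HasAntidiagonal.mem_antidiagonal.mp hp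
    rw [coeff_theta_pow_of_lt (by omega), zero_mul]
  rw [h0, PowerSeries.coeff_one, if_neg hm, sub_zero, PowerSeries.coeff_mul] at hT'
  rw [← hT']
  refine Finset.sum_congr rfl fun p hp => ?_
  have hp := Finset.HasAntidiagonal.mem_antidiagonal.mp hp
  have hdeg : ∀ f : PowerSeries ℂ, (PowerSeries.trunc (m + 1) f).natDegree < m + 1 := fun f =>
    PowerSeries.natDegree_trunc_lt f m
  have h1 : PowerSeries.coeff p.1 (Polynomial.aeval theta P) = q p.1 := by
    rw [q_eq_sum (show p.1 ≤ m by omega), Polynomial.aeval_eq_sum_range' (hdeg _), map_sum]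
    refine Finset.sum_congr rfl fun j hj => ?_
    rw [PowerSeries.coeff_smul, PowerSeries.coeff_trunc, if_pos (Finset.mem_range.mp hj),
      PowerSeries.coeff_exp]
    simp
  have h2 : PowerSeries.coeff p.2 (Polynomial.aeval theta P') = (-1) ^ p.2 * q p.2 := by
    rw [q_eq_sum (show p.2 ≤ m by omega), Polynomial.aeval_eq_sum_range' (hdeg _), map_sum,
      Finset.mul_sum]
    refine Finset.sum_congr rfl fun j hj => ?_
    rw [PowerSeries.coeff_smul, PowerSeries.coeff_trunc, if_pos (Finset.mem_range.mp hj),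
      PowerSeries.evalNegHom, PowerSeries.coeff_rescale, PowerSeries.coeff_exp, mul_smul_comm,
      ← neg_one_pow_smul_coeff_theta_pow, smul_smul, mul_comm]
    simp
  rw [h1, h2]
  ring

/-- The span of the products `q_{α_1} ⋯ q_{α_k}` with `∑ α_i = d` and `∑ α_i² ≥ s`. -/
def qSpan (d s : ℕ) : Submodule ℂ (MvPolynomial ℕ ℂ) :=
  Submodule.span ℂ {f | ∃ α : Multiset ℕ, α.sum = d ∧ s ≤ (α.map (· ^ 2)).sum ∧ f = (α.map q).prod}

theorem prod_q_mem_qSpan (α : Multiset ℕ) : (α.map q).prod ∈ qSpan α.sum (α.map (· ^ 2)).sum :=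
  Submodule.subset_span ⟨α, rfl, le_rfl, rfl⟩

theorem qSpan_mono (d : ℕ) {s s' : ℕ} (h : s ≤ s') : qSpan d s' ≤ qSpan d s :=
  Submodule.span_mono fun _ ⟨α, h1, h2, h3⟩ => ⟨α, h1, h.trans h2, h3⟩

theorem mul_mem_qSpan {d s d' s' : ℕ} {f g : MvPolynomial ℕ ℂ} (hf : f ∈ qSpan d s)
    (hg : g ∈ qSpan d' s') : f * g ∈ qSpan (d + d') (s + s') := by
  have h : qSpan d s * qSpan d' s' ≤ qSpan (d + d') (s + s') := by
    rw [qSpan, qSpan, Submodule.span_mul_span]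
    refine Submodule.span_mono ?_
    rintro _ ⟨_, ⟨α, h1, h2, rfl⟩, _, ⟨β, h1', h2', rfl⟩, rfl⟩
    refine ⟨α + β, ?_, ?_, ?_⟩
    · rw [Multiset.sum_add, h1, h1']
    · rw [Multiset.map_add, Multiset.sum_add]
      omega
    · simp
  exact h (Submodule.mul_mem_mul hf hg)

theorem one_mem_qSpan : (1 : MvPolynomial ℕ ℂ) ∈ qSpan 0 0 := by
  simpa using prod_q_mem_qSpan 0

theorem q_mem_qSpan (m : ℕ) : q m ∈ qSpan m (m ^ 2) := by
  simpa using prod_q_mem_qSpan {m}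

theorem q_mul_q_mem_qSpan (a b : ℕ) : q a * q b ∈ qSpan (a + b) (a ^ 2 + b ^ 2) :=
  mul_mem_qSpan (q_mem_qSpan a) (q_mem_qSpan b)

theorem q_mul_self_mem_qSpan {i : ℕ} (hi : i ≠ 0) : q i * q i ∈ qSpan (2 * i) (2 * i ^ 2 + 1) := by
  have h := sum_antidiagonal_q (m := 2 * i) (by omega)
  rw [← Finset.add_sum_erase _ _ (show (i, i) ∈ Finset.HasAntidiagonal.antidiagonal (2 * i) by
    rw [Finset.HasAntidiagonal.mem_antidiagonal]; ring), add_eq_zero_iff_eq_neg] at h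
  have h1 : q i * q i = ((-1 : ℂ) ^ i) • ((-1) ^ i * (q i * q i)) := by
    rw [MvPolynomial.smul_eq_C_mul, ← mul_assoc, map_pow, map_neg, map_one, ← mul_pow]
    simp
  rw [h1, h]
  refine Submodule.smul_mem _ _ (Submodule.neg_mem _ (Submodule.sum_mem _ fun p hp => ?_))
  rw [Finset.mem_erase, Finset.HasAntidiagonal.mem_antidiagonal] at hp
  have h2 : ((-1) ^ p.2 * (q p.1 * q p.2) : MvPolynomial ℕ ℂ) = ((-1 : ℂ) ^ p.2) • (q p.1 * q p.2) := by
    rw [MvPolynomial.smul_eq_C_mul]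
    simp
  rw [h2]
  refine Submodule.smul_mem _ _ ?_
  rw [← hp.2]
  refine qSpan_mono _ ?_ (q_mul_q_mem_qSpan p.1 p.2)
  have hne : p.1 ≠ p.2 := by
    intro he
    refine hp.1 (Prod.ext ?_ ?_) <;> simp only <;> omega
  rcases lt_or_gt_of_ne hne with hlt | hlt
  · obtain ⟨k, hk⟩ : ∃ k, i = p.1 + k := ⟨i - p.1, by omega⟩
    have : p.2 = i + k := by omega
    rw [this, hk]
    have : 0 < k := by omega
    nlinarith
  · obtain ⟨k, hk⟩ : ∃ k, i = p.2 + k := ⟨i - p.2, by omega⟩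
    have : p.1 = i + k := by omega
    rw [this, hk]
    have : 0 < k := by omega
    nlinarith

/-! ### The leading term of a Schur Q-function -/

/-- The normalization factor of `q_j` in the leading terms. -/
def qScale (j : ℕ) : MvPolynomial ℕ ℂ := MvPolynomial.C (if j = 0 then (Real.sqrt 2 : ℂ) else 1) * q j

/-- The matrix of the leading terms of the elementary Schur Q-functions. -/
def leadQ : Matrix ℕ ℕ (MvPolynomial ℕ ℂ) :=
  Matrix.of fun i j => qScale i * MvPolynomial.C (1 / 2) * qScale j

theorem C_mul_mem {W : Submodule ℂ (MvPolynomial ℕ ℂ)} {f : MvPolynomial ℕ ℂ} (hf : f ∈ W) (c : ℂ) :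
    MvPolynomial.C c * f ∈ W := by
  rw [← MvPolynomial.smul_eq_C_mul]
  exact W.smul_mem c hf

theorem neg_one_pow_mul_mem {W : Submodule ℂ (MvPolynomial ℕ ℂ)} {f : MvPolynomial ℕ ℂ} (hf : f ∈ W)
    (k : ℕ) : (-1) ^ k * f ∈ W := by
  rcases neg_one_pow_eq_or (MvPolynomial ℕ ℂ) k with h | h
  · rwa [h, one_mul]
  · rw [h, neg_one_mul]
    exact W.neg_mem hf

theorem leadQ_mem_qSpan (i j : ℕ) : leadQ i j ∈ qSpan (i + j) (i ^ 2 + j ^ 2) := by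
  have : leadQ i j = MvPolynomial.C (if i = 0 then (Real.sqrt 2 : ℂ) else 1)
      * (MvPolynomial.C (1 / 2) * (MvPolynomial.C (if j = 0 then (Real.sqrt 2 : ℂ) else 1)
        * (q i * q j))) := by
    simp only [leadQ, Matrix.of_apply, qScale]
    ring
  rw [this]
  exact C_mul_mem (C_mul_mem (C_mul_mem (q_mul_q_mem_qSpan i j) _) _) _

theorem elemQ_sub_leadQ_mem_qSpan {i j : ℕ} (h : j < i) :
    elemQ i j - leadQ i j ∈ qSpan (i + j) (i ^ 2 + j ^ 2 + 1) := by
  have hi : i ≠ 0 := by omega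
  by_cases hj : j = 0
  · subst hj
    have hs : ((Real.sqrt 2 : ℂ)⁻¹) = 1 / 2 * (Real.sqrt 2 : ℂ) := by
      have h2 : (Real.sqrt 2 : ℂ) ≠ 0 := by
        rw [Complex.ofReal_ne_zero]
        positivity
      have := inv_sqrt_two_mul_self
      field_simp at this ⊢
      linear_combination this
    have : elemQ i 0 - leadQ i 0 = 0 := by
      simp only [elemQ, leadQ, Matrix.of_apply, qScale, hi, if_true, if_false, q_zero, hs, map_mul,
        map_one]
      ring
    rw [this]
    exact Submodule.zero_mem _
  · have : elemQ i j - leadQ i j = ∑ k ∈ Finset.Icc 1 j, (-1) ^ k * (q (i + k) * q (j - k)) := by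
      simp only [elemQ, leadQ, Matrix.of_apply, qScale, hi, hj, if_false, map_one, mul_assoc]
      ring
    rw [this]
    refine Submodule.sum_mem _ fun k hk => neg_one_pow_mul_mem ?_ k
    rw [Finset.mem_Icc] at hk
    rw [show i + j = i + k + (j - k) by omega]
    refine qSpan_mono _ ?_ (q_mul_q_mem_qSpan _ _)
    obtain ⟨c, rfl⟩ : ∃ c, j = k + c := ⟨j - k, by omega⟩
    rw [Nat.add_sub_cancel_left]
    nlinarith

theorem contract_mem {W : Submodule ℂ (MvPolynomial ℕ ℂ)} {ι : Type*} {d : ι → MvPolynomial ℕ ℂ}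
    {l : List ι} {g : List ι → MvPolynomial ℕ ℂ}
    (h : ∀ a l', l'.Sublist l → l.Perm (a :: l') → d a * g l' ∈ W) : contract d l g ∈ W := by
  rw [contract_eq_sum]
  refine Submodule.sum_mem _ fun k _ => ?_
  rw [mul_assoc]
  refine neg_one_pow_mul_mem (h _ _ (List.eraseIdx_sublist _ _) ?_) _
  exact (List.getElem_cons_eraseIdx_perm k.isLt).symm

theorem pf_leadQ_mem_qSpan (l : List ℕ) : pf leadQ l ∈ qSpan l.sum (l.map (· ^ 2)).sum := by
  induction hn : l.length using Nat.strong_induction_on generalizing l with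
  | _ n ih =>
  cases l with
  | nil => simpa [pf_nil] using one_mem_qSpan
  | cons a l =>
    rw [pf_cons]
    refine contract_mem fun b l' _ hp => ?_
    have h1 := mul_mem_qSpan (leadQ_mem_qSpan a b)
      (ih l'.length (by have := hp.length_eq; simp at hn this; omega) l' rfl)
    have h2 := hp.sum_eq
    have h3 := (hp.map (· ^ 2)).sum_eq
    simp only [List.sum_cons, List.map_cons] at h2 h3 ⊢
    rwa [h2, h3, ← add_assoc, ← add_assoc]

theorem pf_elemQ_sub_mem_qSpan {l : List ℕ} (hl : l.Pairwise fun a b => b < a) :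
    pf elemQ l - pf leadQ l ∈ qSpan l.sum ((l.map (· ^ 2)).sum + 1) := by
  induction hn : l.length using Nat.strong_induction_on generalizing l with
  | _ n ih =>
  cases l with
  | nil => simp [pf_nil]
  | cons a l =>
    rw [List.pairwise_cons] at hl
    have hsplit : pf elemQ (a :: l) - pf leadQ (a :: l)
        = contract (elemQ a - leadQ a) l (pf elemQ)
          + contract (leadQ a) l fun l' => pf elemQ l' - pf leadQ l' := by
      rw [contract_sub, sub_eq_add_neg (elemQ a), contract_add_left, contract_neg_left, pf_cons,
        pf_cons]
      ring
    rw [hsplit]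
    refine Submodule.add_mem _ (contract_mem fun b l' hs hp => ?_) (contract_mem fun b l' hs hp => ?_)
    all_goals
      have hb : b < a := hl.1 b (hp.mem_iff.mpr (by simp))
      have hlen : l'.length < n := by have := hp.length_eq; simp at hn this; omega
      have ih' := ih l'.length hlen (hl.2.sublist hs) rfl
      have h2 := hp.sum_eq
      have h3 := (hp.map (· ^ 2)).sum_eq
      simp only [List.sum_cons, List.map_cons] at h2 h3 ⊢
      rw [h2, h3]
    · have h1 : pf elemQ l' ∈ qSpan l'.sum (l'.map (· ^ 2)).sum := by
        rw [← sub_add_cancel (pf elemQ l') (pf leadQ l')]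
        exact Submodule.add_mem _ (qSpan_mono _ (Nat.le_succ _) ih') (pf_leadQ_mem_qSpan l')
      rw [show a + (b + l'.sum) = a + b + l'.sum by ring,
        show a ^ 2 + (b ^ 2 + (l'.map (· ^ 2)).sum) + 1
          = a ^ 2 + b ^ 2 + 1 + (l'.map (· ^ 2)).sum by ring]
      exact mul_mem_qSpan (elemQ_sub_leadQ_mem_qSpan hb) h1
    · rw [show a + (b + l'.sum) = a + b + l'.sum by ring,
        show a ^ 2 + (b ^ 2 + (l'.map (· ^ 2)).sum) + 1
          = a ^ 2 + b ^ 2 + ((l'.map (· ^ 2)).sum + 1) by ring]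
      exact mul_mem_qSpan (leadQ_mem_qSpan a b) ih'

theorem contract_const {R : Type*} [CommRing R] (c v : R) (l : List ℕ) :
    contract (fun _ => c) l (fun _ => v) = if Odd l.length then c * v else 0 := by
  induction l with
  | nil => simp [contract]
  | cons a l ih =>
    rw [contract, ih, List.length_cons]
    by_cases h : Odd l.length
    · rw [if_pos h, if_neg (by simpa using h.add_one), sub_self]
    · rw [if_neg h, if_pos (Nat.odd_add_one.mpr h), sub_zero]

theorem pf_const {R : Type*} [CommRing R] (c : R) (l : List ℕ) (hl : Even l.length) :
    pf (Matrix.of fun _ _ => c) l = c ^ (l.length / 2) := by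
  induction hn : l.length using Nat.strong_induction_on generalizing l with
  | _ n ih =>
  cases l with
  | nil => simp [pf_nil, ← hn]
  | cons a l =>
    obtain ⟨k, hk⟩ := hl
    rw [List.length_cons] at hk hn
    rw [pf_cons]
    refine (contract_congr (d' := fun _ => c) (g' := fun _ => c ^ (k - 1)) (fun _ _ => rfl) ?_).trans ?_
    rotate_left
    · rw [contract_const, if_pos ⟨k - 1, by omega⟩, ← pow_succ', ← hn]
      congr 1; omega
    · intro l' _ hl'
      rw [ih l'.length (by omega) l' ⟨k - 1, by omega⟩ rfl]
      congr 1; omega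

theorem pf_leadQ {l : List ℕ} (hl : Even l.length) :
    ∃ c : ℂ, c ≠ 0 ∧ pf leadQ l = c • (l.map q).prod := by
  have h2 : (Real.sqrt 2 : ℂ) ≠ 0 := by
    rw [Complex.ofReal_ne_zero]
    positivity
  have h1 : ∀ l : List ℕ, ∃ c : ℂ, c ≠ 0 ∧ (l.map qScale).prod = c • (l.map q).prod := by
    intro l
    induction l with
    | nil => exact ⟨1, one_ne_zero, by simp⟩
    | cons a l ih =>
      obtain ⟨c, hc, h⟩ := ih
      refine ⟨(if a = 0 then (Real.sqrt 2 : ℂ) else 1) * c, mul_ne_zero (by split_ifs <;> simp [h2]) hc, ?_⟩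
      rw [List.map_cons, List.prod_cons, h, List.map_cons, List.prod_cons, qScale,
        MvPolynomial.smul_eq_C_mul, MvPolynomial.smul_eq_C_mul, map_mul]
      ring
  obtain ⟨c, hc, h⟩ := h1 l
  refine ⟨c * (1 / 2) ^ (l.length / 2), mul_ne_zero hc (by simp), ?_⟩
  have h3 := pf_scale (Matrix.of fun _ _ : ℕ => (MvPolynomial.C (1 / 2 : ℂ) : MvPolynomial ℕ ℂ)) qScale l
  rw [pf_const _ _ hl, h] at h3
  refine h3.trans ?_
  simp only [MvPolynomial.smul_eq_C_mul, map_mul, map_pow]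
  ring

end QFunctions

end

end BKP

namespace BKP

noncomputable section

section Independence

@[to_additive]
theorem prod_aug {M : Type*} [CommMonoid M] (lam : Finset ℕ+) {f : ℕ → M} (hf : f 0 = 1) :
    ∏ i ∈ aug lam, f i = ∏ i ∈ lam, f i := by
  have h : ∏ i ∈ lam.image (fun i : ℕ+ => (i : ℕ)), f i = ∏ i ∈ lam, f i :=
    Finset.prod_image fun a _ b _ hab => PNat.coe_injective hab
  rw [aug]
  split_ifs
  · exact h
  · rw [Finset.prod_insert_of_eq_one_if_notMem fun _ => hf, h]

@[to_additive]
theorem prod_map_sort {M : Type*} [CommMonoid M] (s : Finset ℕ) (f : ℕ → M) :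
    ((s.sort (fun a b => b ≤ a)).map f).prod = ∏ i ∈ s, f i := by
  have h := congrArg (fun m => (Multiset.map f m).prod) (Finset.sort_eq s (fun a b => b ≤ a))
  simp only [Multiset.map_coe, Multiset.prod_coe] at h
  exact h

theorem sum_sort_aug (lam : Finset ℕ+) : ((aug lam).sort (fun a b => b ≤ a)).sum = size lam := by
  have := sum_map_sort (aug lam) id
  rwa [List.map_id, sum_aug lam rfl] at this

theorem schurQ_sub_mem_qSpan (lam : Finset ℕ+) : ∃ c : ℂ, c ≠ 0 ∧
    schurQ lam - c • ∏ i ∈ lam, q i ∈ qSpan (size lam) (∑ i ∈ lam, (i : ℕ) ^ 2 + 1) := by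
  obtain ⟨c, hc, h⟩ := pf_leadQ (l := (aug lam).sort (fun a b => b ≤ a)) (by
    rw [Finset.length_sort]
    exact even_card_aug lam)
  refine ⟨c, hc, ?_⟩
  rw [prod_map_sort, prod_aug lam q_zero] at h
  have h2 := pf_elemQ_sub_mem_qSpan (l := (aug lam).sort (fun a b => b ≤ a))
    (Finset.sortedGT_sort (aug lam)).pairwise
  rwa [h, sum_sort_aug, sum_map_sort, sum_aug lam (by simp)] at h2

theorem prod_q_mem_qSpan' (lam : Finset ℕ+) :
    ∏ i ∈ lam, q i ∈ qSpan (size lam) (∑ i ∈ lam, (i : ℕ) ^ 2) := by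
  have := prod_q_mem_qSpan (lam.val.map (fun i : ℕ+ => (i : ℕ)))
  rw [Multiset.map_map, Multiset.map_map] at this
  exact this

theorem schurQ_mem_qSpan (lam : Finset ℕ+) : schurQ lam ∈ qSpan (size lam) 0 := by
  obtain ⟨c, -, h⟩ := schurQ_sub_mem_qSpan lam
  rw [← sub_add_cancel (schurQ lam) (c • ∏ i ∈ lam, q i)]
  exact Submodule.add_mem _ (qSpan_mono _ (Nat.zero_le _) h)
    (Submodule.smul_mem _ _ (qSpan_mono _ (Nat.zero_le _) (prod_q_mem_qSpan' lam)))

/-- The span of the Schur Q-functions of weight `d`. -/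
def schurSpan (d : ℕ) : Submodule ℂ (MvPolynomial ℕ ℂ) :=
  Submodule.span ℂ (Set.range fun lam : {lam : Finset ℕ+ // size lam = d} => schurQ lam)

theorem schurQ_mem_schurSpan (lam : Finset ℕ+) : schurQ lam ∈ schurSpan (size lam) :=
  Submodule.subset_span ⟨⟨lam, rfl⟩, rfl⟩

theorem sum_sq_le (α : Multiset ℕ) : (α.map (· ^ 2)).sum ≤ α.sum ^ 2 := by
  induction α using Multiset.induction_on with
  | empty => simp
  | cons a α ih =>
    rw [Multiset.map_cons, Multiset.sum_cons, Multiset.sum_cons]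
    nlinarith [Nat.zero_le (a * α.sum)]

theorem qSpan_le_schurSpan (k d s : ℕ) (h : d ^ 2 < s + k) : qSpan d s ≤ schurSpan d := by
  induction k generalizing s with
  | zero =>
    rw [qSpan, Submodule.span_le]
    rintro f ⟨α, h1, h2, -⟩
    have := sum_sq_le α
    rw [h1] at this
    omega
  | succ k ih =>
    have ih := ih (s + 1) (by omega)
    rw [qSpan, Submodule.span_le]
    rintro f ⟨α, h1, h2, rfl⟩
    have hα : α.filter (0 < ·) + α.filter (¬ 0 < ·) = α := Multiset.filter_add_not _ _
    have h0 : α.filter (¬ 0 < ·) = Multiset.replicate (α.filter (¬ 0 < ·)).card 0 :=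
      Multiset.eq_replicate_card.mpr fun b hb => by simpa using (Multiset.mem_filter.mp hb).2
    set β := α.filter (0 < ·) with hβ
    have hpos : ∀ b ∈ β, 0 < b := fun b hb => (Multiset.mem_filter.mp hb).2
    rw [h0] at hα
    rw [← hα] at h1 h2 ⊢
    simp only [Multiset.sum_add, Multiset.map_add, Multiset.map_replicate, Multiset.sum_replicate,
      Multiset.prod_add, Multiset.prod_replicate, q_zero, one_pow, smul_zero, add_zero, mul_one,
      ne_eq, OfNat.ofNat_ne_zero, not_false_eq_true, zero_pow] at h1 h2 ⊢
    clear_value β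
    clear h0 hα hβ
    by_cases hn : β.Nodup
    · set lam : Finset ℕ+ := (⟨β, hn⟩ : Finset ℕ).subtype (0 < ·) with hlam
      have hq : ∏ i ∈ lam, q i = (β.map q).prod :=
        Finset.prod_subtype_of_mem (s := (⟨β, hn⟩ : Finset ℕ)) q hpos
      have hsq : ∑ i ∈ lam, (i : ℕ) ^ 2 = (β.map (· ^ 2)).sum :=
        Finset.sum_subtype_of_mem (s := (⟨β, hn⟩ : Finset ℕ)) (· ^ 2) hpos
      have hs : size lam = d := by
        rw [← h1]
        refine (Finset.sum_subtype_of_mem (s := (⟨β, hn⟩ : Finset ℕ)) id hpos).trans ?_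
        rw [Finset.sum, Multiset.map_id]
      obtain ⟨c, hc, hmem⟩ := schurQ_sub_mem_qSpan lam
      rw [hq, hsq, hs] at hmem
      have hmem := ih (qSpan_mono d (by omega) hmem)
      have : (β.map q).prod
          = c⁻¹ • (schurQ lam - (schurQ lam - c • (β.map q).prod)) := by
        rw [sub_sub_cancel, inv_smul_smul₀ hc]
      rw [this]
      refine Submodule.smul_mem _ _ (Submodule.sub_mem _ ?_ hmem)
      rw [← hs]
      exact schurQ_mem_schurSpan lam
    · rw [Multiset.nodup_iff_ne_cons_cons] at hn
      push Not at hn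
      obtain ⟨i, γ, rfl⟩ := hn
      have hi : 0 < i := hpos i (by simp)
      have := mul_mem_qSpan (q_mul_self_mem_qSpan hi.ne') (prod_q_mem_qSpan γ)
      simp only [Multiset.sum_cons, Multiset.map_cons, Multiset.prod_cons] at h1 h2 ⊢
      rw [show 2 * i + γ.sum = d by omega] at this
      rw [← mul_assoc]
      exact ih (qSpan_mono d (by omega) this)

theorem mul_mem_qSpan_zero {d d' : ℕ} {f g : MvPolynomial ℕ ℂ} (hf : f ∈ qSpan d 0)
    (hg : g ∈ qSpan d' 0) : f * g ∈ qSpan (d + d') 0 := by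
  have := mul_mem_qSpan hf hg
  rwa [add_zero] at this

theorem coeff_theta_pow_mem_qSpan_of_lt {m : ℕ}
    (h : ∀ a < m, PowerSeries.coeff a theta ∈ qSpan a 0) (j : ℕ) :
    ∀ a < m, PowerSeries.coeff a (theta ^ j) ∈ qSpan a 0 := by
  induction j with
  | zero =>
    intro a _
    rw [pow_zero, PowerSeries.coeff_one]
    split_ifs with ha
    · rw [ha]
      exact one_mem_qSpan
    · exact Submodule.zero_mem _
  | succ j ih =>
    intro a ha
    rw [pow_succ, PowerSeries.coeff_mul]
    refine Submodule.sum_mem _ fun p hp => ?_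
    rw [Finset.HasAntidiagonal.mem_antidiagonal] at hp
    rw [← hp]
    exact mul_mem_qSpan_zero (ih _ (by omega)) (h _ (by omega))

theorem coeff_theta_mem_qSpan (m : ℕ) : PowerSeries.coeff m theta ∈ qSpan m 0 := by
  induction m using Nat.strong_induction_on with
  | _ m ih =>
  have h0 : PowerSeries.coeff 0 theta = 0 := by simp [theta]
  rcases Nat.eq_zero_or_pos m with rfl | hm
  · rw [h0]
    exact Submodule.zero_mem _
  have hj : ∀ j ≠ 1, PowerSeries.coeff m (theta ^ j) ∈ qSpan m 0 := by
    intro j hj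
    rcases j with _ | _ | j
    · rw [pow_zero, PowerSeries.coeff_one, if_neg hm.ne']
      exact Submodule.zero_mem _
    · exact absurd rfl hj
    · rw [pow_succ, PowerSeries.coeff_mul]
      refine Submodule.sum_mem _ fun p hp => ?_
      rw [Finset.HasAntidiagonal.mem_antidiagonal] at hp
      by_cases h1 : p.1 = 0
      · rw [coeff_theta_pow_of_lt (by omega), zero_mul]
        exact Submodule.zero_mem _
      by_cases h2 : p.2 = 0
      · rw [h2, h0, mul_zero]
        exact Submodule.zero_mem _
      rw [← hp]
      exact mul_mem_qSpan_zero (coeff_theta_pow_mem_qSpan_of_lt (fun a ha => ih a ha) _ _ (by omega))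
        (ih _ (by omega))
  have hq := q_eq_sum (le_refl m)
  rw [← Finset.add_sum_erase _ _ (show 1 ∈ Finset.range (m + 1) by simpa using hm), pow_one,
    Nat.factorial_one, Nat.cast_one, inv_one, one_smul, ← sub_eq_iff_eq_add] at hq
  rw [← hq]
  exact Submodule.sub_mem _ (qSpan_mono _ (Nat.zero_le _) (q_mem_qSpan m))
    (Submodule.sum_mem _ fun j hj' => Submodule.smul_mem _ _ (hj j (Finset.ne_of_mem_erase hj')))

/-- The variable `t_{2k+1}` has weight `2k+1`. -/
def wt (k : ℕ) : ℕ := 2 * k + 1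

theorem X_mem_qSpan (k : ℕ) : (MvPolynomial.X k : MvPolynomial ℕ ℂ) ∈ qSpan (wt k) 0 := by
  have := coeff_theta_mem_qSpan (2 * k + 1)
  rwa [theta, PowerSeries.coeff_mk, if_pos (odd_two_mul_add_one k),
    show (2 * k + 1) / 2 = k by omega] at this

theorem X_pow_mem_qSpan (k j : ℕ) :
    (MvPolynomial.X k ^ j : MvPolynomial ℕ ℂ) ∈ qSpan (j * wt k) 0 := by
  induction j with
  | zero => simpa using one_mem_qSpan
  | succ j ih =>
    rw [pow_succ, add_mul, one_mul]
    exact mul_mem_qSpan_zero ih (X_mem_qSpan k)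

theorem monomial_mem_qSpan (e : ℕ →₀ ℕ) :
    (MvPolynomial.monomial e (1 : ℂ)) ∈ qSpan (Finsupp.weight wt e) 0 := by
  induction e using Finsupp.induction_linear with
  | zero => simpa using one_mem_qSpan
  | add e f he hf =>
    have := mul_mem_qSpan_zero he hf
    rwa [MvPolynomial.monomial_mul, one_mul, ← map_add] at this
  | single k j =>
    rw [← MvPolynomial.X_pow_eq_monomial, Finsupp.weight_single]
    exact X_pow_mem_qSpan k j

theorem monomial_mem_schurSpan {e : ℕ →₀ ℕ} {d : ℕ} (h : Finsupp.weight wt e = d) :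
    (MvPolynomial.monomial e (1 : ℂ)) ∈ schurSpan d :=
  qSpan_le_schurSpan (d ^ 2 + 1) d 0 (by omega) (h ▸ monomial_mem_qSpan e)

open MvPolynomial in
theorem isWeightedHomogeneous_coeff_theta_pow (i j : ℕ) :
    IsWeightedHomogeneous wt (PowerSeries.coeff i (theta ^ j)) i := by
  induction j generalizing i with
  | zero =>
    rw [pow_zero, PowerSeries.coeff_one]
    split_ifs with h
    · rw [h]
      exact isWeightedHomogeneous_one ℂ wt
    · exact isWeightedHomogeneous_zero ℂ wt i
  | succ j ih =>
    rw [pow_succ, PowerSeries.coeff_mul]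
    refine IsWeightedHomogeneous.sum _ _ _ fun p hp => ?_
    rw [← Finset.HasAntidiagonal.mem_antidiagonal.mp hp]
    refine (ih _).mul ?_
    rw [theta, PowerSeries.coeff_mk]
    split_ifs with h
    · have := isWeightedHomogeneous_X ℂ wt (p.2 / 2)
      rwa [wt, Nat.two_mul_div_two_add_one_of_odd h] at this
    · exact isWeightedHomogeneous_zero ℂ wt _

theorem qSpan_le_weightedHomogeneousSubmodule (d s : ℕ) :
    qSpan d s ≤ MvPolynomial.weightedHomogeneousSubmodule ℂ wt d := by
  have hq : ∀ m, MvPolynomial.IsWeightedHomogeneous wt (q m) m := fun m =>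
    MvPolynomial.IsWeightedHomogeneous.sum _ _ _ fun j _ =>
      (isWeightedHomogeneous_coeff_theta_pow m j).C_mul _
  rw [qSpan, Submodule.span_le]
  rintro f ⟨α, rfl, -, rfl⟩
  rw [SetLike.mem_coe, MvPolynomial.mem_weightedHomogeneousSubmodule]
  induction α using Multiset.induction_on with
  | empty => simpa using MvPolynomial.isWeightedHomogeneous_one ℂ wt
  | cons a α ih =>
    rw [Multiset.map_cons, Multiset.prod_cons, Multiset.sum_cons]
    exact (hq a).mul ih

theorem isWeightedHomogeneous_schurQ (lam : Finset ℕ+) :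
    MvPolynomial.IsWeightedHomogeneous wt (schurQ lam) (size lam) :=
  qSpan_le_weightedHomogeneousSubmodule _ _ (schurQ_mem_qSpan lam)

/-- Strict partitions of size `d` as partitions of `d`. -/
def toNatPartition {d : ℕ} (lam : {lam : Finset ℕ+ // size lam = d}) : Nat.Partition d where
  parts := lam.1.val.map fun i : ℕ+ => (i : ℕ)
  parts_pos := by
    intro i hi
    obtain ⟨a, -, rfl⟩ := Multiset.mem_map.mp hi
    exact a.pos
  parts_sum := lam.2

theorem toNatPartition_injective (d : ℕ) : Function.Injective (toNatPartition (d := d)) :=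
  fun _ _ h => Subtype.ext (Finset.val_injective
    (Multiset.map_injective PNat.coe_injective (congrArg Nat.Partition.parts h)))

theorem toNatPartition_mem_distincts {d : ℕ} (lam : {lam : Finset ℕ+ // size lam = d}) :
    toNatPartition lam ∈ Nat.Partition.distincts d := by
  rw [Nat.Partition.distincts, Finset.mem_filter]
  exact ⟨Finset.mem_univ _, lam.1.nodup.map PNat.coe_injective⟩

instance (d : ℕ) : Fintype {lam : Finset ℕ+ // size lam = d} :=
  Fintype.ofInjective _ (toNatPartition_injective d)

/-- The exponent vector with `2k+1` having multiplicity `e k` in the partition `p`. -/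
def oddExponent {d : ℕ} (p : Nat.Partition.odds d) : ℕ →₀ ℕ :=
  Multiset.toFinsupp (p.1.parts.map (· / 2))

theorem map_wt_oddExponent {d : ℕ} (p : Nat.Partition.odds d) :
    (p.1.parts.map (· / 2)).map wt = p.1.parts := by
  rw [Multiset.map_map]
  conv_rhs => rw [← Multiset.map_id p.1.parts]
  refine Multiset.map_congr rfl fun i hi => ?_
  have h := (Finset.mem_filter.mp p.2).2 i hi
  exact Nat.two_mul_div_two_add_one_of_odd (Nat.not_even_iff_odd.mp h)

theorem oddExponent_injective (d : ℕ) : Function.Injective (oddExponent (d := d)) := by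
  intro p p' h
  have h := congrArg (Multiset.map wt) (Multiset.toFinsupp.injective h)
  rw [map_wt_oddExponent, map_wt_oddExponent] at h
  exact Subtype.ext (Nat.Partition.ext h)

theorem weight_toFinsupp (α : Multiset ℕ) :
    Finsupp.weight wt (Multiset.toFinsupp α) = (α.map wt).sum := by
  induction α using Multiset.induction_on with
  | empty => simp
  | cons a α ih =>
    rw [← Multiset.singleton_add, map_add, map_add, ih, Multiset.toFinsupp_singleton,
      Finsupp.weight_single]
    simp

theorem linearIndependent_schurQ (d : ℕ) :
    LinearIndependent ℂ fun lam : {lam : Finset ℕ+ // size lam = d} => schurQ lam := by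
  classical
  rw [linearIndependent_iff_card_le_finrank_span]
  have h1 : Fintype.card {lam : Finset ℕ+ // size lam = d} ≤ (Nat.Partition.distincts d).card := by
    rw [← Fintype.card_coe]
    exact Fintype.card_le_of_injective
      (fun lam => (⟨toNatPartition lam, toNatPartition_mem_distincts lam⟩ :
        Nat.Partition.distincts d))
      fun a b h => toNatPartition_injective d (congrArg Subtype.val h)
  rw [← Nat.Partition.card_odds_eq_card_distincts, ← Fintype.card_coe] at h1
  refine h1.trans ?_
  have hmem : ∀ p : Nat.Partition.odds d,
      MvPolynomial.monomial (oddExponent p) (1 : ℂ) ∈ schurSpan d := fun p =>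
    monomial_mem_schurSpan (by rw [oddExponent, weight_toFinsupp, map_wt_oddExponent, p.1.parts_sum])
  have hli : LinearIndependent ℂ fun p : Nat.Partition.odds d =>
      (⟨_, hmem p⟩ : schurSpan d) := by
    refine LinearIndependent.of_comp (schurSpan d).subtype ?_
    have := (MvPolynomial.basisMonomials ℕ ℂ).linearIndependent.comp _ (oddExponent_injective d)
    rw [MvPolynomial.coe_basisMonomials] at this
    exact this
  have : FiniteDimensional ℂ (schurSpan d) := FiniteDimensional.span_of_finite ℂ (Set.finite_range _)
  exact hli.fintype_card_le_finrank

end Independence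

end

end BKP

namespace BKP

noncomputable section

section Expansion

/-- The power series `∑_μ ξ_μ Q_μ`. -/
def expansion (ξ : Finset ℕ+ → ℂ) : MvPowerSeries ℕ ℂ := fun e =>
  ∑ lam : {lam : Finset ℕ+ // size lam = Finsupp.weight wt e}, ξ lam * (schurQ lam).coeff e

theorem coeff_expansion (ξ : Finset ℕ+ → ℂ) (e : ℕ →₀ ℕ) : MvPowerSeries.coeff e (expansion ξ)
    = ∑ lam : {lam : Finset ℕ+ // size lam = Finsupp.weight wt e}, ξ lam * (schurQ lam).coeff e :=
  rfl

theorem coeff_schurQ_eq_zero {mu : Finset ℕ+} {e : ℕ →₀ ℕ} (h : size mu ≠ Finsupp.weight wt e) :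
    (schurQ mu).coeff e = 0 :=
  (isWeightedHomogeneous_schurQ mu).coeff_eq_zero e h.symm

theorem hasSum_coeff_expansion (ξ : Finset ℕ+ → ℂ) (e : ℕ →₀ ℕ) :
    HasSum (fun mu => ξ mu * (schurQ mu).coeff e) (MvPowerSeries.coeff e (expansion ξ)) := by
  rw [coeff_expansion]
  have h := hasSum_sum_of_ne_finset_zero (f := fun mu => ξ mu * (schurQ mu).coeff e)
    (s := (Finset.univ : Finset {lam : Finset ℕ+ // size lam = Finsupp.weight wt e}).map
      (Function.Embedding.subtype _)) (L := SummationFilter.unconditional _) fun mu hmu => by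
      rw [coeff_schurQ_eq_zero, mul_zero]
      intro hs
      exact hmu (Finset.mem_map.mpr ⟨⟨mu, hs⟩, Finset.mem_univ _, rfl⟩)
  rw [Finset.sum_map] at h
  exact h

theorem isSchurQExpansion_iff {τ : MvPowerSeries ℕ ℂ} {ξ : Finset ℕ+ → ℂ} :
    IsSchurQExpansion τ ξ ↔ τ = expansion ξ := by
  have h : IsSchurQExpansion (expansion ξ) ξ := by
    rw [IsSchurQExpansion, MvPowerSeries.WithPiTopology.hasSum_iff_hasSum_coeff]
    intro e
    simpa using hasSum_coeff_expansion ξ e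
  exact ⟨fun h' => HasSum.unique h' h, fun h' => h' ▸ h⟩

theorem expansion_injective : Function.Injective expansion := by
  intro ξ ξ' h
  funext mu
  have hli := linearIndependent_schurQ (size mu)
  rw [Fintype.linearIndependent_iff] at hli
  refine sub_eq_zero.mp (hli (fun lam => ξ lam - ξ' lam) ?_ ⟨mu, rfl⟩)
  ext e
  rw [MvPolynomial.coeff_sum, MvPolynomial.coeff_zero]
  simp only [MvPolynomial.coeff_smul, smul_eq_mul]
  by_cases he : size mu = Finsupp.weight wt e
  · rw [he]
    simp only [sub_mul, Finset.sum_sub_distrib]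
    rw [← coeff_expansion, ← coeff_expansion, h, sub_self]
  · refine Finset.sum_eq_zero fun lam _ => ?_
    rw [coeff_schurQ_eq_zero (by rwa [lam.2]), mul_zero]

theorem bound_le_size (mu : Finset ℕ+) : bound mu ≤ size mu :=
  bound_le.mpr fun _ hi => Finset.single_le_sum (f := fun i : ℕ+ => (i : ℕ)) (fun _ _ => Nat.zero_le _) hi

theorem coeff_tauTrunc (lam : Finset ℕ+) (r : ℕ → ℕ → ℂ) {n : ℕ} {e : ℕ →₀ ℕ} (hn : bound lam ≤ n)
    (he : Finsupp.weight wt e ≤ n) :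
    (tauTrunc lam r n).coeff e = MvPowerSeries.coeff e (expansion (coords lam r)) := by
  rw [tauTrunc_eq_sum r hn, MvPolynomial.coeff_sum]
  simp only [MvPolynomial.coeff_C_mul, restrict]
  have h := hasSum_sum_of_ne_finset_zero (f := fun mu => coords lam r mu * (schurQ mu).coeff e)
    (s := (Finset.univ : Finset (Finset (Fin n))).map ⟨_, toPartition_injective n⟩)
    (L := SummationFilter.unconditional _) fun mu hmu => by
      rw [coeff_schurQ_eq_zero, mul_zero]
      intro hs
      obtain ⟨nu, rfl⟩ := exists_toPartition_eq ((bound_le_size mu).trans (hs.le.trans he))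
      exact hmu (Finset.mem_map.mpr ⟨nu, Finset.mem_univ _, rfl⟩)
  rw [Finset.sum_map] at h
  exact h.unique (hasSum_coeff_expansion (coords lam r) e)

theorem isBKPTau_iff {lam : Finset ℕ+} {r : ℕ → ℕ → ℂ} {τ : MvPowerSeries ℕ ℂ} :
    IsBKPTau lam r τ ↔ τ = expansion (coords lam r) := by
  have h : IsBKPTau lam r (expansion (coords lam r)) := by
    rw [IsBKPTau, MvPowerSeries.WithPiTopology.tendsto_iff_coeff_tendsto]
    intro e
    refine tendsto_nhds_of_eventually_eq ?_
    filter_upwards [Filter.eventually_ge_atTop (max (bound lam) (Finsupp.weight wt e))] with n hn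
    rw [MvPolynomial.coeff_coe]
    exact coeff_tauTrunc lam r (le_of_max_le_left hn) (le_of_max_le_right hn)
  exact ⟨fun h' => tendsto_nhds_unique h' h, fun h' => h' ▸ h⟩

theorem eq_coords {lam : Finset ℕ+} {r : ℕ → ℕ → ℂ} {τ : MvPowerSeries ℕ ℂ} {ξ : Finset ℕ+ → ℂ}
    (hτ : IsBKPTau lam r τ) (hξ : IsSchurQExpansion τ ξ) : ξ = coords lam r :=
  expansion_injective ((isSchurQExpansion_iff.mp hξ).symm.trans (isBKPTau_iff.mp hτ))

end Expansion

section Parameters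

variable {β : Type*} [LinearOrder β]

theorem coe_map_mem_aug (f : β ↪o ℕ+) {lam : Finset β} {i : β} :
    (f i : ℕ) ∈ aug (lam.map f.toEmbedding) ↔ i ∈ lam := by
  rw [coe_mem_aug]
  exact Finset.mem_map' f.toEmbedding

theorem map_symmDiff (f : β ↪o ℕ+) (lam mu : Finset β) : (symmDiff lam mu).map f.toEmbedding
    = symmDiff (lam.map f.toEmbedding) (mu.map f.toEmbedding) := by
  rw [Finset.map_eq_image, Finset.map_eq_image, Finset.map_eq_image,
    Finset.image_symmDiff _ _ f.toEmbedding.injective]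

theorem aug_map_symmDiff_singleton (f : β ↪o ℕ+) (lam : Finset β) (i : β) :
    aug ((symmDiff lam {i}).map f.toEmbedding)
      = symmDiff (aug (lam.map f.toEmbedding)) {(f i : ℕ), 0} := by
  rw [map_symmDiff, Finset.map_singleton]
  exact aug_symmDiff_singleton' _ _

theorem aug_map_symmDiff_pair (f : β ↪o ℕ+) (lam : Finset β) {i j : β} (h : j < i) :
    aug ((symmDiff lam {i, j}).map f.toEmbedding)
      = symmDiff (aug (lam.map f.toEmbedding)) {(f i : ℕ), (f j : ℕ)} := by
  rw [map_symmDiff, Finset.map_insert, Finset.map_singleton]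
  exact aug_symmDiff_pair _ (f.injective.ne h.ne')

/-- Coordinates with all parts in the range of `f` of the `τ`-function of `λ` have `λ` as the lowest
index. -/
theorem isLowest_coords (f : β ↪o ℕ+) (lam : Finset β) (r : ℕ → ℕ → ℂ) :
    IsLowest (fun mu => coords (lam.map f.toEmbedding) r (mu.map f.toEmbedding)) lam := by
  refine ⟨?_, fun d hd => ⟨?_, fun j hj => ?_⟩⟩
  · obtain ⟨ε, hε, h⟩ := coords_self (lam.map f.toEmbedding)
    beta_reduce
    rw [h]
    rcases hε with rfl | rfl <;> simp
  · obtain ⟨ε, -, h⟩ := coords_near (f d).pos (aug_map_symmDiff_singleton f lam d)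
    beta_reduce
    rw [h, if_pos ((coe_map_mem_aug f).mpr hd), mul_zero]
  · obtain ⟨ε, -, h⟩ := coords_near (PNat.coe_lt_coe _ _ |>.mpr (f.strictMono hj))
      (aug_map_symmDiff_pair f lam hj)
    beta_reduce
    rw [h, if_pos ((coe_map_mem_aug f).mpr hd), mul_zero]

/-- The parameters `r` can be chosen to match given coordinates at the neighbours of `λ`. -/
theorem exists_parameters (f : β ↪o ℕ+) (lam : Finset β) (y : Finset β → ℂ) :
    ∃ r : ℕ → ℕ → ℂ, ∀ (mu : Finset β) (a b : ℕ), b < a → a ∉ aug (lam.map f.toEmbedding) →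
      aug (mu.map f.toEmbedding) = symmDiff (aug (lam.map f.toEmbedding)) {a, b} →
      coords (lam.map f.toEmbedding) r (mu.map f.toEmbedding) = y mu := by
  have h : ∀ a b : ℕ, ∃ v : ℂ, ∀ (mu : Finset β), b < a → a ∉ aug (lam.map f.toEmbedding) →
      aug (mu.map f.toEmbedding) = symmDiff (aug (lam.map f.toEmbedding)) {a, b} →
      ∀ r : ℕ → ℕ → ℂ, r a b = v →
        coords (lam.map f.toEmbedding) r (mu.map f.toEmbedding) = y mu := by
    intro a b
    by_cases hex : b < a ∧ ∃ mu : Finset β,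
      aug (mu.map f.toEmbedding) = symmDiff (aug (lam.map f.toEmbedding)) {a, b}
    · obtain ⟨hab, mu, hmu⟩ := hex
      obtain ⟨ε, hε, h⟩ := coords_near hab hmu
      refine ⟨ε * y mu, fun mu' _ ha hmu' r hr => ?_⟩
      obtain rfl : mu' = mu :=
        Finset.map_injective _ (aug_injective (hmu'.trans hmu.symm))
      rw [h, if_neg ha, hr, ← mul_assoc]
      rcases hε with rfl | rfl <;> simp
    · exact ⟨0, fun mu hab _ hmu => absurd ⟨hab, mu, hmu⟩ hex⟩
  choose r hr using h
  exact ⟨r, fun mu a b hab ha hmu => hr a b mu hab ha hmu r rfl⟩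

theorem exists_eq_smul_coords (f : β ↪o ℕ+) {x : Finset β → ℂ} (hx : CartanPlucker x)
    {lam : Finset β} (hlam : IsLowest x lam) :
    ∃ (r : ℕ → ℕ → ℂ) (c : ℂ), c ≠ 0 ∧
      x = c • fun mu => coords (lam.map f.toEmbedding) r (mu.map f.toEmbedding) := by
  obtain ⟨ε, hε, hself⟩ := coords_self (lam.map f.toEmbedding)
  have hε' : ε * ε = 1 := by rcases hε with rfl | rfl <;> norm_num
  have hc : ε * x lam ≠ 0 := mul_ne_zero (left_ne_zero_of_mul_eq_one hε') hlam.1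
  obtain ⟨r, hr⟩ := exists_parameters f lam ((ε * x lam)⁻¹ • x)
  refine ⟨r, ε * x lam, hc, hx.ext (((cartanPlucker_coords _ r).comp f).smul _) hlam.1 ?_ ?_ ?_⟩
  · rw [Pi.smul_apply, hself, smul_eq_mul, mul_right_comm, hε', one_mul]
  · intro i
    by_cases hi : i ∈ lam
    · rw [(hlam.2 i hi).1, Pi.smul_apply, show coords _ r _ = 0 from
        ((isLowest_coords f lam r).2 i hi).1, smul_zero]
    · rw [Pi.smul_apply, hr _ _ _ (f i).pos (mt (coe_map_mem_aug f).mp hi)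
        (aug_map_symmDiff_singleton f lam i), Pi.smul_apply, smul_inv_smul₀ hc]
  · intro i j hj
    by_cases hi : i ∈ lam
    · rw [(hlam.2 i hi).2 j hj, Pi.smul_apply, show coords _ r _ = 0 from
        ((isLowest_coords f lam r).2 i hi).2 j hj, smul_zero]
    · rw [Pi.smul_apply, hr _ _ _ (PNat.coe_lt_coe _ _ |>.mpr (f.strictMono hj))
        (mt (coe_map_mem_aug f).mp hi) (aug_map_symmDiff_pair f lam hj), Pi.smul_apply,
        smul_inv_smul₀ hc]

theorem parameter_eq_of_coords_eq {lam : Finset ℕ+} {r r' : ℕ → ℕ → ℂ} {n : ℕ}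
    (hlam : bound lam ≤ n) (h : ∀ mu, bound mu ≤ n → coords lam r mu = coords lam r' mu) {a b : ℕ}
    (hab : b < a) (han : a ≤ n) (ha : a ∉ aug lam) : r a b = r' a b := by
  obtain ⟨mu, hmu⟩ : ∃ mu, aug mu = symmDiff (aug lam) {a, b} := by
    refine exists_aug_eq ?_
    rw [even_card_symmDiff, Finset.card_pair hab.ne', Nat.even_add]
    exact iff_of_true (even_card_aug lam) even_two
  have hb : bound mu ≤ n := by
    refine bound_le_of_aug_subset fun k hk => ?_
    rw [hmu, Finset.mem_symmDiff, Finset.mem_insert, Finset.mem_singleton] at hk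
    rcases hk with hk | hk
    · exact le_of_mem_aug hlam hk.1
    · omega
  obtain ⟨ε, hε, hnear⟩ := coords_near hab hmu
  have := h mu hb
  rw [hnear, hnear, if_neg ha, if_neg ha] at this
  refine mul_left_cancel₀ ?_ this
  rcases hε with rfl | rfl <;> norm_num

theorem inr_mem_rows {n k : ℕ} : Sum.inr k ∈ rows n ↔ k ≤ n := by
  simp [rows]

theorem matW0_congr {lam : Finset ℕ+} {r r' : ℕ → ℕ → ℂ} {n : ℕ}
    (h : ∀ a b, b < a → a ≤ n → a ∉ aug lam → r a b = r' a b) {a b : ℕ ⊕ ℕ} (ha : a ∈ rows n)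
    (hb : b ∈ rows n) : matW0 lam r a b = matW0 lam r' a b := by
  have hU : ∀ a ∈ rows n, ∀ b, halfW lam r a b = halfW lam r' a b := by
    rintro (a | a) ha (b | b)
    · rfl
    · rfl
    · have ha' := inr_mem_rows.mp ha
      simp only [halfW]
      split_ifs with hc <;> first | rfl | rw [h a b hc.1 ha' hc.2.1]
    · have ha' := inr_mem_rows.mp ha
      simp only [halfW]
      split_ifs with hc <;> first | rfl | rw [h a b hc.1 ha' hc.2.1]
  simp only [matW0, matW, Matrix.map_apply, Matrix.sub_apply, Matrix.transpose_apply, hU a ha b,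
    hU b hb a]

end Parameters

section Uniqueness

theorem restrict_eq (n : ℕ) (ξ : Finset ℕ+ → ℂ) :
    restrict n ξ = fun mu => ξ (mu.map (succPNatEmb n).toEmbedding) := by
  funext mu
  rw [restrict, toPartition_eq_map]

theorem IsLowest.smul {α : Type*} [LinearOrder α] {x : Finset α → ℂ} {lam : Finset α}
    (h : IsLowest x lam) {c : ℂ} (hc : c ≠ 0) : IsLowest (c • x) lam :=
  ⟨mul_ne_zero hc h.1, fun d hd => ⟨mul_eq_zero_of_right _ (h.2 d hd).1,
    fun j hj => mul_eq_zero_of_right _ ((h.2 d hd).2 j hj)⟩⟩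

theorem isLowest_restrict_coords {n : ℕ} (lam : Finset (Fin n)) (r : ℕ → ℕ → ℂ) :
    IsLowest (restrict n (coords (toPartition n lam) r)) lam := by
  rw [restrict_eq, toPartition_eq_map]
  exact isLowest_coords _ lam r

theorem cartanPlucker_restrict_coords (n : ℕ) (lam : Finset ℕ+) (r : ℕ → ℕ → ℂ) :
    CartanPlucker (restrict n (coords lam r)) := by
  rw [restrict_eq]
  exact (cartanPlucker_coords lam r).comp _

theorem restrict_coords_ne_zero {n : ℕ} {lam : Finset ℕ+} (r : ℕ → ℕ → ℂ) (h : bound lam ≤ n) :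
    restrict n (coords lam r) ≠ 0 := by
  obtain ⟨lam, rfl⟩ := exists_toPartition_eq h
  exact fun h => (isLowest_restrict_coords lam r).1 (congrFun h lam)

theorem eq_of_smul_restrict_coords_eq {n : ℕ} {lam lam' : Finset ℕ+} {r r' : ℕ → ℕ → ℂ} {c c' : ℂ}
    (hlam : bound lam ≤ n) (hlam' : bound lam' ≤ n) (hc : c ≠ 0)
    (h : c • restrict n (coords lam r) = c' • restrict n (coords lam' r')) :
    lam' = lam ∧ c' = c ∧
      ∀ a ∈ rows n, ∀ b ∈ rows n, matW0 lam' r' a b = matW0 lam r a b := by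
  have hc' : c' ≠ 0 := by
    rintro rfl
    rw [zero_smul] at h
    exact smul_ne_zero hc (restrict_coords_ne_zero r hlam) h
  obtain rfl : lam' = lam := by
    obtain ⟨lam, rfl⟩ := exists_toPartition_eq hlam
    obtain ⟨lam', rfl⟩ := exists_toPartition_eq hlam'
    have h1 := (isLowest_restrict_coords lam r).smul hc
    have h2 := (isLowest_restrict_coords lam' r').smul hc'
    rw [← h] at h2
    rw [IsLowest.unique ((cartanPlucker_restrict_coords n _ r).smul c) h1 h2]
  have hmu : ∀ mu, bound mu ≤ n → c * coords lam' r mu = c' * coords lam' r' mu := by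
    intro mu hb
    obtain ⟨mu, rfl⟩ := exists_toPartition_eq hb
    exact congrFun h mu
  obtain rfl : c' = c := by
    obtain ⟨ε, hε, hself⟩ := coords_self lam'
    have := hmu lam' hlam
    rw [hself, hself] at this
    refine mul_right_cancel₀ ?_ this.symm
    rcases hε with rfl | rfl <;> norm_num
  refine ⟨rfl, rfl, fun a ha b hb => matW0_congr (fun a b hab han ha => ?_) ha hb⟩
  exact parameter_eq_of_coords_eq hlam (fun mu hb => mul_left_cancel₀ hc (hmu mu hb).symm) hab han ha

end Uniqueness

section Infinite

theorem cartanPlucker_of_restrict {ξ : Finset ℕ+ → ℂ} (h : ∀ n, CartanPlucker (restrict n ξ)) :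
    CartanPlucker ξ := by
  intro mu nu
  have hmu := le_max_left (bound mu) (bound nu)
  have hnu := le_max_right (bound mu) (bound nu)
  generalize max (bound mu) (bound nu) = n at hmu hnu
  obtain ⟨mu, rfl⟩ := exists_toPartition_eq hmu
  obtain ⟨nu, rfl⟩ := exists_toPartition_eq hnu
  have h := h n
  rw [restrict_eq] at h
  rw [toPartition_eq_map, toPartition_eq_map, sum_symmDiff_map, Finset.card_map, Finset.card_map]
  exact h mu nu

theorem IsPureSpinorInf.cartanPlucker {ξ : Finset ℕ+ → ℂ} (h : IsPureSpinorInf ξ) :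
    CartanPlucker ξ := by
  refine cartanPlucker_of_restrict fun n => ?_
  rcases h.2 n with h | h
  · rw [h]
    intro mu nu
    simp
  · exact h.cartanPlucker

theorem isPureSpinorInf_coords (lam : Finset ℕ+) (r : ℕ → ℕ → ℂ) : IsPureSpinorInf (coords lam r) := by
  refine ⟨fun h => ?_, fun n => ?_⟩
  · exact restrict_coords_ne_zero (n := bound lam) r le_rfl (by rw [h]; rfl)
  · by_cases h : restrict n (coords lam r) = 0
    · exact Or.inl h
    · exact Or.inr ((cartanPlucker_restrict_coords n lam r).isPureSpinor h)

theorem IsPureSpinorInf.exists_eq_smul_coords {ξ : Finset ℕ+ → ℂ} (h : IsPureSpinorInf ξ) :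
    ∃ (lam : Finset ℕ+) (r : ℕ → ℕ → ℂ) (c : ℂ), c ≠ 0 ∧ ξ = c • coords lam r := by
  obtain ⟨lam, hlam⟩ := exists_isLowest h.1 (f := fun i : ℕ+ => (i : ℕ)) fun _ _ h => h
  obtain ⟨r, c, hc, h⟩ := BKP.exists_eq_smul_coords (OrderIso.refl ℕ+).toOrderEmbedding
    h.cartanPlucker hlam
  refine ⟨lam, r, c, hc, ?_⟩
  have hmap : ∀ mu : Finset ℕ+, mu.map (OrderIso.refl ℕ+).toOrderEmbedding.toEmbedding = mu :=
    fun mu => Finset.map_refl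
  simpa only [hmap] using h

end Infinite

section Scaling

theorem IsPureSpinor.exists_eq_smul_coords {n : ℕ} {s : S n} (h : IsPureSpinor n s) :
    ∃ (lam : Finset ℕ+) (r : ℕ → ℕ → ℂ) (c : ℂ), bound lam ≤ n ∧ c ≠ 0 ∧
      s = c • cartanSpinor n (restrict n (coords lam r)) := by
  obtain ⟨x, rfl⟩ := exists_cartanSpinor s
  have hx : x ≠ 0 := by
    rintro rfl
    exact h.1 (by simp [cartanSpinor])
  obtain ⟨lam, hlam⟩ := exists_isLowest hx (f := fun i : Fin n => (i : ℕ)) fun _ _ h => h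
  obtain ⟨r, c, hc, h⟩ := BKP.exists_eq_smul_coords (succPNatEmb n) h.cartanPlucker hlam
  refine ⟨toPartition n lam, r, c, bound_toPartition_le lam, hc, ?_⟩
  rw [← cartanSpinor_smul, restrict_eq, toPartition_eq_map, ← h]

/-- The entries of the diagonal matrix by which the principal minors are rescaled. -/
def scaling (n : ℕ) (c : ℂ) : ℕ ⊕ ℕ → ℂ
  | Sum.inl k => (-1) ^ k
  | Sum.inr k => if k = 0 then (-1) ^ (∑ k ∈ Finset.range (n + 1), k) * c else 1

theorem scaling_ne_zero (n : ℕ) {c : ℂ} (hc : c ≠ 0) (a : ℕ ⊕ ℕ) : scaling n c a ≠ 0 := by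
  rcases a with k | k
  · exact pow_ne_zero _ (by norm_num)
  · rw [scaling]
    split_ifs
    · exact mul_ne_zero (pow_ne_zero _ (by norm_num)) hc
    · exact one_ne_zero

theorem prod_scaling_minorRows {n : ℕ} (c : ℂ) {mu : Finset ℕ+} (hmu : bound mu ≤ n) :
    ((minorRows n mu).map (scaling n c)).prod = (-1) ^ size mu * c := by
  have hsub : aug mu ⊆ Finset.range (n + 1) := fun k hk =>
    Finset.mem_range.mpr (Nat.lt_succ_of_le (le_of_mem_aug hmu hk))
  have h1 : (((List.range (n + 1)).reverse.filter (fun k => k ∉ aug mu)).map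
      fun k => (-1 : ℂ) ^ k).prod = (-1) ^ ∑ k ∈ Finset.range (n + 1) \ aug mu, k := by
    rw [← Finset.prod_pow_eq_pow_sum, ← Finset.filter_notMem_eq_sdiff]
    exact ((((List.reverse_perm _).filter _).map _).prod_eq)
  have h2 : ((List.range (n + 1)).map fun k => scaling n c (Sum.inr k)).prod
      = (-1) ^ (∑ k ∈ Finset.range (n + 1), k) * c := by
    rw [List.range_succ_eq_map, List.map_cons, List.prod_cons, List.map_map,
      List.prod_eq_one (by simp [scaling]), mul_one]
    rfl
  have h3 := Finset.sum_sdiff (f := fun k => k) hsub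
  rw [minorRows, List.map_append, List.prod_append, List.map_map, List.map_map]
  refine (congrArg₂ (· * ·) h1 h2).trans ?_
  rw [size_eq_sum_aug, ← h3, pow_add, ← mul_assoc, ← mul_assoc, ← pow_add, ← two_mul,
    (even_two_mul _).neg_one_pow, one_mul]

theorem pf_scaling_eq {n : ℕ} {lam : Finset ℕ+} (r : ℕ → ℕ → ℂ) (c : ℂ) (hlam : bound lam ≤ n)
    (mu : Finset (Fin n)) :
    pf (fun a b => scaling n c a * matW0 lam r a b * scaling n c b)
      (minorRows n (toPartition n mu)) = c * restrict n (coords lam r) mu := by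
  have hmu := bound_toPartition_le mu
  refine (pf_scale _ _ _).trans ?_
  rw [prod_scaling_minorRows c hmu, restrict, coords_eq hlam hmu]
  change _ * pf _ (complRows _ _) = _
  ring

end Scaling

end

end BKP

theorem theorem1p4 :
    -- The `τ`-function has a unique Schur-Q expansion; its coefficients satisfy the Cartan–Plücker
    -- relations, are coordinates of a pure spinor, and are Pfaffians of minors of `W_λ|_{t = 0}`.
    (∀ (lam : Finset ℕ+) (r : ℕ → ℕ → ℂ),
      ∃ (τ : MvPowerSeries ℕ ℂ) (ξ : Finset ℕ+ → ℂ),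
        BKP.IsBKPTau lam r τ ∧
        BKP.IsSchurQExpansion τ ξ ∧
        (∀ ξ', BKP.IsSchurQExpansion τ ξ' → ξ' = ξ) ∧
        BKP.CartanPlucker ξ ∧
        BKP.IsPureSpinorInf ξ ∧
        (∀ n : ℕ, (∀ i ∈ lam, (i : ℕ) ≤ n) →
          BKP.tauTrunc lam r n =
            ∑ mu : Finset (Fin n),
              MvPolynomial.C (BKP.restrict n ξ mu) * BKP.schurQ (BKP.toPartition n mu) ∧
          BKP.CartanPlucker (BKP.restrict n ξ) ∧
          BKP.IsPureSpinor n (BKP.cartanSpinor n (BKP.restrict n ξ)) ∧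
          ∀ mu : Finset ℕ+, (∀ i ∈ mu, (i : ℕ) ≤ n) →
            ξ mu = (-1) ^ BKP.size mu * BKP.pf (BKP.matW0 lam r) (BKP.minorRows n mu))) ∧
    -- Every pure spinor arises in this way, from a matrix determined by it, and its Cartan
    -- coordinates are Pfaffians of minors of this matrix.
    (∀ (n : ℕ) (s : BKP.S n), BKP.IsPureSpinor n s →
      ∃ (lam : Finset ℕ+) (r : ℕ → ℕ → ℂ) (c : ℂ) (τ : MvPowerSeries ℕ ℂ) (ξ : Finset ℕ+ → ℂ),
        (∀ i ∈ lam, (i : ℕ) ≤ n) ∧ c ≠ 0 ∧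
        BKP.IsBKPTau lam r τ ∧ BKP.IsSchurQExpansion τ ξ ∧
        s = c • BKP.cartanSpinor n (BKP.restrict n ξ) ∧
        (∀ (lam' : Finset ℕ+) (r' : ℕ → ℕ → ℂ) (c' : ℂ) (τ' : MvPowerSeries ℕ ℂ)
          (ξ' : Finset ℕ+ → ℂ), (∀ i ∈ lam', (i : ℕ) ≤ n) →
          BKP.IsBKPTau lam' r' τ' → BKP.IsSchurQExpansion τ' ξ' →
          s = c' • BKP.cartanSpinor n (BKP.restrict n ξ') →
          lam' = lam ∧ c' = c ∧
            ∀ a ∈ BKP.rows n, ∀ b ∈ BKP.rows n, BKP.matW0 lam' r' a b = BKP.matW0 lam r a b) ∧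
        (BKP.matW0 lam r).transpose = -BKP.matW0 lam r ∧
        (∃ d : ℕ ⊕ ℕ → ℂ, (∀ a, d a ≠ 0) ∧
          ∀ x : Finset (Fin n) → ℂ, s = BKP.cartanSpinor n x →
            ∀ mu, x mu = BKP.pf (fun a b => d a * BKP.matW0 lam r a b * d b)
              (BKP.minorRows n (BKP.toPartition n mu)))) ∧
    -- Every family of coordinates of an infinite-dimensional pure spinor arises in this way.
    (∀ ξ : Finset ℕ+ → ℂ, BKP.IsPureSpinorInf ξ →
      ∃ (lam : Finset ℕ+) (r : ℕ → ℕ → ℂ) (c : ℂ) (τ : MvPowerSeries ℕ ℂ) (ξ' : Finset ℕ+ → ℂ),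
        c ≠ 0 ∧ BKP.IsBKPTau lam r τ ∧ BKP.IsSchurQExpansion τ ξ' ∧ ξ = c • ξ') := by
  open BKP in
  refine ⟨fun lam r => ?_, fun n s hs => ?_, fun ξ hξ => ?_⟩
  · refine ⟨expansion (coords lam r), coords lam r, isBKPTau_iff.mpr rfl,
      isSchurQExpansion_iff.mpr rfl, fun ξ' h => expansion_injective (isSchurQExpansion_iff.mp h).symm,
      cartanPlucker_coords lam r, isPureSpinorInf_coords lam r, fun n hn => ?_⟩
    have hn := bound_le.mpr hn
    exact ⟨tauTrunc_eq_sum r hn, cartanPlucker_restrict_coords n lam r,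
      (cartanPlucker_restrict_coords n lam r).isPureSpinor (restrict_coords_ne_zero r hn),
      fun mu hmu => coords_eq hn (bound_le.mpr hmu)⟩
  · obtain ⟨lam, r, c, hlam, hc, rfl⟩ := hs.exists_eq_smul_coords
    refine ⟨lam, r, c, expansion (coords lam r), coords lam r, bound_le.mp hlam, hc,
      isBKPTau_iff.mpr rfl, isSchurQExpansion_iff.mpr rfl, rfl, ?_, ?_, scaling n c,
      scaling_ne_zero n hc, ?_⟩
    · intro lam' r' c' τ' ξ' hlam' hτ' hξ' h
      rw [eq_coords hτ' hξ', ← cartanSpinor_smul, ← cartanSpinor_smul] at h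
      exact eq_of_smul_restrict_coords_eq hlam (bound_le.mpr hlam') hc (cartanSpinor_injective h)
    · ext a b
      rw [Matrix.transpose_apply, Matrix.neg_apply, matW0_skew]
    · intro x hx mu
      rw [← cartanSpinor_smul] at hx
      rw [pf_scaling_eq r c hlam, ← cartanSpinor_injective hx]
      rfl
  · obtain ⟨lam, r, c, hc, h⟩ := hξ.exists_eq_smul_coords
    exact ⟨lam, r, c, expansion (coords lam r), coords lam r, hc, isBKPTau_iff.mpr rfl,
      isSchurQExpansion_iff.mpr rfl, h⟩
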